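/- **Setting.** Let $\Sigma=\overline\Sigma\setminus V$ be a closed connected oriented surface of genus $g$ with a finite set $V$ of $s$ punctures removed, $s>0$, $2g-2+s>0$ (up to orientation-preserving homeomorphism, $\Sigma=\mathbb H/\Gamma$ with $\Gamma\subset SL(2,\mathbb R)$ discrete, acting freely on the upper half-plane $\mathbb H$, with finite-type quotient having at least one cusp). Let $G=PSL(2,\mathbb R)$, let $T\subset G$ be the upper unipotent subgroup, $H$ the subgroup of the classes of $\mathrm{diag}(h,h^{-1})$, $h>0$, and $\theta$ the class of $\begin{pmatrix}0&-1\\1&0\end{pmatrix}$. A parabolic subgroup is a conjugate of $T$. Let $\mathcal M$ be the set of conjugacy classes of irreducible representations $\pi_1(\Sigma)\to G$ with (nontrivial) parabolic holonomies around all punctures. An *ideal arc* is a nontrivial isotopy class of simple paths between punctures; an *ideal triangulation* $\tau$ is a (finite) maximal set of pairwise nonintersecting ideal arcs, i.e. one that cuts $\Sigma$ into ideal triangles; $\bar\tau$ is the set of its triangles. An arc is *$m$-admissible*, $m\in\mathcal M$, if the holonomies around the punctures at its two ends, transported along the arc to a common base point, lie in distinct parabolic subgroups. $\mathcal M_\tau\subset\mathcal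 M$ is the set of the $m$ for which all arcs of $\tau$ are $m$-admissible. For a set $\alpha$ of ideal arcs, the graph $\Gamma_\alpha$ in $\Sigma$ has one vertex for each end of each arc of $\alpha$, lying on a small circle around the corresponding puncture; its *long* edges are the (truncated) arcs and its *short* edges are the segments of these circles between vertices. A flat graph connection on $\Gamma_\alpha$ is a representation in $G$ of the groupoid of homotopy classes of paths in $\Sigma$ between vertices of $\Gamma_\alpha$. The bundle $\pi:\tilde{\mathcal M}\to\mathcal M$ has as its fibre over $m$ the set of flat graph connections that represent $m$, on $\Gamma_\alpha$ with $\alpha$ the set of all $m$-admissible ideal arcs, whose parallel transports lie in $\theta H$ for long edges and in $T$ for short edges. For a corner $c$ of a triangle $T_c\in\bar\tau$ let $O_c$ be the side opposite to $c$ and $A_c,B_c$ the two other sides. For $f\in\mathbb R_{>0}^{\tau}$, $\epsilon\in\{\pm1\}^{\bar\tau}$ put $$\phi_\tau(f,\epsilon)=\prod_{P\in V}\ \sum_{c\text{ corner at }P}\epsilon(T_c)\frac{f(O_c)}{f(A_c)f(B_c)} .$$ The pair $(f,\epsilon)$ *corresponds* to a point of $\pi^{-1}(\mathcal M_\tau)$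 if this point has parallel transport $\theta\,\mathrm{diag}(f(e),f(e)^{-1})$ along the long edge of each $e\in\tau$ and $\begin{pmatrix}1&u(c)\\0&1\end{pmatrix}$, $u(c)=\epsilon(T_c)\frac{f(O_c)}{f(A_c)f(B_c)}$, along the short edge of each corner $c$ (directed counterclockwise around the puncture). **Proposition (flip transformation).** Let $\tau,\tau'$ be two ideal triangulations of $\Sigma$ related by a single flip on $e\in\tau$, so that the ideal triangles $t_1,t_2\in\bar\tau$ with sides $e,a,b$ and $e,c,d$ respectively (in the cyclic order induced by the orientation of $\Sigma$) are replaced by the ideal triangles $t_1',t_2'\in\bar\tau'$ with sides $e',d,a$ and $e',b,c$ respectively. Let $$(f,\epsilon)\in\mathbb R_{>0}^{\tau}\times\{\pm1\}^{\bar\tau}\setminus\phi_\tau^{-1}(0),\qquad (f',\epsilon')\in\mathbb R_{>0}^{\tau'}\times\{\pm1\}^{\bar\tau'}\setminus\phi_{\tau'}^{-1}(0).$$ Then $(f,\epsilon)$ corresponds to exactly one point of $\pi^{-1}(\mathcal M_\tau)$ and $(f',\epsilon')$ to exactly one point of $\pi^{-1}(\mathcal M_{\tau'})$, and the two pairs correspond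 to one and the same point of $\pi^{-1}(\mathcal M_\tau\cap\mathcal M_{\tau'})$ if and only if $$f'(x)=f(x)\quad\text{for all }x\in\tau',\ x\neq e',$$ $$\epsilon'(t)=\epsilon(t)\quad\text{for all }t\in\bar\tau',\ t\neq t_1',t_2',$$ $$\epsilon'(t_1')\epsilon'(t_2')=\epsilon(t_1)\epsilon(t_2),$$ $$\epsilon'(t_1')f(e)f'(e')=\epsilon(t_2)f(a)f(c)+\epsilon(t_1)f(b)f(d).$$ In particular, if $(f,\epsilon)$, corresponding to a point over $m\in\mathcal M_\tau$, is such that $$\frac{f(a)f(c)}{f(b)f(d)}+\epsilon(t_1)\epsilon(t_2)=0,$$ then $m\notin\mathcal M_{\tau'}$. -/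

import Mathlib

open scoped MatrixGroups UpperHalfPlane Pointwise

noncomputable section

namespace PuncturedSurface

/-! ### The group `G = PSL(2, ℝ)` and its subgroups -/

/-- The structure group `G = PSL(2, ℝ)`. -/
abbrev G : Type := PSL(2, ℝ)

/-- The upper unipotent matrix with entry `u`. -/
def unipMat (u : ℝ) : SL(2, ℝ) := ⟨!![1, u; 0, 1], by simp [Matrix.det_fin_two]⟩

/-- The class in `G` of the upper unipotent matrix with entry `u`. -/
def unip (u : ℝ) : G := QuotientGroup.mk (unipMat u)

theorem unipMat_mul (u v : ℝ) : unipMat u * unipMat v = unipMat (u + v) := by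
  refine Subtype.ext ?_
  change (!![1, u; 0, 1] : Matrix (Fin 2) (Fin 2) ℝ) * !![1, v; 0, 1] = !![1, u + v; 0, 1]
  rw [Matrix.mul_fin_two]
  simp [add_comm]

theorem unip_mul (u v : ℝ) : unip u * unip v = unip (u + v) := by
  rw [unip, unip, unip, ← unipMat_mul]; rfl

theorem unip_zero : unip 0 = 1 := by
  have h : unipMat 0 = 1 := by
    ext i j
    fin_cases i <;> fin_cases j <;> simp [unipMat]
  rw [unip, h]; rfl

/-- The standard parabolic subgroup `T ≃ ℝ` of `G`. -/
def T : Subgroup G where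
  carrier := Set.range unip
  mul_mem' := by
    rintro _ _ ⟨u, rfl⟩ ⟨v, rfl⟩
    exact ⟨u + v, (unip_mul u v).symm⟩
  one_mem' := ⟨0, unip_zero⟩
  inv_mem' := by
    rintro _ ⟨u, rfl⟩
    refine ⟨-u, ?_⟩
    rw [eq_inv_iff_mul_eq_one, unip_mul, neg_add_cancel, unip_zero]

/-- The Borel subgroup `B`, the normalizer of `T`. -/
def B : Subgroup G := Subgroup.normalizer (T : Set G)

/-- The element `θ · diag(h, h⁻¹)` of `θH`, where `θ` is the class of `!![0, -1; 1, 0]`, `θ² = 1`.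
It is used for `h > 0`. -/
def thetaDiag (h : ℝ) (hh : 0 < h) : G :=
  QuotientGroup.mk (⟨!![0, -1; 1, 0], by simp [Matrix.det_fin_two]⟩ *
    ⟨!![h, 0; 0, h⁻¹], by simp [Matrix.det_fin_two, hh.ne']⟩ : SL(2, ℝ))

/-- The subset `θH` of `G`. -/
def thetaH : Set G := {g | ∃ (h : ℝ) (hh : 0 < h), g = thetaDiag h hh}

/-- An element of `G` is parabolic if it is conjugate to a nontrivial element of `T`. -/
def IsParabolicElt (g : G) : Prop := g ≠ 1 ∧ ∃ a : G, a⁻¹ * g * a ∈ T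

/-! ### Punctured surfaces

The oriented punctured surface `Σ` of finite type is `ℍ / Γ`, where the discrete group
`Γ ⊆ SL(2, ℝ)` acts freely on `ℍ`; then `π₁(Σ) = Γ` and the universal cover is `ℍ`.  The lifts of
punctures to the boundary of `ℍ` are the cusps of `Γ`. -/

/-- `ℍ / Γ` is an oriented surface of finite type with at least one puncture: `Γ` is discrete, acts
freely on `ℍ`, has a cusp, and `ℍ / Γ` is the union of a compact set and of finitely many
cusp neighbourhoods. -/
structure IsPuncturedSurfaceGroup (Γ : Subgroup SL(2, ℝ)) : Prop where
  discrete : DiscreteTopology Γ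
  free : ∀ γ ∈ Γ, γ ≠ 1 → ∀ z : ℍ, γ • z ≠ z
  finiteType : ∃ (K : Set ℍ) (F : Set SL(2, ℝ)), IsCompact K ∧ F.Finite ∧ F.Nonempty ∧
    (∀ g ∈ F, IsCusp (Matrix.SpecialLinearGroup.mapGL ℝ g • (OnePoint.infty : OnePoint ℝ))
      (Γ.map (Matrix.SpecialLinearGroup.mapGL ℝ))) ∧
    ∀ z : ℍ, ∃ γ ∈ Γ, γ • z ∈ K ∨ ∃ g ∈ F, 1 < (g⁻¹ • γ • z).im

/-- The cusps of `Γ`, i.e. the lifts of the punctures. -/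
def Cusp (Γ : Subgroup SL(2, ℝ)) : Type :=
  {x : OnePoint ℝ // IsCusp x (Γ.map (Matrix.SpecialLinearGroup.mapGL ℝ))}

variable {Γ : Subgroup SL(2, ℝ)}

instance : MulAction Γ (Cusp Γ) where
  smul γ x := ⟨Matrix.SpecialLinearGroup.mapGL ℝ (γ : SL(2, ℝ)) • x.1,
    x.2.smul_of_mem (Subgroup.mem_map_of_mem _ γ.2)⟩
  one_smul x := Subtype.ext (by
    change Matrix.SpecialLinearGroup.mapGL ℝ (1 : SL(2, ℝ)) • x.1 = x.1
    rw [map_one, one_smul])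
  mul_smul γ δ x := Subtype.ext (by
    change Matrix.SpecialLinearGroup.mapGL ℝ ((γ : SL(2, ℝ)) * (δ : SL(2, ℝ))) • x.1 =
      Matrix.SpecialLinearGroup.mapGL ℝ (γ : SL(2, ℝ)) •
        Matrix.SpecialLinearGroup.mapGL ℝ (δ : SL(2, ℝ)) • x.1
    rw [map_mul, mul_smul])

/-- The set `V` of punctures. -/
abbrev Puncture (Γ : Subgroup SL(2, ℝ)) : Type := MulAction.orbitRel.Quotient Γ (Cusp Γ)

/-- The puncture below a cusp. -/
def puncture (x : Cusp Γ) : Puncture Γ := Quotient.mk _ x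

/-! ### Positions of points on the boundary circle of `ℍ` -/

/-- Homogeneous coordinates of a point of `ℝ ∪ {∞}`. -/
def vec (x : OnePoint ℝ) : ℝ × ℝ := x.elim (1, 0) fun t => (t, 1)

/-- The determinant of the homogeneous coordinate vectors of two boundary points. -/
def bdet (x y : OnePoint ℝ) : ℝ := (vec x).1 * (vec y).2 - (vec x).2 * (vec y).1

/-- Positive if `x, y, z` are in counterclockwise (positive) cyclic order on the boundary of `ℍ`,
negative if they are in clockwise cyclic order, zero if two of them coincide. -/
def orient (x y z : OnePoint ℝ) : ℝ := bdet x y * bdet y z * bdet z x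

/-- The geodesic from `x` to `y` crosses the geodesic from `z` to `w`: the points `z` and `w` are
strictly on different sides of `x` and `y`. -/
def Cross (x y z w : OnePoint ℝ) : Prop := orient x y z * orient x y w < 0

/-- For `x ≠ y` this is zero on the geodesic of `ℍ` between `x` and `y`, and positive on the side
of it whose boundary points `z` satisfy `0 < orient x y z`. -/
def side (x y : OnePoint ℝ) (p : ℍ) : ℝ :=
  -bdet x y * ((vec x).1 * (vec y).1 - ((vec x).1 * (vec y).2 + (vec x).2 * (vec y).1) * p.re
    + (vec x).2 * (vec y).2 * (p.re ^ 2 + p.im ^ 2))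

/-- The closed ideal triangle in `ℍ` with vertices `x, y, z`, in counterclockwise order. -/
def idealTriangle (x y z : OnePoint ℝ) : Set ℍ :=
  {p | 0 ≤ side x y p ∧ 0 ≤ side y z p ∧ 0 ≤ side z x p}

/-! ### Ideal arcs, ideal triangles and ideal triangulations

An isotopy class of simple paths between punctures is given by its geodesic representative, thus
by the `Γ`-orbit of the pair of end points of a lift.  An ideal triangle is given by the `Γ`-orbit
of the set of vertices of a lift. -/

/-- `Γ`-orbits of sets of cusps. -/
abbrev Orb (Γ : Subgroup SL(2, ℝ)) : Type := MulAction.orbitRel.Quotient Γ (Set (Cusp Γ))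

/-- The class of the geodesic with end points `x` and `y`. -/
def arc (x y : Cusp Γ) : Orb Γ := Quotient.mk _ {x, y}

/-- The class of the triangle with vertices `x, y, z`. -/
def face (x y z : Cusp Γ) : Orb Γ := Quotient.mk _ {x, y, z}

theorem arc_comm (x y : Cusp Γ) : arc x y = arc y x := by
  rw [arc, arc, Set.pair_comm]

theorem arc_smul (γ : Γ) (x y : Cusp Γ) : arc (γ • x) (γ • y) = arc x y := by
  refine Quotient.sound ⟨γ, ?_⟩
  change γ • ({x, y} : Set (Cusp Γ)) = _
  rw [← Set.image_smul, Set.image_pair]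

/-- Ideal arcs: the end points of a lift are distinct (the arc is not contractible to a puncture)
and no two lifts cross (the arc is simple). -/
def IsIdealArc (e : Orb Γ) : Prop :=
  ∃ x y : Cusp Γ, x ≠ y ∧ e = arc x y ∧
    ∀ γ : Γ, ¬ Cross x.1 y.1 (γ • x).1 (γ • y).1

/-- `x, y, z` are, in counterclockwise order, the vertices of a lifted triangle all of whose sides
belong to `τ`. -/
structure IsTri (τ : Set (Orb Γ)) (x y z : Cusp Γ) : Prop where
  pos : 0 < orient x.1 y.1 z.1
  xy : arc x y ∈ τ
  yz : arc y z ∈ τ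
  zx : arc z x ∈ τ

/-- An ideal triangulation of `Σ`: a finite set of pairwise nonintersecting ideal arcs that cuts
`Σ` into ideal triangles.  Each edge has an ideal triangle on each of its two sides, the ideal
triangles cover `Σ`, and each puncture is a vertex. -/
structure IsIdealTriangulation (τ : Set (Orb Γ)) : Prop where
  finite : τ.Finite
  isIdealArc : ∀ e ∈ τ, IsIdealArc e
  nonintersecting : ∀ x y z w : Cusp Γ, arc x y ∈ τ → arc z w ∈ τ → ¬ Cross x.1 y.1 z.1 w.1
  exists_tri : ∀ x y : Cusp Γ, arc x y ∈ τ → ∃ z, IsTri τ x y z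
  cover : ∀ p : ℍ, ∃ x y z : Cusp Γ, IsTri τ x y z ∧ p ∈ idealTriangle x.1 y.1 z.1
  exists_arc : ∀ x : Cusp Γ, ∃ y, arc x y ∈ τ

/-- The set of ideal triangles (faces) of `τ`. -/
def faces (τ : Set (Orb Γ)) : Set (Orb Γ) := {t | ∃ x y z : Cusp Γ, IsTri τ x y z ∧ t = face x y z}

theorem IsTri.face_mem {τ : Set (Orb Γ)} {x y z : Cusp Γ} (h : IsTri τ x y z) :
    face x y z ∈ faces τ := ⟨x, y, z, h, rfl⟩

theorem IsTri.xz {τ : Set (Orb Γ)} {x y z : Cusp Γ} (h : IsTri τ x y z) : arc x z ∈ τ :=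
  arc_comm z x ▸ h.zx

/-- `τ'` is obtained from `τ` by the flip which replaces the diagonal `e = x₀x₂` of the ideal
quadrilateral with (lifted) vertices `x₀, x₁, x₂, x₃`, in counterclockwise order, by the diagonal
`e' = x₁x₃`.  With `a = x₀x₁`, `b = x₁x₂`, `c = x₂x₃`, `d = x₃x₀`, the triangles `t₁ = (e, a, b)`
and `t₂ = (e, c, d)` are replaced by `t₁' = (e', d, a)` and `t₂' = (e', b, c)`. -/
structure IsFlip (τ τ' : Set (Orb Γ)) (x₀ x₁ x₂ x₃ : Cusp Γ) : Prop where
  t₁ : IsTri τ x₀ x₁ x₂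
  t₂ : IsTri τ x₀ x₂ x₃
  t₁' : IsTri τ' x₁ x₃ x₀
  t₂' : IsTri τ' x₁ x₂ x₃
  eq : τ' = insert (arc x₁ x₃) (τ \ {arc x₀ x₂})

/-! ### Corners and the function `φ` -/

/-- `Γ`-orbits of triples of cusps.  The corner at `x` of the triangle with vertices `x, y, z` is
the orbit of `(x, y, z)`. -/
abbrev TripleOrb (Γ : Subgroup SL(2, ℝ)) : Type :=
  MulAction.orbitRel.Quotient Γ (Cusp Γ × Cusp Γ × Cusp Γ)

/-- The triangle `T_c` of a corner `c`. -/
def cornerFace : TripleOrb Γ → Orb Γ :=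
  Quotient.map (fun c => {c.1, c.2.1, c.2.2}) (by
    rintro _ c ⟨γ, rfl⟩
    refine ⟨γ, ?_⟩
    change γ • ({c.1, c.2.1, c.2.2} : Set (Cusp Γ)) = {γ • c.1, γ • c.2.1, γ • c.2.2}
    rw [← Set.image_smul, Set.image_insert_eq, Set.image_pair])

theorem pair_rel (γ : Γ) (x y : Cusp Γ) :
    (MulAction.orbitRel Γ (Set (Cusp Γ))) {γ • x, γ • y} {x, y} := by
  refine ⟨γ, ?_⟩
  change γ • ({x, y} : Set (Cusp Γ)) = _
  rw [← Set.image_smul, Set.image_pair]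

/-- The side `O_c` opposite to a corner `c`. -/
def cornerOpp : TripleOrb Γ → Orb Γ :=
  Quotient.map (fun c => {c.2.1, c.2.2}) (by
    rintro _ c ⟨γ, rfl⟩
    exact pair_rel γ c.2.1 c.2.2)

/-- The first side `A_c` adjacent to a corner `c`. -/
def cornerAdj₁ : TripleOrb Γ → Orb Γ :=
  Quotient.map (fun c => {c.1, c.2.1}) (by
    rintro _ c ⟨γ, rfl⟩
    exact pair_rel γ c.1 c.2.1)

/-- The second side `B_c` adjacent to a corner `c`. -/
def cornerAdj₂ : TripleOrb Γ → Orb Γ :=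
  Quotient.map (fun c => {c.2.2, c.1}) (by
    rintro _ c ⟨γ, rfl⟩
    exact pair_rel γ c.2.2 c.1)

/-- The corners of the triangles of `τ` at the puncture `P`. -/
def corners (τ : Set (Orb Γ)) (P : Puncture Γ) : Set (TripleOrb Γ) :=
  {c | ∃ x y z : Cusp Γ, IsTri τ x y z ∧ puncture x = P ∧ c = Quotient.mk _ (x, y, z)}

section

variable {τ : Set (Orb Γ)} {P : Puncture Γ} {c : TripleOrb Γ}

theorem cornerFace_mem (hc : c ∈ corners τ P) : cornerFace c ∈ faces τ := by
  obtain ⟨x, y, z, h, -, rfl⟩ := hc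
  exact h.face_mem

theorem cornerOpp_mem (hc : c ∈ corners τ P) : cornerOpp c ∈ τ := by
  obtain ⟨x, y, z, h, -, rfl⟩ := hc
  exact h.yz

theorem cornerAdj₁_mem (hc : c ∈ corners τ P) : cornerAdj₁ c ∈ τ := by
  obtain ⟨x, y, z, h, -, rfl⟩ := hc
  exact h.xy

theorem cornerAdj₂_mem (hc : c ∈ corners τ P) : cornerAdj₂ c ∈ τ := by
  obtain ⟨x, y, z, h, -, rfl⟩ := hc
  exact h.zx

end

/-- `ℝ_{>0}^τ`: positive functions on the set of edges of `τ`. -/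
abbrev EdgeFun (τ : Set (Orb Γ)) : Type := τ → Set.Ioi (0 : ℝ)

/-- `{±1}^{\bar τ}`: signs on the faces of `τ`. -/
abbrev FaceSign (τ : Set (Orb Γ)) : Type := faces τ → ℤˣ

/-- A sign as a real number. -/
def sgn (s : ℤˣ) : ℝ := ((s : ℤ) : ℝ)

/-- `φ_{τ,P}(f, ε) = ∑_c ε(T_c) f(O_c) / (f(A_c) f(B_c))`, the sum over the corners at `P`. -/
def phiAt (τ : Set (Orb Γ)) (f : EdgeFun τ) (ε : FaceSign τ) (P : Puncture Γ) : ℝ :=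
  ∑ᶠ c : corners τ P, sgn (ε ⟨cornerFace c.1, cornerFace_mem c.2⟩) *
    ((f ⟨cornerOpp c.1, cornerOpp_mem c.2⟩ : ℝ) /
      ((f ⟨cornerAdj₁ c.1, cornerAdj₁_mem c.2⟩ : ℝ) * (f ⟨cornerAdj₂ c.1, cornerAdj₂_mem c.2⟩ : ℝ)))

/-- `φ_τ(f, ε) = ∏_P φ_{τ,P}(f, ε)`, the product over all punctures. -/
def phi (τ : Set (Orb Γ)) (f : EdgeFun τ) (ε : FaceSign τ) : ℝ := ∏ᶠ P : Puncture Γ, phiAt τ f ε P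

/-! ### The moduli space of flat connections -/

/-- Flat connections: irreducible representations of `π₁(Σ) = Γ` in `G` with parabolic
holonomies around the punctures. -/
structure FlatConn (Γ : Subgroup SL(2, ℝ)) where
  hol : Γ →* G
  irreducible : ∀ a : G, ∃ γ : Γ, a⁻¹ * hol γ * a ∉ B
  parabolic : ∀ (x : Cusp Γ) (γ : Γ), γ • x = x → γ ≠ 1 → IsParabolicElt (hol γ)

/-- Gauge equivalence of flat connections: overall conjugation. -/
instance flatConnSetoid (Γ : Subgroup SL(2, ℝ)) : Setoid (FlatConn Γ) where
  r ρ σ := ∃ a : G, ∀ γ : Γ, σ.hol γ = a * ρ.hol γ * a⁻¹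
  iseqv :=
    { refl := fun ρ => ⟨1, fun γ => by simp⟩
      symm := by
        rintro ρ σ ⟨a, h⟩
        exact ⟨a⁻¹, fun γ => by rw [h]; group⟩
      trans := by
        rintro ρ σ υ ⟨a, h⟩ ⟨b, k⟩
        exact ⟨b * a, fun γ => by rw [k, h]; group⟩ }

/-- The moduli space `𝓜` of flat connections. -/
def Moduli (Γ : Subgroup SL(2, ℝ)) : Type := Quotient (flatConnSetoid Γ)

/-- The geodesic from `x` to `y` is admissible: the holonomies around the punctures at its two ends
(the images of the stabilizers of `x` and of `y`) belong to distinct parabolic subgroups. -/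
def Admissible (ρ : FlatConn Γ) (x y : Cusp Γ) : Prop :=
  ¬ ∃ a : G, (∀ γ : Γ, γ • x = x → a⁻¹ * ρ.hol γ * a ∈ T) ∧
    (∀ γ : Γ, γ • y = y → a⁻¹ * ρ.hol γ * a ∈ T)

/-- The set `α` of all `m`-admissible ideal arcs. -/
def admissibleArcs (m : Moduli Γ) : Set (Orb Γ) :=
  {e | IsIdealArc e ∧ ∃ (ρ : FlatConn Γ) (x y : Cusp Γ),
    (Quotient.mk _ ρ : Moduli Γ) = m ∧ e = arc x y ∧ Admissible ρ x y}

/-- `𝓜_τ`: the moduli for which all arcs of `τ` are admissible. -/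
def moduliOf (τ : Set (Orb Γ)) : Set (Moduli Γ) := {m | τ ⊆ admissibleArcs m}

/-! ### Graph connections and the bundle over the moduli space

The graph `Γ_α` of a set `α` of ideal arcs has one vertex at each of the two ends of each arc, on
a small circle around the puncture.  A vertex of its lift to the universal cover is an ordered pair
`(x, y)` of cusps with `arc x y ∈ α`; it is placed near the end `x` of the lifted arc, on the lift of
the circle.  Lifted long edges join `(x, y)` and `(y, x)`, and lifted short edges join vertices
`(x, y)` and `(x, z)` near the same cusp.  Homotopy classes of paths in `Σ` between vertices
of `Γ_α` are `Γ`-orbits of pairs of lifted vertices. -/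

/-- The lifted vertices of the graph of `α`. -/
def Vert (α : Set (Orb Γ)) : Type := {v : Cusp Γ × Cusp Γ // arc v.1 v.2 ∈ α}

instance (α : Set (Orb Γ)) : MulAction Γ (Vert α) where
  smul γ v := ⟨(γ • v.1.1, γ • v.1.2), by
    have h := arc_smul γ v.1.1 v.1.2
    rw [h]; exact v.2⟩
  one_smul v := Subtype.ext (one_smul Γ v.1)
  mul_smul γ δ v := Subtype.ext (mul_smul γ δ v.1)

/-- A flat graph connection on the graph of `α`: a `G`-representation of the groupoid of homotopy
classes of paths in `Σ` between vertices of the graph.  Here `W v w` is the parallel transport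
along the image in `Σ` of the path from `v` to `w` in the universal cover. -/
@[ext]
structure GraphConn (α : Set (Orb Γ)) where
  W : Vert α → Vert α → G
  comp : ∀ u v w, W u v * W v w = W u w
  smul : ∀ (γ : Γ) (u v), W (γ • u) (γ • v) = W u v

/-- The holonomy representation of `π₁(Σ) = Γ` of a flat graph connection, based at the vertex
`v`. -/
def GraphConn.hol {α : Set (Orb Γ)} (C : GraphConn α) (v : Vert α) : Γ →* G where
  toFun γ := C.W v (γ • v)
  map_one' := by
    have h := C.comp v v v
    rw [one_smul]
    exact mul_eq_left.mp h
  map_mul' γ δ := by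
    rw [mul_smul, ← C.comp v (γ • v) (γ • δ • v), C.smul]

/-- The flat graph connection represents `m`. -/
def GraphConn.Represents {α : Set (Orb Γ)} (C : GraphConn α) (m : Moduli Γ) : Prop :=
  ∃ (v : Vert α) (ρ : FlatConn Γ), ρ.hol = C.hol v ∧ (Quotient.mk _ ρ : Moduli Γ) = m

/-- The total space of the bundle `π : \tilde 𝓜 → 𝓜`.  A point over `m` is a flat graph connection
representing `m`, on the graph of the set of all `m`-admissible ideal arcs, with parallel
transports in `θH` along long edges and in `T` along short edges. -/
structure Bundle (Γ : Subgroup SL(2, ℝ)) where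
  /-- The projection `π` to the moduli space. -/
  π : Moduli Γ
  conn : GraphConn (admissibleArcs π)
  represents : conn.Represents π
  long : ∀ (x y : Cusp Γ) (hxy : arc x y ∈ admissibleArcs π) (hyx : arc y x ∈ admissibleArcs π),
    conn.W ⟨(x, y), hxy⟩ ⟨(y, x), hyx⟩ ∈ thetaH
  short : ∀ (x y z : Cusp Γ) (hy : arc x y ∈ admissibleArcs π) (hz : arc x z ∈ admissibleArcs π),
    conn.W ⟨(x, y), hy⟩ ⟨(x, z), hz⟩ ∈ T

/-- The pair `(f, ε)` corresponds to the point `p` of `π⁻¹(𝓜_τ)`: the parallel transport along the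
long edge of `e ∈ τ` is `θ · diag(f(e), f(e)⁻¹)`, and the parallel transport along the short edge
of a corner `c`, directed counterclockwise around the puncture, is the unipotent with entry
`ε(T_c) f(O_c) / (f(A_c) f(B_c))`. -/
structure Corresponds (τ : Set (Orb Γ)) (f : EdgeFun τ) (ε : FaceSign τ) (p : Bundle Γ) : Prop where
  mem : p.π ∈ moduliOf τ
  long : ∀ (x y : Cusp Γ) (hxy : arc x y ∈ τ) (hyx : arc y x ∈ τ),
    p.conn.W ⟨(x, y), mem hxy⟩ ⟨(y, x), mem hyx⟩ = thetaDiag (f ⟨arc x y, hxy⟩) (f ⟨arc x y, hxy⟩).2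
  short : ∀ (x y z : Cusp Γ) (h : IsTri τ x y z),
    p.conn.W ⟨(x, y), mem h.xy⟩ ⟨(x, z), mem h.xz⟩ =
      unip (sgn (ε ⟨face x y z, h.face_mem⟩) *
        ((f ⟨arc y z, h.yz⟩ : ℝ) / ((f ⟨arc x y, h.xy⟩ : ℝ) * (f ⟨arc z x, h.zx⟩ : ℝ))))

end PuncturedSurface

end

open PuncturedSurface

namespace PuncturedSurface

variable {Γ : Subgroup SL(2, ℝ)} {τ τ' : Set (Orb Γ)}

/-! ### Cyclic order on the boundary circle -/

/-! A point of the bundle amounts to a system of frames in `G`, one at each end of each lifted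
admissible arc, and `(f, ε)` prescribes the changes of frame along the edges and corners of `τ`.
These prescriptions close up around every triangle: given the long transports, the three short ones
are forced up to one common sign (`hexagon_iff`). That sign comes from the ambiguity in lifting from
`PSL` to `SL`, and it is `ε`.

The dual graph of the lifted triangulation is a tree: it is connected because ℍ is (`reachable`),
and acyclic because each lifted edge separates ℍ (`isAcyclic`). Hence frames can be developed over
the universal cover, uniquely once one frame is fixed (`exists_isDevelopment`,
`IsDevelopment.unique`), and uniqueness makes the development equivariant under a holonomy
representation. The triangles at a cusp form a free ℤ-orbit on which a generator of the stabilizer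
shifts by one period. Short transports add up along the period, so the holonomy of that generator is
unipotent with entry `phiAt` (`parabolic_holonomy`); thus `phi ≠ 0` makes the peripheral holonomies
parabolic. Irreducibility holds because the elements of `θH` lie outside `B`. Uniqueness in the big
Bruhat cell extends the frames in one way only from `τ` to all admissible arcs (`IsFrame.unique`),
so the pair corresponds to exactly one point (`exists_corresponds`, `Corresponds.unique`).

A flip changes only the diagonal and its two triangles. Short transports compose, so the new corner
parameter at each end of the old diagonal is the sum of the two old ones. These two equations are
equivalent to the sign and length relations of the statement (`flip_relations_iff`). Conversely, a
nonzero sum makes the new diagonal admissible (`Corresponds.arc_mem`), and the triangle rule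
`Bundle.exists_sign` then recovers its length and the other corners. If the sum vanishes, the
diagonal cannot be admissible, because corner parameters of admissible triangles are nonzero. -/

theorem vec_infty : vec OnePoint.infty = (1, 0) := rfl

theorem vec_coe (t : ℝ) : vec (t : OnePoint ℝ) = (t, 1) := rfl

theorem bdet_eq_zero_iff {x y : OnePoint ℝ} : bdet x y = 0 ↔ x = y := by
  induction x using OnePoint.rec <;> induction y using OnePoint.rec <;>
    simp [bdet, vec_infty, vec_coe, sub_eq_zero]

theorem orient_rotate (x y z : OnePoint ℝ) : orient y z x = orient x y z := by
  simp only [orient]; ring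

theorem orient_swap (x y z : OnePoint ℝ) : orient y x z = -orient x y z := by
  simp only [orient, bdet]; ring

theorem orient_eq_zero_iff {x y z : OnePoint ℝ} : orient x y z = 0 ↔ x = y ∨ y = z ∨ z = x := by
  simp only [orient, mul_eq_zero, bdet_eq_zero_iff, or_assoc]

theorem ne_of_orient_pos {x y z : OnePoint ℝ} (h : 0 < orient x y z) :
    x ≠ y ∧ y ≠ z ∧ z ≠ x := by
  have := h.ne'
  rw [Ne, orient_eq_zero_iff] at this
  tauto

/-- With `x` at infinity this is transitivity of the order on the line. The identity `key` is the
three-term Plücker relation among `x, y, z, w`, multiplied by a product of `bdet`s. -/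
theorem orient_trans {x y z w : OnePoint ℝ} (h₁ : 0 < orient x y z) (h₂ : 0 < orient x z w) :
    0 < orient x y w := by
  have hxz : bdet x z ≠ 0 := by
    rw [Ne, bdet_eq_zero_iff]; exact (ne_of_orient_pos h₁).2.2.symm
  have key : bdet x z ^ 2 * orient x y w =
      bdet x w ^ 2 * orient x y z + bdet x y ^ 2 * orient x z w := by
    simp only [orient, bdet]; ring
  have hxw : bdet x w ≠ 0 := by
    rw [Ne, bdet_eq_zero_iff]; exact (ne_of_orient_pos h₂).2.2.symm
  have : 0 < bdet x z ^ 2 * orient x y w := by rw [key]; positivity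
  exact pos_of_mul_pos_right this (by positivity)

/-- Seen from the boundary, the three arcs cut out by a triangle are disjoint. -/
theorem eq_of_orient_nonneg {x y z w : OnePoint ℝ} (h : 0 < orient x y z) (hx : w ≠ x) (hy : w ≠ y)
    (h₁ : 0 ≤ orient x y w) (h₂ : 0 ≤ orient y z w) (h₃ : 0 ≤ orient z x w) : w = z := by
  -- The product of the three orientations is minus a square times a positive number, so they can
  -- all be nonnegative only if that square vanishes.
  have key : orient x y w * orient y z w * orient z x w =
      -(orient x y z * (bdet x w * bdet y w * bdet z w) ^ 2) := by
    simp only [orient, bdet]; ring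
  have h0 : 0 ≤ orient x y w * orient y z w * orient z x w := by positivity
  have : bdet x w * bdet y w * bdet z w = 0 := by
    by_contra hne
    have : 0 < orient x y z * (bdet x w * bdet y w * bdet z w) ^ 2 := by positivity
    linarith
  simp only [mul_eq_zero, bdet_eq_zero_iff] at this
  rcases this with (h | h) | h
  · exact absurd h.symm hx
  · exact absurd h.symm hy
  · exact h.symm

/-! ### Positions of points of `ℍ` -/

theorem side_swap (x y : OnePoint ℝ) (p : ℍ) : side y x p = -side x y p := by
  simp only [side, bdet]; ring

/-- In the projective model, `side y z p`, `side z x p`, `side x y p` are barycentric weights of `p`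
relative to `x, y, z`. The linear form `side a b` takes the boundary values `orient a b x`, `orient
a b y`, `orient a b z` at the vertices. -/
theorem orient_mul_side (a b x y z : OnePoint ℝ) (p : ℍ) :
    orient x y z * side a b p =
      orient a b x * side y z p + orient a b y * side z x p + orient a b z * side x y p := by
  simp only [orient, bdet, side]; ring

theorem continuous_side (x y : OnePoint ℝ) : Continuous (side x y) := by
  unfold side
  have := UpperHalfPlane.continuous_re
  have := UpperHalfPlane.continuous_im
  fun_prop

/-- The inner product, in which `p` is the standard complex structure, of the homogeneous
coordinate vectors. -/
def pairing (x y : OnePoint ℝ) (p : ℍ) : ℝ :=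
  (vec x).1 * (vec y).1 - ((vec x).1 * (vec y).2 + (vec x).2 * (vec y).1) * p.re
    + (vec x).2 * (vec y).2 * (p.re ^ 2 + p.im ^ 2)

theorem pairing_self_pos (x : OnePoint ℝ) (p : ℍ) : 0 < pairing x x p := by
  have hp := p.im_pos
  induction x using OnePoint.rec with
  | infty => simp [pairing, vec_infty]
  | coe t =>
    have : pairing t t p = (t - p.re) ^ 2 + p.im ^ 2 := by
      simp only [pairing, vec_coe]; ring
    rw [this]; positivity

/-- Lying on the geodesic means that the coordinate vectors of `x` and `y` are orthogonal for the
inner product of `p`. Expanding the vector of `w` in these two leaves only a positive multiple of a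
squared norm. Hence a point of one side of a triangle is strictly inside the other two. -/
theorem side_pos_of_side_eq_zero {x y w : OnePoint ℝ} {p : ℍ} (h : 0 < orient y x w)
    (hp : side x y p = 0) : 0 < side x w p ∧ 0 < side w y p := by
  obtain ⟨hyx, hxw, hwy⟩ := ne_of_orient_pos h
  have hb : bdet x y ≠ 0 := by rw [Ne, bdet_eq_zero_iff]; exact hyx.symm
  have h0 : pairing x y p = 0 := by
    have : side x y p = -bdet x y * pairing x y p := rfl
    rw [this] at hp
    simpa [hb] using hp
  have e₁ : bdet x y ^ 2 * side x w p =
      orient y x w * pairing x x p - bdet x y * bdet x w ^ 2 * pairing x y p := by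
    simp only [orient, bdet, side, pairing]; ring
  have e₂ : bdet x y ^ 2 * side w y p =
      orient y x w * pairing y y p - bdet x y * bdet w y ^ 2 * pairing x y p := by
    simp only [orient, bdet, side, pairing]; ring
  rw [h0, mul_zero, sub_zero] at e₁ e₂
  have hx := pairing_self_pos x p
  have hy := pairing_self_pos y p
  have hb2 : 0 < bdet x y ^ 2 := by positivity
  exact ⟨pos_of_mul_pos_right (e₁ ▸ mul_pos h hx) hb2.le,
    pos_of_mul_pos_right (e₂ ▸ mul_pos h hy) hb2.le⟩

/-! ### The action of `Γ` -/

theorem vec_smul (g : SL(2, ℝ)) (x : OnePoint ℝ) :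
    ∃ k : ℝ, k ≠ 0 ∧
      g 0 0 * (vec x).1 + g 0 1 * (vec x).2 =
        k * (vec (Matrix.SpecialLinearGroup.mapGL ℝ g • x)).1 ∧
      g 1 0 * (vec x).1 + g 1 1 * (vec x).2 =
        k * (vec (Matrix.SpecialLinearGroup.mapGL ℝ g • x)).2 := by
  have hdet : g 0 0 * g 1 1 - g 0 1 * g 1 0 = 1 := by
    rw [← Matrix.det_fin_two]; exact g.2
  induction x using OnePoint.rec with
  | infty =>
    rw [OnePoint.smul_infty_eq_ite]
    by_cases h : g 1 0 = 0
    · refine ⟨g 0 0, ?_, ?_⟩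
      · rintro h0; simp [h0, h] at hdet
      · simp [vec_infty, h]
    · refine ⟨g 1 0, h, ?_⟩
      simp [vec_infty, vec_coe, h]
      field_simp
  | coe t =>
    rw [OnePoint.smul_some_eq_ite]
    by_cases h : g 1 0 * t + g 1 1 = 0
    · refine ⟨g 0 0 * t + g 0 1, ?_, ?_⟩
      · rintro h0
        have : g 0 0 * g 1 1 - g 0 1 * g 1 0 = 0 := by
          linear_combination g 0 0 * h - g 1 0 * h0
        linarith
      · simp [vec_infty, vec_coe, h]
    · refine ⟨g 1 0 * t + g 1 1, h, ?_⟩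
      have h' : t * g 1 0 + g 1 1 ≠ 0 := by rwa [mul_comm t]
      simp [vec_coe, h]
      field_simp

theorem bdet_smul (g : SL(2, ℝ)) (x y : OnePoint ℝ) {k l : ℝ} {x' y' : OnePoint ℝ}
    (hx₁ : g 0 0 * (vec x).1 + g 0 1 * (vec x).2 = k * (vec x').1)
    (hx₂ : g 1 0 * (vec x).1 + g 1 1 * (vec x).2 = k * (vec x').2)
    (hy₁ : g 0 0 * (vec y).1 + g 0 1 * (vec y).2 = l * (vec y').1)
    (hy₂ : g 1 0 * (vec y).1 + g 1 1 * (vec y).2 = l * (vec y').2) :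
    bdet x y = k * l * bdet x' y' := by
  have hdet : g 0 0 * g 1 1 - g 0 1 * g 1 0 = 1 := by
    rw [← Matrix.det_fin_two]; exact g.2
  have : k * l * bdet x' y' = (k * (vec x').1) * (l * (vec y').2) -
    (k * (vec x').2) * (l * (vec y').1) := by simp only [bdet]; ring
  rw [this, ← hx₁, ← hx₂, ← hy₁, ← hy₂, bdet]
  linear_combination (-(vec x).1 * (vec y).2 + (vec x).2 * (vec y).1) * hdet

/-- Each coordinate vector is rescaled by a nonzero factor and occurs twice in `orient`, so the
total factor is a square. -/
theorem orient_smul_pos (γ : Γ) {x y z : Cusp Γ} (h : 0 < orient x.1 y.1 z.1) :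
    0 < orient (γ • x).1 (γ • y).1 (γ • z).1 := by
  obtain ⟨k, hk, hx₁, hx₂⟩ := vec_smul γ.1 x.1
  obtain ⟨l, hl, hy₁, hy₂⟩ := vec_smul γ.1 y.1
  obtain ⟨m, hm, hz₁, hz₂⟩ := vec_smul γ.1 z.1
  have : orient x.1 y.1 z.1 = (k * l * m) ^ 2 * orient (γ • x).1 (γ • y).1 (γ • z).1 := by
    rw [orient, bdet_smul γ.1 _ _ hx₁ hx₂ hy₁ hy₂, bdet_smul γ.1 _ _ hy₁ hy₂ hz₁ hz₂,
      bdet_smul γ.1 _ _ hz₁ hz₂ hx₁ hx₂, orient]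
    change _ = (k * l * m) ^ 2 * (bdet (Matrix.SpecialLinearGroup.mapGL ℝ γ.1 • x.1)
      (Matrix.SpecialLinearGroup.mapGL ℝ γ.1 • y.1) *
    bdet (Matrix.SpecialLinearGroup.mapGL ℝ γ.1 • y.1)
      (Matrix.SpecialLinearGroup.mapGL ℝ γ.1 • z.1) *
    bdet (Matrix.SpecialLinearGroup.mapGL ℝ γ.1 • z.1)
      (Matrix.SpecialLinearGroup.mapGL ℝ γ.1 • x.1))
    ring
  rw [this] at h
  exact pos_of_mul_pos_right h (by positivity)

/-- The fixed points are pairwise independent eigenvectors. Since the determinant is 1, the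
eigenvalues have pairwise products 1, so they coincide and the matrix is `1` or `-1`. The latter
acts trivially on ℍ, which freeness excludes. -/
theorem eq_one_of_fix_three (hΓ : ∀ γ ∈ Γ, γ ≠ 1 → ∀ z : ℍ, γ • z ≠ z) {γ : Γ} {x y z : Cusp Γ}
    (h : 0 < orient x.1 y.1 z.1) (hx : γ • x = x) (hy : γ • y = y) (hz : γ • z = z) : γ = 1 := by
  obtain ⟨k, hk, hx₁, hx₂⟩ := vec_smul γ.1 x.1
  obtain ⟨l, hl, hy₁, hy₂⟩ := vec_smul γ.1 y.1
  obtain ⟨m, hm, hz₁, hz₂⟩ := vec_smul γ.1 z.1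
  change _ = k * (vec (γ • x).1).1 at hx₁
  change _ = k * (vec (γ • x).1).2 at hx₂
  change _ = l * (vec (γ • y).1).1 at hy₁
  change _ = l * (vec (γ • y).1).2 at hy₂
  change _ = m * (vec (γ • z).1).1 at hz₁
  change _ = m * (vec (γ • z).1).2 at hz₂
  rw [hx] at hx₁ hx₂
  rw [hy] at hy₁ hy₂
  rw [hz] at hz₁ hz₂
  have hxy := bdet_smul γ.1 _ _ hx₁ hx₂ hy₁ hy₂
  have hyz := bdet_smul γ.1 _ _ hy₁ hy₂ hz₁ hz₂
  have hzx := bdet_smul γ.1 _ _ hz₁ hz₂ hx₁ hx₂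
  obtain ⟨n₁, n₂, n₃⟩ := ne_of_orient_pos h
  rw [Ne, ← bdet_eq_zero_iff] at n₁ n₂ n₃
  have e₁ : k * l = 1 := mul_right_cancel₀ n₁ (by rw [← hxy, one_mul])
  have e₂ : l * m = 1 := mul_right_cancel₀ n₂ (by rw [← hyz, one_mul])
  have e₃ : m * k = 1 := mul_right_cancel₀ n₃ (by rw [← hzx, one_mul])
  have hkm : l = k := by
    have : m * (l - k) = 0 := by linear_combination e₂ - e₃
    rcases mul_eq_zero.mp this with h | h
    · exact absurd h hm
    · linarith
  rw [hkm] at hy₁ hy₂ e₁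
  set a := γ.1 0 0
  set b := γ.1 0 1
  set c := γ.1 1 0
  set d := γ.1 1 1
  have ha : a = k := by
    have : bdet x.1 y.1 * (a - k) = 0 := by
      simp only [bdet]
      linear_combination (vec y.1).2 * hx₁ - (vec x.1).2 * hy₁
    rcases mul_eq_zero.mp this with h | h
    · exact absurd h n₁
    · linarith
  have hb : b = 0 := by
    have : bdet x.1 y.1 * b = 0 := by
      simp only [bdet]
      linear_combination (vec x.1).1 * hy₁ - (vec y.1).1 * hx₁
    exact (mul_eq_zero.mp this).resolve_left n₁
  have hc : c = 0 := by
    have : bdet x.1 y.1 * c = 0 := by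
      simp only [bdet]
      linear_combination (vec y.1).2 * hx₂ - (vec x.1).2 * hy₂
    exact (mul_eq_zero.mp this).resolve_left n₁
  have hd : d = k := by
    have : bdet x.1 y.1 * (d - k) = 0 := by
      simp only [bdet]
      linear_combination (vec x.1).1 * hy₂ - (vec y.1).1 * hx₂
    rcases mul_eq_zero.mp this with h | h
    · exact absurd h n₁
    · linarith
  have hk2 : k = 1 ∨ k = -1 := by
    have : (k - 1) * (k + 1) = 0 := by linear_combination e₁
    rcases mul_eq_zero.mp this with h | h
    · left; linarith
    · right; linarith
  rcases hk2 with rfl | rfl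
  · refine Subtype.ext (Subtype.ext ?_)
    ext i j
    fin_cases i <;> fin_cases j <;> simp <;> assumption
  · have hγ : γ.1 = -1 := by
      refine Subtype.ext ?_
      ext i j
      fin_cases i <;> fin_cases j <;> simp <;> assumption
    by_contra hne
    refine hΓ γ.1 γ.2 (fun h => hne (Subtype.ext h)) UpperHalfPlane.I ?_
    rw [hγ]
    have h1 : (-1 : SL(2, ℝ)) • UpperHalfPlane.I =
        (Matrix.SpecialLinearGroup.toGL (-1 : SL(2, ℝ))) • UpperHalfPlane.I := rfl
    have h2 : (Matrix.SpecialLinearGroup.toGL (-1 : SL(2, ℝ))) = -1 := by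
      ext i j
      simp
    rw [h1, h2, UpperHalfPlane.neg_smul, one_smul]

/-- The stabilizer of a cusp is nontrivial. -/
theorem Cusp.exists_stabilizer_ne_one (x : Cusp Γ) : ∃ γ : Γ, γ • x = x ∧ γ ≠ 1 := by
  obtain ⟨g, hg, hp, hgx⟩ := x.2
  obtain ⟨γ, hγ, rfl⟩ := hg
  refine ⟨⟨γ, hγ⟩, Subtype.ext hgx, ?_⟩
  intro h1
  have : γ = 1 := congrArg Subtype.val h1
  subst this
  rw [map_one] at hp
  exact hp.1 ⟨1, by simp⟩

/-! ### Triangles of an ideal triangulation -/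

theorem IsTri.rotate {x y z : Cusp Γ} (h : IsTri τ x y z) : IsTri τ y z x :=
  ⟨by rw [orient_rotate]; exact h.pos, h.yz, h.zx, h.xy⟩

theorem IsTri.ne {x y z : Cusp Γ} (h : IsTri τ x y z) : x ≠ y ∧ y ≠ z ∧ z ≠ x := by
  obtain ⟨h₁, h₂, h₃⟩ := ne_of_orient_pos h.pos
  exact ⟨fun e => h₁ (congrArg _ e), fun e => h₂ (congrArg _ e), fun e => h₃ (congrArg _ e)⟩

theorem IsTri.smul {x y z : Cusp Γ} (h : IsTri τ x y z) (γ : Γ) :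
    IsTri τ (γ • x) (γ • y) (γ • z) :=
  ⟨orient_smul_pos γ h.pos, by rw [arc_smul]; exact h.xy, by rw [arc_smul]; exact h.yz,
    by rw [arc_smul]; exact h.zx⟩

namespace IsIdealTriangulation

/-- Since edges do not cross, `w` lies weakly on the inner side of each side of the triangle `x, y,
z`. No boundary point other than the vertices does. -/
theorem third_unique (hτ : IsIdealTriangulation τ) {x y z w : Cusp Γ} (hz : IsTri τ x y z)
    (hw : IsTri τ x y w) : w = z := by
  have n₁ := hτ.nonintersecting y z x w hz.yz hw.xz
  have n₂ := hτ.nonintersecting z x y w hz.zx hw.yz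
  simp only [Cross, not_lt] at n₁ n₂
  rw [orient_rotate] at n₁
  rw [← orient_rotate] at n₂
  rw [← orient_rotate x.1 y.1 z.1] at n₁
  have hp := hz.pos
  refine Subtype.ext (eq_of_orient_nonneg hp (fun e => hw.ne.2.2 (Subtype.ext e))
    (fun e => hw.ne.2.1 (Subtype.ext e.symm)) hw.pos.le ?_ ?_)
  · rw [orient_rotate] at n₁
    exact nonneg_of_mul_nonneg_right n₁ hp
  · rw [orient_rotate] at n₂
    have h2 : orient z.1 x.1 y.1 = orient x.1 y.1 z.1 := by
      rw [← orient_rotate, orient_rotate]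
    rw [h2] at n₂
    exact nonneg_of_mul_nonneg_right n₂ hp

/-- The vertices of a triangle lie on one side of an edge. -/
theorem one_side (hτ : IsIdealTriangulation τ) {a b x y z : Cusp Γ} (hab : arc a b ∈ τ)
    (h : IsTri τ x y z) :
    (0 ≤ orient a.1 b.1 x.1 ∧ 0 ≤ orient a.1 b.1 y.1 ∧ 0 ≤ orient a.1 b.1 z.1) ∨
      (orient a.1 b.1 x.1 ≤ 0 ∧ orient a.1 b.1 y.1 ≤ 0 ∧ orient a.1 b.1 z.1 ≤ 0) := by
  have n₁ := hτ.nonintersecting a b x y hab h.xy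
  have n₂ := hτ.nonintersecting a b y z hab h.yz
  have n₃ := hτ.nonintersecting a b z x hab h.zx
  simp only [Cross, not_lt] at n₁ n₂ n₃
  generalize orient a.1 b.1 x.1 = p at *
  generalize orient a.1 b.1 y.1 = q at *
  generalize orient a.1 b.1 z.1 = r at *
  rcases lt_trichotomy p 0 with hp | hp | hp
  · have := nonpos_of_mul_nonneg_right n₁ hp
    have := nonpos_of_mul_nonneg_left n₃ hp
    exact Or.inr ⟨hp.le, by assumption, by assumption⟩
  · rcases le_total q 0 with hq | hq
    · rcases hq.eq_or_lt with hq | hq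
      · rcases le_total r 0 with hr | hr
        · exact Or.inr ⟨hp.le, hq.le, hr⟩
        · exact Or.inl ⟨hp.ge, hq.ge, hr⟩
      · exact Or.inr ⟨hp.le, hq.le, nonpos_of_mul_nonneg_right n₂ hq⟩
    · rcases hq.eq_or_lt with hq | hq
      · rcases le_total r 0 with hr | hr
        · exact Or.inr ⟨hp.le, hq.ge, hr⟩
        · exact Or.inl ⟨hp.ge, hq.le, hr⟩
      · exact Or.inl ⟨hp.ge, hq.le, nonneg_of_mul_nonneg_right n₂ hq⟩
  · have := nonneg_of_mul_nonneg_right n₁ hp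
    have := nonneg_of_mul_nonneg_left n₃ hp
    exact Or.inl ⟨hp.le, by assumption, by assumption⟩

end IsIdealTriangulation

/-! ### Lifted triangles and their dual graph. -/

/-- The sets of vertices of the lifted triangles. -/
def TriSet (τ : Set (Orb Γ)) : Type :=
  {s : Set (Cusp Γ) // ∃ x y z, IsTri τ x y z ∧ s = {x, y, z}}

/-- The lifted triangle with given vertices. -/
def IsTri.set {x y z : Cusp Γ} (h : IsTri τ x y z) : TriSet τ := ⟨{x, y, z}, x, y, z, h, rfl⟩

theorem IsTri.set_rotate {x y z : Cusp Γ} (h : IsTri τ x y z) : h.rotate.set = h.set := by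
  refine Subtype.ext ?_
  change ({y, z, x} : Set (Cusp Γ)) = {x, y, z}
  ext w; simp only [Set.mem_insert_iff, Set.mem_singleton_iff]; tauto

theorem TriSet.exists_third (s : TriSet τ) {a b : Cusp Γ} (hab : a ≠ b) (ha : a ∈ s.1)
    (hb : b ∈ s.1) :
    (∃ c, ∃ h : IsTri τ a b c, s = h.set) ∨ (∃ c, ∃ h : IsTri τ b a c, s = h.set) := by
  obtain ⟨s, x, y, z, h, rfl⟩ := s
  simp only [Set.mem_insert_iff, Set.mem_singleton_iff] at ha hb
  have e₁ : (⟨{x, y, z}, x, y, z, h, rfl⟩ : TriSet τ) = h.set := rfl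
  have e₂ := h.set_rotate.symm
  have e₃ := h.rotate.set_rotate.symm
  rcases ha with rfl | rfl | rfl <;> rcases hb with rfl | rfl | rfl
  · exact absurd rfl hab
  · exact Or.inl ⟨_, h, e₁⟩
  · exact Or.inr ⟨_, h.rotate.rotate, e₁.trans (e₂.trans e₃)⟩
  · exact Or.inr ⟨_, h, e₁⟩
  · exact absurd rfl hab
  · exact Or.inl ⟨_, h.rotate, e₁.trans e₂⟩
  · exact Or.inl ⟨_, h.rotate.rotate, e₁.trans (e₂.trans e₃)⟩
  · exact Or.inr ⟨_, h.rotate, e₁.trans e₂⟩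
  · exact absurd rfl hab

theorem TriSet.exists_pos (s : TriSet τ) : ∃ x y z, ∃ h : IsTri τ x y z, s = h.set := by
  obtain ⟨s, x, y, z, h, rfl⟩ := s
  exact ⟨x, y, z, h, rfl⟩

/-- The dual graph of the lifted triangulation: triangles that share a side are adjacent. -/
def dual (τ : Set (Orb Γ)) : SimpleGraph (TriSet τ) where
  Adj s t := s ≠ t ∧ ∃ a b, a ≠ b ∧ a ∈ s.1 ∧ b ∈ s.1 ∧ a ∈ t.1 ∧ b ∈ t.1
  symm := ⟨by
    rintro s t ⟨h, a, b, hab, h₁, h₂, h₃, h₄⟩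
    exact ⟨h.symm, a, b, hab, h₃, h₄, h₁, h₂⟩⟩
  loopless := ⟨fun _ h => h.1 rfl⟩

theorem IsIdealTriangulation.exists_of_adj (hτ : IsIdealTriangulation τ) {s t : TriSet τ}
    (hst : (dual τ).Adj s t) :
    ∃ a b c d, ∃ (h : IsTri τ a b c) (k : IsTri τ b a d), s = h.set ∧ t = k.set := by
  obtain ⟨hne, a, b, hab, ha, hb, ha', hb'⟩ := hst
  rcases s.exists_third hab ha hb with ⟨c, h, hs⟩ | ⟨c, h, hs⟩ <;>
    rcases t.exists_third hab ha' hb' with ⟨d, k, ht⟩ | ⟨d, k, ht⟩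
  · obtain rfl := hτ.third_unique h k
    exact absurd (hs.trans ht.symm) hne
  · exact ⟨a, b, c, d, h, k, hs, ht⟩
  · exact ⟨b, a, c, d, h, k, hs, ht⟩
  · obtain rfl := hτ.third_unique h k
    exact absurd (hs.trans ht.symm) hne

/-! ### Connectedness of the dual graph -/

/-- The closed ideal triangle with given vertices. -/
def TriSet.region (s : TriSet τ) : Set ℍ :=
  {p | ∃ x y z, ∃ h : IsTri τ x y z, s = h.set ∧ p ∈ idealTriangle x.1 y.1 z.1}

theorem exists_side_eq_zero {x y : OnePoint ℝ} (h : x ≠ y) : ∃ p : ℍ, side x y p = 0 := by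
  rw [Ne, ← bdet_eq_zero_iff] at h
  set a := (vec x).1 with ha
  set b := (vec x).2 with hb
  set c := (vec y).1 with hc
  set d := (vec y).2 with hd
  have hdet : a * d - b * c ≠ 0 := h
  have hD : 0 < b ^ 2 + d ^ 2 := by
    rcases eq_or_ne b 0 with h0 | h0
    · have : d ≠ 0 := by rintro h1; simp [h0, h1] at hdet
      positivity
    · positivity
  -- This is the image of `i` under the matrix with columns `(a, b)` and `(c, d)`, which carries the
  -- geodesic between `0` and `∞` to the required one. The absolute value reflects it into ℍ if the
  -- determinant is negative.
  refine ⟨⟨⟨(a * b + c * d) / (b ^ 2 + d ^ 2), |a * d - b * c| / (b ^ 2 + d ^ 2)⟩,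
    div_pos (abs_pos.mpr hdet) hD⟩, ?_⟩
  simp only [side, UpperHalfPlane.re, UpperHalfPlane.im, ← ha, ← hb, ← hc, ← hd]
  rw [div_pow, div_pow, sq_abs, ← add_div]
  have e : (a * b + c * d) ^ 2 + (a * d - b * c) ^ 2 = (a ^ 2 + c ^ 2) * (b ^ 2 + d ^ 2) := by
    ring
  rw [e]
  refine mul_eq_zero_of_right _ ?_
  field_simp
  ring

theorem TriSet.region_nonempty (s : TriSet τ) : s.region.Nonempty := by
  obtain ⟨x, y, z, h, rfl⟩ := s.exists_pos
  obtain ⟨p, hp⟩ := exists_side_eq_zero (ne_of_orient_pos h.pos).1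
  have hp' : side y.1 x.1 p = 0 := by rw [side_swap, hp, neg_zero]
  obtain ⟨h₁, h₂⟩ := side_pos_of_side_eq_zero h.pos hp'
  exact ⟨p, x, y, z, h, rfl, hp.ge, h₁.le, h₂.le⟩

theorem eq_or_eq_of_orient_eq_zero {a b x : Cusp Γ} (hab : a ≠ b)
    (h : orient a.1 b.1 x.1 = 0) : x = a ∨ x = b := by
  rcases orient_eq_zero_iff.mp h with h | h | h
  · exact absurd (Subtype.ext h) hab
  · exact Or.inr (Subtype.ext h.symm)
  · exact Or.inl (Subtype.ext h)

theorem not_side_eq_zero_two {x y z : OnePoint ℝ} {p : ℍ} (h : 0 < orient x y z)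
    (h₁ : side x y p = 0) : 0 < side y z p ∧ 0 < side z x p :=
  side_pos_of_side_eq_zero h (by rw [side_swap, h₁, neg_zero])

/-- A triangle beyond an edge of another triangle which shares a point with it has that edge. -/
theorem share_of_orient_nonpos {a b x y z : Cusp Γ} {p : ℍ} (hab : a ≠ b) (h : IsTri τ x y z)
    (hp : p ∈ idealTriangle x.1 y.1 z.1) (hs : 0 ≤ side a.1 b.1 p)
    (hx : orient a.1 b.1 x.1 ≤ 0) (hy : orient a.1 b.1 y.1 ≤ 0) (hz : orient a.1 b.1 z.1 ≤ 0) :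
    a ∈ h.set.1 ∧ b ∈ h.set.1 := by
  obtain ⟨h₁, h₂, h₃⟩ := hp
  have key := orient_mul_side a.1 b.1 x.1 y.1 z.1 p
  have k0 : 0 ≤ orient x.1 y.1 z.1 * side a.1 b.1 p := mul_nonneg h.pos.le hs
  have k₁ := mul_nonpos_of_nonpos_of_nonneg hx h₂
  have k₂ := mul_nonpos_of_nonpos_of_nonneg hy h₃
  have k₃ := mul_nonpos_of_nonpos_of_nonneg hz h₁
  -- Three nonpositive terms have a nonnegative sum, so each is zero. At most one of the `side`
  -- factors vanishes at `p`, hence two vertices lie at the ends of the geodesic `ab`.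
  have z₁ : orient a.1 b.1 x.1 * side y.1 z.1 p = 0 := by linarith
  have z₂ : orient a.1 b.1 y.1 * side z.1 x.1 p = 0 := by linarith
  have z₃ : orient a.1 b.1 z.1 * side x.1 y.1 p = 0 := by linarith
  have hxy : x ≠ y := h.ne.1
  have hyz : y ≠ z := h.ne.2.1
  have hzx : z ≠ x := h.ne.2.2
  have main : (∃ u v, u ≠ v ∧ u ∈ h.set.1 ∧ v ∈ h.set.1 ∧ orient a.1 b.1 u.1 = 0 ∧
      orient a.1 b.1 v.1 = 0) := by
    have hx' : x ∈ h.set.1 := Or.inl rfl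
    have hy' : y ∈ h.set.1 := Or.inr (Or.inl rfl)
    have hz' : z ∈ h.set.1 := Or.inr (Or.inr rfl)
    rcases mul_eq_zero.mp z₁ with o₁ | s₁
    · rcases mul_eq_zero.mp z₂ with o₂ | s₂
      · exact ⟨x, y, hxy, hx', hy', o₁, o₂⟩
      · have := (not_side_eq_zero_two h.rotate.rotate.pos s₂).1
        exact ⟨z, x, hzx, hz', hx', (mul_eq_zero.mp z₃).resolve_right this.ne', o₁⟩
    · obtain ⟨s₂, s₃⟩ := not_side_eq_zero_two h.rotate.pos s₁
      exact ⟨y, z, hyz, hy', hz', (mul_eq_zero.mp z₂).resolve_right s₂.ne',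
        (mul_eq_zero.mp z₃).resolve_right s₃.ne'⟩
  obtain ⟨u, v, huv, hu, hv, ou, ov⟩ := main
  rcases eq_or_eq_of_orient_eq_zero hab ou with rfl | rfl <;>
    rcases eq_or_eq_of_orient_eq_zero hab ov with rfl | rfl
  · exact absurd rfl huv
  · exact ⟨hu, hv⟩
  · exact ⟨hv, hu⟩
  · exact absurd rfl huv

namespace IsIdealTriangulation

/-- By `one_side`, the second triangle lies either beyond some side of the first, and then shares
that side, or within all three sides, and then its vertices are among those of the first. -/
theorem eq_or_adj_of_mem_region (hτ : IsIdealTriangulation τ) {s t : TriSet τ} {p : ℍ}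
    (hs : p ∈ s.region) (ht : p ∈ t.region) : s = t ∨ (dual τ).Adj s t := by
  obtain ⟨x, y, z, h, rfl, h₁, h₂, h₃⟩ := hs
  obtain ⟨x', y', z', h', rfl, hp⟩ := ht
  by_cases hst : h.set = h'.set
  · exact Or.inl hst
  refine Or.inr ⟨hst, ?_⟩
  have hx' : x ∈ h.set.1 := Or.inl rfl
  have hy' : y ∈ h.set.1 := Or.inr (Or.inl rfl)
  have hz' : z ∈ h.set.1 := Or.inr (Or.inr rfl)
  rcases hτ.one_side h.xy h' with a | a
  · rcases hτ.one_side h.yz h' with b | b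
    · rcases hτ.one_side h.zx h' with c | c
      · have aux : ∀ w : Cusp Γ, 0 ≤ orient x.1 y.1 w.1 → 0 ≤ orient y.1 z.1 w.1 →
            0 ≤ orient z.1 x.1 w.1 → w ∈ h.set.1 := by
          intro w u₁ u₂ u₃
          by_cases e₁ : w = x
          · exact e₁ ▸ hx'
          by_cases e₂ : w = y
          · exact e₂ ▸ hy'
          have : w = z := Subtype.ext (eq_of_orient_nonneg h.pos (fun e => e₁ (Subtype.ext e))
            (fun e => e₂ (Subtype.ext e)) u₁ u₂ u₃)
          exact this ▸ hz'
        exact ⟨x', y', h'.ne.1, aux _ a.1 b.1 c.1, aux _ a.2.1 b.2.1 c.2.1, Or.inl rfl,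
          Or.inr (Or.inl rfl)⟩
      · obtain ⟨u, v⟩ := share_of_orient_nonpos h.ne.2.2 h' hp h₃ c.1 c.2.1 c.2.2
        exact ⟨z, x, h.ne.2.2, hz', hx', u, v⟩
    · obtain ⟨u, v⟩ := share_of_orient_nonpos h.ne.2.1 h' hp h₂ b.1 b.2.1 b.2.2
      exact ⟨y, z, h.ne.2.1, hy', hz', u, v⟩
  · obtain ⟨u, v⟩ := share_of_orient_nonpos h.ne.1 h' hp h₁ a.1 a.2.1 a.2.2
    exact ⟨x, y, h.ne.1, hx', hy', u, v⟩

/-- The triangles on the two sides of an edge together fill a neighbourhood of each of its points,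
because the other four side functions stay positive nearby. This gives local finiteness of the
triangulation without using discreteness of `Γ`. -/
theorem exists_nhds_of_side_eq_zero (hτ : IsIdealTriangulation τ) {x y z : Cusp Γ} {p : ℍ}
    (h : IsTri τ x y z) (hp : side x.1 y.1 p = 0) :
    ∃ s t : TriSet τ, p ∈ s.region ∧ p ∈ t.region ∧ s.region ∪ t.region ∈ nhds p := by
  obtain ⟨w, k⟩ := hτ.exists_tri y x (by rw [arc_comm]; exact h.xy)
  obtain ⟨a₁, a₂⟩ := not_side_eq_zero_two h.pos hp
  obtain ⟨b₁, b₂⟩ := side_pos_of_side_eq_zero k.pos hp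
  refine ⟨h.set, k.set, ⟨x, y, z, h, rfl, hp.ge, a₁.le, a₂.le⟩,
    ⟨y, x, w, k, rfl, by rw [side_swap, hp, neg_zero], b₁.le, b₂.le⟩, ?_⟩
  filter_upwards [(continuous_side y.1 z.1).continuousAt.eventually_const_lt a₁,
    (continuous_side z.1 x.1).continuousAt.eventually_const_lt a₂,
    (continuous_side x.1 w.1).continuousAt.eventually_const_lt b₁,
    (continuous_side w.1 y.1).continuousAt.eventually_const_lt b₂] with q q₁ q₂ q₃ q₄
  rcases le_total 0 (side x.1 y.1 q) with hq | hq
  · exact Or.inl ⟨x, y, z, h, rfl, hq, q₁.le, q₂.le⟩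
  · exact Or.inr ⟨y, x, w, k, rfl, by rw [side_swap]; linarith, q₃.le, q₄.le⟩

theorem exists_nhds (hτ : IsIdealTriangulation τ) (p : ℍ) :
    ∃ s t : TriSet τ, p ∈ s.region ∧ p ∈ t.region ∧ s.region ∪ t.region ∈ nhds p := by
  obtain ⟨x, y, z, h, h₁, h₂, h₃⟩ := hτ.cover p
  rcases h₁.eq_or_lt with e₁ | l₁
  · exact hτ.exists_nhds_of_side_eq_zero h e₁.symm
  rcases h₂.eq_or_lt with e₂ | l₂
  · exact hτ.exists_nhds_of_side_eq_zero h.rotate e₂.symm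
  rcases h₃.eq_or_lt with e₃ | l₃
  · exact hτ.exists_nhds_of_side_eq_zero h.rotate.rotate e₃.symm
  have hp : p ∈ h.set.region := ⟨x, y, z, h, rfl, h₁, h₂, h₃⟩
  refine ⟨h.set, h.set, hp, hp, ?_⟩
  filter_upwards [(continuous_side x.1 y.1).continuousAt.eventually_const_lt l₁,
    (continuous_side y.1 z.1).continuousAt.eventually_const_lt l₂,
    (continuous_side z.1 x.1).continuousAt.eventually_const_lt l₃] with q q₁ q₂ q₃
  exact Or.inl ⟨x, y, z, h, rfl, q₁.le, q₂.le, q₃.le⟩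

/-- The union of the triangles reachable from `s` is open and closed in the connected space ℍ:
locally two triangles suffice, and triangles with a common point are equal or adjacent. -/
theorem reachable (hτ : IsIdealTriangulation τ) (s t : TriSet τ) : (dual τ).Reachable s t := by
  have step : ∀ {u v : TriSet τ} {p : ℍ}, p ∈ u.region → p ∈ v.region →
      (dual τ).Reachable u v := by
    intro u v p hu hv
    rcases hτ.eq_or_adj_of_mem_region hu hv with rfl | h
    · exact SimpleGraph.Reachable.refl _
    · exact h.reachable
  let U : Set ℍ := {p | ∃ u : TriSet τ, (dual τ).Reachable s u ∧ p ∈ u.region}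
  have hU : IsOpen U := by
    rw [isOpen_iff_mem_nhds]
    rintro p ⟨u, hu, hp⟩
    obtain ⟨v, w, hv, hw, hn⟩ := hτ.exists_nhds p
    filter_upwards [hn] with q hq
    rcases hq with hq | hq
    · exact ⟨v, hu.trans (step hp hv), hq⟩
    · exact ⟨w, hu.trans (step hp hw), hq⟩
  have hU' : IsClosed U := by
    rw [← isOpen_compl_iff, isOpen_iff_mem_nhds]
    intro p hp
    obtain ⟨v, w, hv, hw, hn⟩ := hτ.exists_nhds p
    filter_upwards [hn] with q hq
    rintro ⟨u, hu, hqu⟩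
    rcases hq with hq | hq
    · exact hp ⟨v, hu.trans (step hqu hq), hv⟩
    · exact hp ⟨w, hu.trans (step hqu hq), hw⟩
  obtain ⟨p, hp⟩ := s.region_nonempty
  have huniv : U = Set.univ :=
    IsClopen.eq_univ ⟨hU', hU⟩ ⟨p, s, SimpleGraph.Reachable.refl _, hp⟩
  obtain ⟨q, hq⟩ := t.region_nonempty
  obtain ⟨u, hu, hqu⟩ : q ∈ U := huniv ▸ Set.mem_univ q
  exact hu.trans (step hqu hq)

end IsIdealTriangulation

/-! ### Potentials on trees -/

section Potential

variable {V K : Type*} [Group K] {X : SimpleGraph V}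

/-- The ordered product of the values of `c` on the darts of a walk. -/
def walkProd (c : V → V → K) : ∀ {u v : V}, X.Walk u v → K
  | _, _, .nil => 1
  | u, _, .cons (v := v) _ p => c u v * walkProd c p

theorem walkProd_concat (c : V → V → K) {u v w : V} (p : X.Walk u v) (h : X.Adj v w) :
    walkProd c (p.concat h) = walkProd c p * c v w := by
  induction p with
  | nil => simp [walkProd, SimpleGraph.Walk.concat]
  | cons h' p ih =>
    rw [SimpleGraph.Walk.concat_cons, walkProd, walkProd, ih, mul_assoc]

/-- A transport along the edges of a tree has a potential. -/
theorem exists_potential (hX : X.IsAcyclic) (hr : ∀ s t, X.Reachable s t) (c : V → V → K)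
    (hc : ∀ s t, X.Adj s t → c s t * c t s = 1) :
    ∃ h : V → K, ∀ s t, X.Adj s t → h t = h s * c s t := by
  classical
  rcases isEmpty_or_nonempty V with hV | ⟨⟨r⟩⟩
  · exact ⟨fun _ => 1, fun s => hV.elim s⟩
  have hp : ∀ v, ∃ p : X.Walk r v, p.IsPath := fun v => by
    obtain ⟨p⟩ := hr r v
    exact ⟨p.bypass, p.bypass_isPath⟩
  choose p hp using hp
  -- The potential is the product along the path from the root. For adjacent vertices of a tree, one
  -- of the two paths extends the other by the edge between them.
  refine ⟨fun v => walkProd c (p v), fun s t hst => ?_⟩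
  beta_reduce
  by_cases hs : s ∈ (p t).support
  · rw [hX.path_concat (hp s) (hp t) hst hs, walkProd_concat]
  · have ht := hX.mem_support_of_ne_mem_support_of_adj_of_isPath (hp s) (hp t) hst hs
    rw [hX.path_concat (hp t) (hp s) hst.symm ht, walkProd_concat, mul_assoc,
      hc t s hst.symm, mul_one]

end Potential

/-! ### The dual graph is a tree -/

/-- All vertices of the triangle lie weakly to the right of the geodesic from `a` to `b`. -/
def TriSet.Far (s : TriSet τ) (a b : Cusp Γ) : Prop := ∀ v ∈ s.1, orient a.1 b.1 v.1 ≤ 0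

namespace IsIdealTriangulation

theorem far_or_near (hτ : IsIdealTriangulation τ) {a b : Cusp Γ} (hab : arc a b ∈ τ)
    (s : TriSet τ) : s.Far a b ∨ ∀ v ∈ s.1, 0 ≤ orient a.1 b.1 v.1 := by
  obtain ⟨x, y, z, h, rfl⟩ := s.exists_pos
  rcases hτ.one_side hab h with ⟨h₁, h₂, h₃⟩ | ⟨h₁, h₂, h₃⟩
  · right; rintro v (rfl | rfl | rfl) <;> assumption
  · left; rintro v (rfl | rfl | rfl) <;> assumption

/-- Somewhere the walk passes from the far side of `ab` to the near side. The two vertices shared at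
that step lie weakly on both sides, so they are `a` and `b`, and `third_unique` identifies the two
triangles. -/
theorem mem_edges_of_far (hτ : IsIdealTriangulation τ) {a b c d : Cusp Γ} (h : IsTri τ a b c)
    (k : IsTri τ b a d) {s t : TriSet τ} (p : (dual τ).Walk s t) (hs : s.Far a b)
    (ht : ¬ t.Far a b) : s(k.set, h.set) ∈ p.edges := by
  induction p with
  | nil => exact absurd hs ht
  | @cons s u t hsu p ih =>
    by_cases hu : u.Far a b
    · exact List.mem_cons_of_mem _ (ih hu ht)
    · have hn := (hτ.far_or_near h.xy u).resolve_left hu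
      obtain ⟨-, q, r, hqr, hq, hr, hq', hr'⟩ := hsu
      have oq := le_antisymm (hs q hq) (hn q hq')
      have or := le_antisymm (hs r hr) (hn r hr')
      have hab : a ∈ s.1 ∧ b ∈ s.1 ∧ a ∈ u.1 ∧ b ∈ u.1 := by
        rcases eq_or_eq_of_orient_eq_zero h.ne.1 oq with rfl | rfl <;>
          rcases eq_or_eq_of_orient_eq_zero h.ne.1 or with rfl | rfl
        · exact absurd rfl hqr
        · exact ⟨hq, hr, hq', hr'⟩
        · exact ⟨hr, hq, hr', hq'⟩
        · exact absurd rfl hqr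
      obtain ⟨h₁, h₂, h₃, h₄⟩ := hab
      have es : s = k.set := by
        rcases s.exists_third h.ne.1 h₁ h₂ with ⟨e, l, rfl⟩ | ⟨e, l, rfl⟩
        · exact absurd (hs e (Or.inr (Or.inr rfl))) (not_le.mpr l.pos)
        · obtain rfl := hτ.third_unique k l; rfl
      have eu : u = h.set := by
        rcases u.exists_third h.ne.1 h₃ h₄ with ⟨e, l, rfl⟩ | ⟨e, l, rfl⟩
        · obtain rfl := hτ.third_unique h l; rfl
        · have := hn e (Or.inr (Or.inr rfl))
          have hl := l.pos
          rw [orient_swap] at hl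
          linarith
      subst es eu
      exact List.mem_cons_self

theorem far_of_tri {a b d : Cusp Γ} (k : IsTri τ b a d) : k.set.Far a b := by
  rintro v (rfl | rfl | rfl)
  · exact (orient_eq_zero_iff.mpr (Or.inr (Or.inl rfl))).le
  · exact (orient_eq_zero_iff.mpr (Or.inr (Or.inr rfl))).le
  · rw [orient_swap]; linarith [k.pos]

theorem not_far_of_mem {a b c : Cusp Γ} {s : TriSet τ} (hc : c ∈ s.1)
    (h : 0 < orient a.1 b.1 c.1) : ¬ s.Far a b := fun hf => absurd (hf c hc) (not_le.mpr h)

/-- Every dual edge is a bridge: a walk between its ends changes sides of the common geodesic, hence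
uses that dual edge. -/
theorem isAcyclic (hτ : IsIdealTriangulation τ) : (dual τ).IsAcyclic := by
  rw [SimpleGraph.isAcyclic_iff_forall_adj_isBridge]
  intro s t hst
  rw [SimpleGraph.isBridge_iff_forall_walk_mem_edges]
  intro p
  obtain ⟨a, b, c, d, h, k, rfl, rfl⟩ := hτ.exists_of_adj hst
  have := hτ.mem_edges_of_far h k p.reverse (far_of_tri k)
    (not_far_of_mem (Or.inr (Or.inr rfl)) h.pos)
  rw [SimpleGraph.Walk.edges_reverse, List.mem_reverse] at this
  rwa [Sym2.eq_swap]

/-- Any two triangles with vertex `x` are connected by a sequence of such triangles. -/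
theorem fan_induction (hτ : IsIdealTriangulation τ) {x : Cusp Γ} {P : TriSet τ → Prop}
    (hP : ∀ s t, (dual τ).Adj s t → x ∈ s.1 → x ∈ t.1 → P s → P t) {s t : TriSet τ}
    (hs : x ∈ s.1) (ht : x ∈ t.1) (h : P s) : P t := by
  classical
  obtain ⟨p₀⟩ := hτ.reachable s t
  have hp := p₀.bypass_isPath
  generalize p₀.bypass = p at hp
  induction p with
  | nil => exact h
  | @cons s u t hsu p ih =>
    rw [SimpleGraph.Walk.cons_isPath_iff] at hp
    -- A path leaving the fan of `x` crosses the side opposite `x`. To end at a triangle with vertex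
    -- `x` it must recross that geodesic through the same dual edge, so it revisits `s`, which a
    -- path cannot do.
    suffices hu : x ∈ u.1 from ih hu ht (hP s u hsu hs hu h) p hp.1
    by_contra hu
    obtain ⟨a, b, c, d, l, k, rfl, rfl⟩ := hτ.exists_of_adj hsu
    have hxc : x = c := by
      rcases hs with rfl | rfl | hs
      · exact absurd (Or.inr (Or.inl rfl)) hu
      · exact absurd (Or.inl rfl) hu
      · exact hs
    subst hxc
    exact hp.2 (p.snd_mem_support_of_mem_edges (hτ.mem_edges_of_far l k p (far_of_tri k)
      (not_far_of_mem ht l.pos)))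

/-- Any oriented edge is reached from any other by turning inside triangles and reversing edges,
because the dual graph is connected. It serves for uniqueness of developments. -/
theorem edge_induction (hτ : IsIdealTriangulation τ) {Q : Cusp Γ → Cusp Γ → Prop}
    (rot : ∀ x y z, IsTri τ x y z → Q x y → Q y z) (flip : ∀ x y, arc x y ∈ τ → Q x y → Q y x)
    {a b c d : Cusp Γ} (hab : arc a b ∈ τ) (hcd : arc c d ∈ τ) (h : Q a b) : Q c d := by
  have all : ∀ {x y z} (t : IsTri τ x y z), Q x y → ∀ x' y' z', ∀ t' : IsTri τ x' y' z',
      t.set = t'.set → Q x' y' := by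
    intro x y z t hQ x' y' z' t' e
    have hx' : x' ∈ t.set.1 := e ▸ Or.inl rfl
    have hy' : y' ∈ t.set.1 := e ▸ Or.inr (Or.inl rfl)
    have q₁ := rot _ _ _ t hQ
    have q₂ := rot _ _ _ t.rotate q₁
    have hne := t'.ne.1
    rcases hx' with rfl | rfl | rfl <;> rcases hy' with rfl | rfl | rfl
    all_goals first
      | exact absurd rfl hne
      | assumption
      | exact flip _ _ t.xy hQ
      | exact flip _ _ t.yz q₁
      | exact flip _ _ t.zx q₂
  obtain ⟨e, t⟩ := hτ.exists_tri a b hab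
  obtain ⟨f, t'⟩ := hτ.exists_tri c d hcd
  have main : ∀ s : TriSet τ, (dual τ).Reachable t.set s →
      ∀ x y z, ∀ u : IsTri τ x y z, s = u.set → Q x y := by
    rintro s ⟨p⟩
    have hs := all t h
    generalize t.set = r at p hs
    induction p with
    | nil => exact hs
    | @cons r v s hrv p ih =>
      refine ih ?_
      obtain ⟨a, b, c, d, h, k, rfl, rfl⟩ := hτ.exists_of_adj hrv
      exact all k (flip _ _ h.xy (hs _ _ _ h rfl))
  exact main t'.set (hτ.reachable _ _) _ _ _ t' rfl

end IsIdealTriangulation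

/-- A positively oriented triple is determined by its underlying set up to rotation. -/
theorem eq_rotate_of_triple_eq {x y z a b c : Cusp Γ} (p : 0 < orient x.1 y.1 z.1)
    (q : 0 < orient a.1 b.1 c.1) (e : ({x, y, z} : Set (Cusp Γ)) = {a, b, c}) :
    (a = x ∧ b = y ∧ c = z) ∨ (a = y ∧ b = z ∧ c = x) ∨ (a = z ∧ b = x ∧ c = y) := by
  have ha : a ∈ ({x, y, z} : Set (Cusp Γ)) := e ▸ Or.inl rfl
  have hb : b ∈ ({x, y, z} : Set (Cusp Γ)) := e ▸ Or.inr (Or.inl rfl)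
  have hc : c ∈ ({x, y, z} : Set (Cusp Γ)) := e ▸ Or.inr (Or.inr rfl)
  have n := ne_of_orient_pos q
  have r₁ := orient_rotate x.1 y.1 z.1
  have r₂ := orient_rotate y.1 z.1 x.1
  have s₁ := orient_swap x.1 y.1 z.1
  have s₂ := orient_swap y.1 z.1 x.1
  have s₃ := orient_swap z.1 x.1 y.1
  rcases ha with rfl | rfl | rfl <;> rcases hb with rfl | rfl | rfl <;>
    rcases hc with rfl | rfl | rfl
  all_goals first
    | exact absurd rfl n.1
    | exact absurd rfl n.2.1
    | exact absurd rfl n.2.2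
    | exact Or.inl ⟨rfl, rfl, rfl⟩
    | exact Or.inr (Or.inl ⟨rfl, rfl, rfl⟩)
    | exact Or.inr (Or.inr ⟨rfl, rfl, rfl⟩)
    | (exfalso; linarith)

theorem IsTri.eq_of_set_eq {x y z a b c : Cusp Γ} (h : IsTri τ x y z) (k : IsTri τ a b c)
    (e : h.set = k.set) :
    (a = x ∧ b = y ∧ c = z) ∨ (a = y ∧ b = z ∧ c = x) ∨ (a = z ∧ b = x ∧ c = y) :=
  eq_rotate_of_triple_eq h.pos k.pos (congrArg Subtype.val e)

/-! ### Developments -/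

/-- `F` is a family of frames with transport `len x y` along the long edge from `(x, y)` to `(y, x)`
and `sh x y z` along the short edge at the corner `x` of the triangle `x, y, z`. -/
structure IsDevelopment {K : Type*} [Group K] (τ : Set (Orb Γ)) (len : Cusp Γ → Cusp Γ → K)
    (sh : Cusp Γ → Cusp Γ → Cusp Γ → K) (F : Cusp Γ → Cusp Γ → K) : Prop where
  long : ∀ x y, arc x y ∈ τ → F y x = F x y * len x y
  short : ∀ x y z, IsTri τ x y z → F x z = F x y * sh x y z

section Development

variable {K : Type*} [Group K] {len : Cusp Γ → Cusp Γ → K} {sh : Cusp Γ → Cusp Γ → Cusp Γ → K}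

theorem IsDevelopment.unique (hτ : IsIdealTriangulation τ) {F F' : Cusp Γ → Cusp Γ → K}
    (hF : IsDevelopment τ len sh F) (hF' : IsDevelopment τ len sh F') {a b c d : Cusp Γ}
    (hab : arc a b ∈ τ) (hcd : arc c d ∈ τ) (h : F a b = F' a b) : F c d = F' c d := by
  refine hτ.edge_induction (Q := fun x y => F x y = F' x y) ?_ ?_ hab hcd h
  · intro x y z t e
    have h₁ := hF.short y z x t.rotate
    have h₂ := hF'.short y z x t.rotate
    rw [hF.long x y t.xy, e, ← hF'.long x y t.xy, h₂] at h₁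
    exact (mul_right_cancel h₁).symm
  · intro x y hxy e
    rw [hF.long x y hxy, hF'.long x y hxy, e]

/-- `P a` stands for the frame at `a` on the side from `a` to the next vertex, relative to a first
frame in the same triangle. The hexagon relation is what makes going around all three vertices
consistent. -/
theorem exists_localFrame {sh : Cusp Γ → Cusp Γ → Cusp Γ → K} {len : Cusp Γ → Cusp Γ → K}
    (hhex : ∀ x y z, IsTri τ x y z → len x y * (sh y z x)⁻¹ * (len y z * (sh z x y)⁻¹) *
      (len z x * (sh x y z)⁻¹) = 1) (s : TriSet τ) :
    ∃ P : Cusp Γ → K, ∀ a b c, ∀ k : IsTri τ a b c, s = k.set →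
      P b = P a * (len a b * (sh b c a)⁻¹) := by
  classical
  obtain ⟨x, y, z, h, rfl⟩ := s.exists_pos
  refine ⟨fun a => if a = x then 1 else if a = y then len x y * (sh y z x)⁻¹ else
    len x y * (sh y z x)⁻¹ * (len y z * (sh z x y)⁻¹), fun a b c k e => ?_⟩
  obtain ⟨n₁, n₂, n₃⟩ := h.ne
  rcases h.eq_of_set_eq k e with ⟨rfl, rfl, rfl⟩ | ⟨rfl, rfl, rfl⟩ | ⟨rfl, rfl, rfl⟩
  · simp [n₁.symm]
  · simp [n₁.symm, n₂.symm, n₃]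
  · simp only [if_true, if_neg n₃, if_neg n₂.symm]
    exact (hhex _ _ _ h).symm

/-- The developing map exists since the dual graph is a tree. -/
theorem exists_isDevelopment (hτ : IsIdealTriangulation τ)
    (hlen : ∀ x y, arc x y ∈ τ → len x y * len y x = 1)
    (hhex : ∀ x y z, IsTri τ x y z → len x y * (sh y z x)⁻¹ * (len y z * (sh z x y)⁻¹) *
      (len z x * (sh x y z)⁻¹) = 1) :
    ∃ F, IsDevelopment τ len sh F := by
  classical
  choose P hP using exists_localFrame (τ := τ) hhex
  -- The transition between the local frames of adjacent triangles. It does not depend on the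
  -- labelling, since two distinct adjacent triangles share exactly one edge and the orientation of
  -- `s` fixes its direction.
  have hc : ∀ s t : TriSet τ, ∃ g : K, (dual τ).Adj s t →
      ∀ a b c d, ∀ (h : IsTri τ a b c) (k : IsTri τ b a d), s = h.set → t = k.set →
        g = P s a * len a b * (P t b)⁻¹ := by
    intro s t
    by_cases hst : (dual τ).Adj s t
    · obtain ⟨a, b, c, d, h, k, rfl, rfl⟩ := hτ.exists_of_adj hst
      refine ⟨P h.set a * len a b * (P k.set b)⁻¹, fun _ a' b' c' d' h' k' es et => ?_⟩
      have hcd : c ≠ d := by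
        rintro rfl
        have h1 := h.pos
        have h2 := k.pos
        rw [orient_swap] at h2
        linarith
      obtain ⟨n₁, n₂, n₃⟩ := h.ne
      obtain ⟨m₁, m₂, m₃⟩ := k.ne
      have : a' = a ∧ b' = b := by
        rcases h.eq_of_set_eq h' es with ⟨rfl, rfl, rfl⟩ | ⟨rfl, rfl, rfl⟩ | ⟨rfl, rfl, rfl⟩
        · exact ⟨rfl, rfl⟩
        · rcases k.eq_of_set_eq k' et with ⟨e₁, e₂, e₃⟩ | ⟨e₁, e₂, e₃⟩ | ⟨e₁, e₂, e₃⟩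
          · exact absurd e₁.symm n₂
          · exact absurd e₁ n₃
          · exact absurd e₁ hcd
        · rcases k.eq_of_set_eq k' et with ⟨e₁, e₂, e₃⟩ | ⟨e₁, e₂, e₃⟩ | ⟨e₁, e₂, e₃⟩
          · exact absurd e₁ n₁
          · exact absurd e₂ hcd
          · exact absurd e₂.symm n₂
      rw [this.1, this.2]
    · exact ⟨1, fun h => absurd h hst⟩
  choose g hg using hc
  obtain ⟨H, hH⟩ := exists_potential hτ.isAcyclic hτ.reachable g (by
    intro s t hst
    obtain ⟨a, b, c, d, h, k, rfl, rfl⟩ := hτ.exists_of_adj hst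
    rw [hg _ _ hst a b c d h k rfl rfl, hg _ _ hst.symm b a d c k h rfl rfl]
    have := hlen a b h.xy
    simp only [mul_assoc, inv_mul_cancel_left]
    rw [← mul_assoc (len a b), this, one_mul, mul_inv_cancel])
  -- The frame on `(a, b)` is read off in the triangle to the left of `ab`, with `H` gluing the
  -- local frames. The value `1` off `τ` plays no role.
  let F : Cusp Γ → Cusp Γ → K := fun a b =>
    if h : arc a b ∈ τ then H (hτ.exists_tri a b h).choose_spec.set *
      P (hτ.exists_tri a b h).choose_spec.set a else 1
  have hF : ∀ {x y z} (t : IsTri τ x y z), F x y = H t.set * P t.set x := by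
    intro x y z t
    have hz := hτ.third_unique t (hτ.exists_tri x y t.xy).choose_spec
    have hs : (hτ.exists_tri x y t.xy).choose_spec.set = t.set := by
      refine Subtype.ext ?_
      change ({x, y, _} : Set (Cusp Γ)) = {x, y, z}
      rw [hz]
    change dite _ _ _ = _
    rw [dif_pos t.xy, hs]
  have long : ∀ x y, arc x y ∈ τ → F y x = F x y * len x y := by
    intro x y hxy
    obtain ⟨z, t⟩ := hτ.exists_tri x y hxy
    obtain ⟨w, u⟩ := hτ.exists_tri y x (by rwa [arc_comm])
    have hadj : (dual τ).Adj t.set u.set := by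
      refine ⟨fun e => ?_, x, y, t.ne.1, Or.inl rfl, Or.inr (Or.inl rfl), Or.inr (Or.inl rfl),
        Or.inl rfl⟩
      obtain ⟨n₁, n₂, n₃⟩ := t.ne
      rcases t.eq_of_set_eq u e with ⟨e₁, e₂, -⟩ | ⟨e₁, e₂, -⟩ | ⟨e₁, e₂, -⟩
      · exact n₁ e₂
      · exact n₃ e₂.symm
      · exact n₂ e₁
    rw [hF t, hF u, hH _ _ hadj, hg _ _ hadj x y z w t u rfl rfl]
    group
  refine ⟨F, long, fun x y z t => ?_⟩
  have e : t.rotate.rotate.set = t.set := t.rotate.set_rotate.trans t.set_rotate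
  rw [long z x t.zx, hF t.rotate.rotate, hF t, e, hP t.set z x y t.rotate.rotate e.symm]
  group

end Development

/-! ### The fan of triangles at a cusp -/

/-- The cusps joined to `x` by a lifted edge. -/
def Nbr (τ : Set (Orb Γ)) (x : Cusp Γ) : Type := {y : Cusp Γ // arc x y ∈ τ}

noncomputable instance (x : Cusp Γ) : MulAction (MulAction.stabilizer Γ x) (Nbr τ x) where
  smul γ y := ⟨γ.1 • y.1, by
    have h := arc_smul γ.1 x y.1
    rw [γ.2] at h
    rw [h]; exact y.2⟩
  one_smul y := Subtype.ext (one_smul Γ y.1)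
  mul_smul γ δ y := Subtype.ext (mul_smul γ.1 δ.1 y.1)

namespace IsIdealTriangulation

/-- The next neighbour of `x` in counterclockwise order. -/
noncomputable def fanSucc (hτ : IsIdealTriangulation τ) (x : Cusp Γ) :
    Equiv.Perm (Nbr τ x) where
  toFun y := ⟨(hτ.exists_tri x y.1 y.2).choose, (hτ.exists_tri x y.1 y.2).choose_spec.xz⟩
  invFun z :=
    have h := hτ.exists_tri z.1 x (by rw [arc_comm]; exact z.2)
    ⟨h.choose, h.choose_spec.yz⟩
  left_inv y := by
    refine Subtype.ext ?_
    have h₁ := (hτ.exists_tri x y.1 y.2).choose_spec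
    have h₂ := (hτ.exists_tri _ x (by rw [arc_comm]; exact h₁.xz)).choose_spec
    exact hτ.third_unique h₁.rotate.rotate h₂
  right_inv z := by
    refine Subtype.ext ?_
    have h₁ := (hτ.exists_tri z.1 x (by rw [arc_comm]; exact z.2)).choose_spec
    have h₂ := (hτ.exists_tri x _ h₁.yz).choose_spec
    exact hτ.third_unique h₁.rotate h₂

theorem isTri_fanSucc (hτ : IsIdealTriangulation τ) {x : Cusp Γ}
    (y : Nbr τ x) : IsTri τ x y.1 (hτ.fanSucc x y).1 :=
  (hτ.exists_tri x y.1 y.2).choose_spec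

theorem fanSucc_eq (hτ : IsIdealTriangulation τ) {x : Cusp Γ}
    {y z : Nbr τ x} (h : IsTri τ x y.1 z.1) : hτ.fanSucc x y = z :=
  Subtype.ext (hτ.third_unique h (hτ.isTri_fanSucc y))

theorem fanSucc_smul (hτ : IsIdealTriangulation τ) {x : Cusp Γ}
    (γ : MulAction.stabilizer Γ x) (y : Nbr τ x) :
    hτ.fanSucc x (γ • y) = γ • hτ.fanSucc x y := by
  refine hτ.fanSucc_eq ?_
  have h := (hτ.isTri_fanSucc y).smul γ.1
  rw [γ.2] at h
  exact h

theorem fanSucc_zpow_smul (hτ : IsIdealTriangulation τ) {x : Cusp Γ}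
    (γ : MulAction.stabilizer Γ x) (y : Nbr τ x) (k : ℤ) :
    (hτ.fanSucc x ^ k) (γ • y) = γ • (hτ.fanSucc x ^ k) y := by
  have hc : Commute (hτ.fanSucc x) (MulAction.toPerm γ) :=
    Equiv.ext fun y => hτ.fanSucc_smul γ y
  exact Equiv.congr_fun (hc.zpow_left k).eq y

/-- Crossing an edge at `x` moves one step forwards or backwards in the fan, and `fan_induction`
connects all triangles at `x` by such crossings. -/
theorem sameCycle_fanSucc (hτ : IsIdealTriangulation τ) {x : Cusp Γ}
    (y z : Nbr τ x) : (hτ.fanSucc x).SameCycle y z := by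
  have key := hτ.fan_induction (x := x)
    (P := fun s => ∀ v w, ∀ t : IsTri τ x v w, s = t.set → (hτ.fanSucc x).SameCycle y ⟨v, t.xy⟩)
    ?_ (s := (hτ.isTri_fanSucc y).set) (t := (hτ.isTri_fanSucc z).set) (Or.inl rfl) (Or.inl rfl) ?_
  · exact key _ _ (hτ.isTri_fanSucc z) rfl
  · intro s t hst hs ht ih v w u hu
    obtain ⟨a, b, c, d, h, k, rfl, rfl⟩ := hτ.exists_of_adj hst
    have hab : x = a ∨ x = b := by
      rcases hs with e | e | e
      · exact Or.inl e
      · exact Or.inr e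
      · rcases ht with e' | e' | e'
        · exact Or.inr e'
        · exact Or.inl e'
        · obtain rfl : c = d := e.symm.trans e'
          have h1 := h.pos
          have h2 := k.pos
          rw [orient_swap] at h2
          linarith
    rcases hab with rfl | rfl
    · have ih := ih b c h rfl
      have hv : v = d := by
        rcases k.eq_of_set_eq u hu with ⟨e, -, -⟩ | ⟨-, e, -⟩ | ⟨e, -, -⟩
        · exact absurd e h.ne.1
        · exact e
        · exact absurd e k.ne.2.1
      subst hv
      have e : hτ.fanSucc x ⟨v, u.xy⟩ = ⟨b, h.xy⟩ := hτ.fanSucc_eq k.rotate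
      rw [← e] at ih
      exact Equiv.Perm.sameCycle_apply_right.mp ih
    · have ih := ih c a h.rotate h.set_rotate.symm
      have e : hτ.fanSucc x ⟨c, h.yz⟩ = ⟨a, k.xy⟩ := hτ.fanSucc_eq h.rotate
      have hv : v = a := by
        rcases k.eq_of_set_eq u hu with ⟨-, e, -⟩ | ⟨e, -, -⟩ | ⟨e, -, -⟩
        · exact e
        · exact absurd e k.ne.1
        · exact absurd e.symm k.ne.2.2
      subst hv
      rw [← e]
      exact Equiv.Perm.sameCycle_apply_right.mpr ih
  · intro v w t e
    have hv : v = y.1 := by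
      have n := (hτ.isTri_fanSucc y).ne
      rcases (hτ.isTri_fanSucc y).eq_of_set_eq t e with ⟨-, e, -⟩ | ⟨e, -, -⟩ | ⟨e, -, -⟩
      · exact e
      · exact absurd e n.1
      · exact absurd e.symm n.2.2
    subst hv
    exact Equiv.Perm.SameCycle.refl _ _

/-- Seen from `x`, the boundary is a line along which successors move strictly in one direction. So
the successor generates a free action of ℤ on the neighbours. -/
theorem orient_fanSucc_pow_pos (hτ : IsIdealTriangulation τ) {x : Cusp Γ}
    (y : Nbr τ x) (n : ℕ) :
    0 < orient x.1 y.1.1 ((hτ.fanSucc x ^ (n + 1)) y).1.1 := by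
  induction n with
  | zero => simpa using (hτ.isTri_fanSucc y).pos
  | succ n ih =>
    rw [pow_succ', Equiv.Perm.mul_apply]
    exact orient_trans ih (hτ.isTri_fanSucc _).pos

theorem fanSucc_pow_ne (hτ : IsIdealTriangulation τ) {x : Cusp Γ}
    (y : Nbr τ x) {n : ℕ} (hn : n ≠ 0) : (hτ.fanSucc x ^ n) y ≠ y := by
  obtain ⟨m, rfl⟩ := Nat.exists_eq_succ_of_ne_zero hn
  intro h
  have := hτ.orient_fanSucc_pow_pos y m
  rw [← Nat.succ_eq_add_one, h] at this
  exact (ne_of_orient_pos this).2.1 rfl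

theorem eq_zero_of_fanSucc_zpow_eq (hτ : IsIdealTriangulation τ) {x : Cusp Γ}
    {y : Nbr τ x} {k : ℤ} (h : (hτ.fanSucc x ^ k) y = y) :
    k = 0 := by
  by_contra hk
  refine hτ.fanSucc_pow_ne y (Int.natAbs_ne_zero.mpr hk) ?_
  rcases Int.natAbs_eq k with e | e
  · rw [e, zpow_natCast] at h
    exact h
  · rw [e, zpow_neg, zpow_natCast, Equiv.Perm.inv_eq_iff_eq] at h
    exact h.symm

theorem fanSucc_zpow_injective (hτ : IsIdealTriangulation τ) {x : Cusp Γ}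
    {y : Nbr τ x} {k l : ℤ}
    (h : (hτ.fanSucc x ^ k) y = (hτ.fanSucc x ^ l) y) : k = l := by
  have : (hτ.fanSucc x ^ (k - l)) y = y := by
    rw [sub_eq_neg_add, zpow_add, Equiv.Perm.mul_apply, h, ← Equiv.Perm.mul_apply, ← zpow_add,
      neg_add_cancel, zpow_zero, Equiv.Perm.one_apply]
  linarith [hτ.eq_zero_of_fanSucc_zpow_eq this]

theorem eq_one_of_smul_eq (hτ : IsIdealTriangulation τ) {x : Cusp Γ}
    (hΓ : ∀ γ ∈ Γ, γ ≠ 1 → ∀ z : ℍ, γ • z ≠ z)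
    {γ : MulAction.stabilizer Γ x} {y : Nbr τ x} (h : γ • y = y) : γ = 1 := by
  have h2 : γ • hτ.fanSucc x y = hτ.fanSucc x y := by rw [← hτ.fanSucc_smul, h]
  exact Subtype.ext (eq_one_of_fix_three hΓ (hτ.isTri_fanSucc y).pos γ.2
    (congrArg Subtype.val h) (congrArg Subtype.val h2))

/-- The stabilizer of a cusp is generated by an element that shifts the fan by `d > 0` steps. -/
theorem exists_stabilizer_generator (hτ : IsIdealTriangulation τ) {x : Cusp Γ}
    (hΓ : ∀ γ ∈ Γ, γ ≠ 1 → ∀ z : ℍ, γ • z ≠ z) (y : Nbr τ x) :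
    ∃ (d : ℕ) (δ : MulAction.stabilizer Γ x), 0 < d ∧ δ • y = (hτ.fanSucc x ^ d) y ∧
      ∀ γ : MulAction.stabilizer Γ x, ∃ m : ℤ, γ = δ ^ m := by
  have add : ∀ {γ δ : MulAction.stabilizer Γ x} {k l : ℤ}, γ • y = (hτ.fanSucc x ^ k) y →
      δ • y = (hτ.fanSucc x ^ l) y → (γ * δ) • y = (hτ.fanSucc x ^ (k + l)) y := by
    intro γ δ k l h₁ h₂
    rw [mul_smul, h₂, ← hτ.fanSucc_zpow_smul, h₁, add_comm, zpow_add, Equiv.Perm.mul_apply]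
  have neg : ∀ {γ : MulAction.stabilizer Γ x} {k : ℤ}, γ • y = (hτ.fanSucc x ^ k) y →
      γ⁻¹ • y = (hτ.fanSucc x ^ (-k)) y := by
    intro γ k h
    rw [inv_smul_eq_iff, ← hτ.fanSucc_zpow_smul, h, ← Equiv.Perm.mul_apply, ← zpow_add,
      neg_add_cancel, zpow_zero, Equiv.Perm.one_apply]
  -- The shifts of the fan realized by the stabilizer. The group is cyclic as a subgroup of ℤ, and
  -- nonzero because a cusp has a nontrivial stabilizer and freeness makes shift zero trivial.
  let H : AddSubgroup ℤ :=
    { carrier := {k | ∃ γ : MulAction.stabilizer Γ x, γ • y = (hτ.fanSucc x ^ k) y}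
      zero_mem' := ⟨1, by simp⟩
      add_mem' := by
        rintro k l ⟨γ, h₁⟩ ⟨δ, h₂⟩
        exact ⟨γ * δ, add h₁ h₂⟩
      neg_mem' := by
        rintro k ⟨γ, h⟩
        exact ⟨γ⁻¹, neg h⟩ }
  obtain ⟨a, ha⟩ := Int.subgroup_cyclic H
  rw [← AddSubgroup.zmultiples_eq_closure] at ha
  have hd : ((a.natAbs : ℕ) : ℤ) ∈ H := by
    rw [ha, Int.mem_zmultiples_iff, Int.dvd_natAbs]
  obtain ⟨δ, hδ⟩ := hd
  have shift : ∀ γ : MulAction.stabilizer Γ x, ∃ k : ℤ, γ • y = (hτ.fanSucc x ^ k) y := by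
    intro γ
    obtain ⟨k, hk⟩ := hτ.sameCycle_fanSucc y (γ • y)
    exact ⟨k, hk.symm⟩
  refine ⟨a.natAbs, δ, ?_, by rwa [zpow_natCast] at hδ, fun γ => ?_⟩
  · obtain ⟨γ, hγ, hne⟩ := x.exists_stabilizer_ne_one
    obtain ⟨k, hk⟩ := shift ⟨γ, hγ⟩
    have hkH : k ∈ H := ⟨_, hk⟩
    rw [Int.natAbs_pos]
    rintro rfl
    rw [ha, Int.mem_zmultiples_iff, zero_dvd_iff] at hkH
    subst hkH
    have := hτ.eq_one_of_smul_eq hΓ (γ := ⟨γ, hγ⟩) (y := y) (by simpa using hk)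
    exact hne (congrArg Subtype.val this)
  · obtain ⟨k, hk⟩ := shift γ
    have hkH : k ∈ H := ⟨_, hk⟩
    rw [ha, Int.mem_zmultiples_iff, ← Int.natAbs_dvd] at hkH
    obtain ⟨m, rfl⟩ := hkH
    have hpow : ∀ n : ℕ, (δ ^ n) • y = (hτ.fanSucc x ^ ((a.natAbs : ℤ) * n)) y := by
      intro n
      induction n with
      | zero => simp
      | succ n ih => rw [pow_succ, add ih hδ]; push_cast; rw [mul_add, mul_one]
    have hzpow : (δ ^ m) • y = (hτ.fanSucc x ^ ((a.natAbs : ℤ) * m)) y := by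
      rcases Int.natAbs_eq m with e | e
      · rw [e, zpow_natCast]; exact hpow _
      · rw [e, zpow_neg, zpow_natCast, mul_neg]; exact neg (hpow _)
    refine ⟨m, ?_⟩
    have := hτ.eq_one_of_smul_eq hΓ (γ := (δ ^ m)⁻¹ * γ) (y := y) (by
      rw [mul_smul, hk, ← hzpow, inv_smul_smul])
    rw [inv_mul_eq_one] at this
    exact this.symm

end IsIdealTriangulation

/-! ### Sums over corners -/

/-- The stabilizer of `x` shifts the fan by multiples of `d`, so `d` consecutive triangles represent
the corners at the puncture once each. An identification between two of them fixes `x`, hence is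
such a shift. -/
theorem corners_bijective (hτ : IsIdealTriangulation τ) {x : Cusp Γ} (y : Nbr τ x) {d : ℕ}
    {δ : MulAction.stabilizer Γ x} (hd : 0 < d) (hδ : δ • y = (hτ.fanSucc x ^ d) y)
    (hgen : ∀ γ : MulAction.stabilizer Γ x, ∃ m : ℤ, γ = δ ^ m) :
    Function.Bijective (fun i : Fin d => (⟨Quotient.mk _ (x, ((hτ.fanSucc x ^ (i : ℕ)) y).1,
      (hτ.fanSucc x ((hτ.fanSucc x ^ (i : ℕ)) y)).1), _, _, _, hτ.isTri_fanSucc _, rfl, rfl⟩ :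
        corners τ (puncture x))) := by
  have hzpow : ∀ m : ℤ, (δ ^ m) • y = (hτ.fanSucc x ^ ((d : ℤ) * m)) y := by
    have hc : ∀ z : ℤ, δ • (hτ.fanSucc x ^ z) y = (hτ.fanSucc x ^ (z + d)) y := by
      intro z
      rw [← hτ.fanSucc_zpow_smul, hδ, zpow_add, zpow_natCast, Equiv.Perm.mul_apply]
    intro m
    induction m using Int.induction_on with
    | zero => simp
    | succ n ih => rw [zpow_add_one, (Commute.self_zpow δ n).eq.symm, mul_smul, ih, hc]; ring_nf
    | pred n ih =>
      rw [zpow_sub_one, ← (Commute.inv_left (Commute.self_zpow δ (-n))).eq, mul_smul, ih,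
        inv_smul_eq_iff, hc]
      ring_nf
  constructor
  · intro i j hij
    obtain ⟨γ, hγ⟩ := Quotient.exact (congrArg Subtype.val hij)
    have h₁ : γ • x = x := congrArg Prod.fst hγ
    have h₂ : γ • ((hτ.fanSucc x ^ (j : ℕ)) y).1 = ((hτ.fanSucc x ^ (i : ℕ)) y).1 :=
      congrArg (fun c => c.2.1) hγ
    obtain ⟨m, hm⟩ := hgen ⟨γ, h₁⟩
    have h₃ : (δ ^ m) • (hτ.fanSucc x ^ (j : ℤ)) y = (hτ.fanSucc x ^ (i : ℤ)) y := by
      rw [← hm, zpow_natCast, zpow_natCast]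
      exact Subtype.ext h₂
    rw [← hτ.fanSucc_zpow_smul, hzpow, ← Equiv.Perm.mul_apply, ← zpow_add] at h₃
    have h₄ := hτ.fanSucc_zpow_injective h₃
    have hi := i.2
    have hj := j.2
    have hmod : ((i : ℕ) : ℤ) % d = ((j : ℕ) : ℤ) % d := by
      rw [← h₄, Int.add_mul_emod_self_left]
    rw [Int.emod_eq_of_lt (by positivity) (by exact_mod_cast hi),
      Int.emod_eq_of_lt (by positivity) (by exact_mod_cast hj)] at hmod
    exact Fin.ext (by exact_mod_cast hmod)
  · rintro ⟨c, x', v, w, t, hx', rfl⟩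
    obtain ⟨γ, hγ⟩ := Quotient.exact hx'.symm
    have hγ' : γ • x' = x := hγ
    have t' := t.smul γ
    rw [hγ'] at t'
    let v' : Nbr τ x := ⟨_, t'.xy⟩
    let w' : Nbr τ x := ⟨_, t'.xz⟩
    obtain ⟨k, hk⟩ := hτ.sameCycle_fanSucc y v'
    have hd' : (0 : ℤ) < d := by exact_mod_cast hd
    have hlt := Int.emod_lt_of_pos k hd'
    have hnn := Int.emod_nonneg k hd'.ne'
    -- Reducing the fan index modulo `d` is undone by the power `-(k / d)` of the generator.
    refine ⟨⟨(k % d).toNat, by omega⟩, Subtype.ext (Quotient.sound ?_)⟩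
    have hcast : ((k % d).toNat : ℤ) = k % d := Int.toNat_of_nonneg hnn
    have e₁ : (hτ.fanSucc x ^ (k % d).toNat) y = δ ^ (-(k / d)) • v' := by
      rw [← hk, ← hτ.fanSucc_zpow_smul, hzpow, ← Equiv.Perm.mul_apply, ← zpow_add,
        ← zpow_natCast, hcast]
      congr 2
      have := Int.emod_add_mul_ediv k d
      linarith
    have e₂ : hτ.fanSucc x ((hτ.fanSucc x ^ (k % d).toNat) y) =
        δ ^ (-(k / d)) • w' := by
      rw [e₁, hτ.fanSucc_smul, hτ.fanSucc_eq (z := w') t']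
    refine ⟨(δ ^ (-(k / d))).1 * γ, ?_⟩
    change (_ • x', _ • v, _ • w) = (x, _, _)
    rw [e₂, e₁, mul_smul, mul_smul, mul_smul, hγ', (δ ^ (-(k / d))).2]
    rfl

open Classical in
/-- The extension of `f` by `1` to all orbits. -/
noncomputable def edgeLen (f : EdgeFun τ) (e : Orb Γ) : ℝ := if h : e ∈ τ then (f ⟨e, h⟩ : ℝ) else 1

open Classical in
/-- The extension of `ε` by `1` to all orbits. -/
noncomputable def faceSgn (ε : FaceSign τ) (t : Orb Γ) : ℤˣ :=
  if h : t ∈ faces τ then ε ⟨t, h⟩ else 1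

theorem edgeLen_of_mem (f : EdgeFun τ) {e : Orb Γ} (h : e ∈ τ) : edgeLen f e = f ⟨e, h⟩ :=
  dif_pos h

theorem faceSgn_of_mem (ε : FaceSign τ) {t : Orb Γ} (h : t ∈ faces τ) : faceSgn ε t = ε ⟨t, h⟩ :=
  dif_pos h

theorem edgeLen_pos (f : EdgeFun τ) (e : Orb Γ) : 0 < edgeLen f e := by
  rw [edgeLen]
  split_ifs with h
  · exact (f ⟨e, h⟩).2
  · exact one_pos

/-- The parameter `ε(T_c) f(O_c) / (f(A_c) f(B_c))` of the corner at `x` of the triangle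
`x, y, z`. -/
noncomputable def cornerParam (f : EdgeFun τ) (ε : FaceSign τ) (x y z : Cusp Γ) : ℝ :=
  sgn (faceSgn ε (face x y z)) *
    (edgeLen f (arc y z) / (edgeLen f (arc x y) * edgeLen f (arc z x)))

theorem face_rotate (x y z : Cusp Γ) : face y z x = face x y z := by
  refine congrArg (Quotient.mk _) ?_
  ext w; simp only [Set.mem_insert_iff, Set.mem_singleton_iff]; tauto

theorem face_smul (γ : Γ) (x y z : Cusp Γ) : face (γ • x) (γ • y) (γ • z) = face x y z := by
  refine Quotient.sound ⟨γ, ?_⟩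
  change γ • ({x, y, z} : Set (Cusp Γ)) = _
  rw [← Set.image_smul, Set.image_insert_eq, Set.image_pair]

theorem cornerParam_smul (f : EdgeFun τ) (ε : FaceSign τ) (γ : Γ) (x y z : Cusp Γ) :
    cornerParam f ε (γ • x) (γ • y) (γ • z) = cornerParam f ε x y z := by
  simp only [cornerParam, arc_smul, face_smul]

theorem phiAt_eq_sum (hτ : IsIdealTriangulation τ) (f : EdgeFun τ) (ε : FaceSign τ) {x : Cusp Γ}
    (y : Nbr τ x) {d : ℕ} {δ : MulAction.stabilizer Γ x} (hd : 0 < d)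
    (hδ : δ • y = (hτ.fanSucc x ^ d) y)
    (hgen : ∀ γ : MulAction.stabilizer Γ x, ∃ m : ℤ, γ = δ ^ m) :
    phiAt τ f ε (puncture x) = ∑ i ∈ Finset.range d, cornerParam f ε x
      ((hτ.fanSucc x ^ i) y).1 ((hτ.fanSucc x ^ (i + 1)) y).1 := by
  rw [Finset.sum_range, ← finsum_eq_sum_of_fintype, phiAt]
  refine (finsum_eq_of_bijective _ (corners_bijective hτ y hd hδ hgen) fun i => ?_).symm
  have t := hτ.isTri_fanSucc ((hτ.fanSucc x ^ (i : ℕ)) y)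
  rw [pow_succ', Equiv.Perm.mul_apply, cornerParam, faceSgn_of_mem ε t.face_mem,
    edgeLen_of_mem f t.xy, edgeLen_of_mem f t.yz, edgeLen_of_mem f t.zx]
  rfl

/-- Each puncture is an end of one of finitely many edges. Finiteness is needed for `phi`: on
infinite support `finprod` defaults to `1`, which could hide a vanishing factor. -/
theorem finite_puncture (hτ : IsIdealTriangulation τ) : Finite (Puncture Γ) := by
  have hsub : (Set.univ : Set (Puncture Γ)) ⊆
      ⋃ e ∈ τ, puncture '' (Quotient.out e : Set (Cusp Γ)) ∩
        {P | (Quotient.out e : Set (Cusp Γ)).Finite} := by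
    rintro P -
    induction P using Quotient.inductionOn with | _ x
    obtain ⟨y, hy⟩ := hτ.exists_arc x
    obtain ⟨γ, hγ⟩ : (MulAction.orbitRel Γ (Set (Cusp Γ))) (Quotient.out (arc x y)) {x, y} :=
      Quotient.mk_out (s := MulAction.orbitRel Γ (Set (Cusp Γ))) ({x, y} : Set (Cusp Γ))
    have hγ' : γ • ({x, y} : Set (Cusp Γ)) = Quotient.out (arc x y) := hγ
    refine Set.mem_biUnion hy ⟨⟨γ • x, ?_, ?_⟩, ?_⟩
    · rw [← hγ']
      exact Set.smul_mem_smul_set (Or.inl rfl)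
    · exact Quotient.sound ⟨γ, rfl⟩
    · change (Quotient.out (arc x y) : Set (Cusp Γ)).Finite
      rw [← hγ']
      exact (Set.toFinite _).smul_set
  rw [← Set.finite_univ_iff]
  refine Set.Finite.subset (hτ.finite.biUnion fun e _ => ?_) hsub
  by_cases h : (Quotient.out e : Set (Cusp Γ)).Finite
  · exact (h.image _).subset Set.inter_subset_left
  · exact Set.finite_empty.subset fun P hP => h hP.2

theorem phiAt_ne_zero (hτ : IsIdealTriangulation τ) {f : EdgeFun τ} {ε : FaceSign τ}
    (h : phi τ f ε ≠ 0) (P : Puncture Γ) : phiAt τ f ε P ≠ 0 := by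
  have := finite_puncture hτ
  have := Fintype.ofFinite (Puncture Γ)
  rw [phi, finprod_eq_prod_of_fintype, Finset.prod_ne_zero_iff] at h
  exact h P (Finset.mem_univ P)

/-! ### Computations in `PSL(2, ℝ)` -/

theorem mk_eq_mk_iff {M N : SL(2, ℝ)} : (QuotientGroup.mk M : G) = QuotientGroup.mk N ↔
    ∃ s : ℝ, (s = 1 ∨ s = -1) ∧ N 0 0 = s * M 0 0 ∧ N 0 1 = s * M 0 1 ∧ N 1 0 = s * M 1 0 ∧
      N 1 1 = s * M 1 1 := by
  rw [QuotientGroup.eq, Matrix.SpecialLinearGroup.mem_center_iff]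
  constructor
  · rintro ⟨r, hr, h⟩
    have hN : (N : Matrix (Fin 2) (Fin 2) ℝ) = M.1 * Matrix.scalar (Fin 2) r := by
      rw [h, ← Matrix.SpecialLinearGroup.coe_mul, mul_inv_cancel_left]
    rw [Fintype.card_fin, sq_eq_one_iff] at hr
    refine ⟨r, hr, ?_⟩
    simp [hN, mul_comm]
  · rintro ⟨s, hs, h₁, h₂, h₃, h₄⟩
    refine ⟨s, by rw [Fintype.card_fin, sq_eq_one_iff]; exact hs, ?_⟩
    have hN : (N : Matrix (Fin 2) (Fin 2) ℝ) = M.1 * Matrix.scalar (Fin 2) s := by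
      ext i j
      fin_cases i <;> fin_cases j <;> simp [h₁, h₂, h₃, h₄, mul_comm]
    rw [Matrix.SpecialLinearGroup.coe_mul, hN, ← mul_assoc, ← Matrix.SpecialLinearGroup.coe_mul,
      inv_mul_cancel, Matrix.SpecialLinearGroup.coe_one, one_mul]

theorem coe_mk_mul (M N : SL(2, ℝ)) :
    (QuotientGroup.mk (M * N) : G) = QuotientGroup.mk M * QuotientGroup.mk N := rfl

theorem coe_mk_inv (M : SL(2, ℝ)) :
    (QuotientGroup.mk M⁻¹ : G) = (QuotientGroup.mk M)⁻¹ := rfl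

theorem mul_apply_fin_two (M N : SL(2, ℝ)) (i j : Fin 2) :
    (M * N) i j = M i 0 * N 0 j + M i 1 * N 1 j := by
  rw [Matrix.SpecialLinearGroup.coe_mul, Matrix.mul_apply, Fin.sum_univ_two]

theorem det_entries (M : SL(2, ℝ)) : M 0 0 * M 1 1 - M 0 1 * M 1 0 = 1 := by
  rw [← Matrix.det_fin_two]; exact M.2

theorem inv_entries (M : SL(2, ℝ)) : M⁻¹ 0 0 = M 1 1 ∧ M⁻¹ 0 1 = -M 0 1 ∧ M⁻¹ 1 0 = -M 1 0 ∧
    M⁻¹ 1 1 = M 0 0 := by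
  rw [Matrix.SpecialLinearGroup.SL2_inv_expl]
  simp

theorem unipMat_entries (u : ℝ) : unipMat u 0 0 = 1 ∧ unipMat u 0 1 = u ∧ unipMat u 1 0 = 0 ∧
    unipMat u 1 1 = 1 := by
  simp [unipMat]

/-- The matrix `!![0, -1; 1, 0] * diag(h, h⁻¹)`. -/
noncomputable def thetaMat (h : ℝ) (hh : 0 < h) : SL(2, ℝ) :=
  ⟨!![0, -h⁻¹; h, 0], by simp [Matrix.det_fin_two, hh.ne']⟩

theorem thetaDiag_eq (h : ℝ) (hh : 0 < h) : thetaDiag h hh = QuotientGroup.mk (thetaMat h hh) := by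
  rw [thetaDiag, thetaMat]
  congr 1
  refine Subtype.ext ?_
  change (!![0, -1; 1, 0] : Matrix (Fin 2) (Fin 2) ℝ) * !![h, 0; 0, h⁻¹] = !![0, -h⁻¹; h, 0]
  rw [Matrix.mul_fin_two]
  simp

theorem thetaMat_entries (h : ℝ) (hh : 0 < h) : thetaMat h hh 0 0 = 0 ∧
    thetaMat h hh 0 1 = -h⁻¹ ∧ thetaMat h hh 1 0 = h ∧ thetaMat h hh 1 1 = 0 := by
  simp [thetaMat]

theorem unip_mem_T (u : ℝ) : unip u ∈ T := ⟨u, rfl⟩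

theorem unip_inv (u : ℝ) : (unip u)⁻¹ = unip (-u) := by
  rw [inv_eq_iff_mul_eq_one, unip_mul, add_neg_cancel, unip_zero]

theorem unip_injective : Function.Injective unip := by
  intro u v h
  obtain ⟨s, -, h₁, h₂, -, -⟩ := mk_eq_mk_iff.mp h
  obtain ⟨a₁, a₂, -, -⟩ := unipMat_entries u
  obtain ⟨b₁, b₂, -, -⟩ := unipMat_entries v
  rw [a₁, b₁] at h₁
  rw [a₂, b₂] at h₂
  rw [h₂, ← mul_one s, ← h₁, one_mul]

theorem unip_eq_one_iff {u : ℝ} : unip u = 1 ↔ u = 0 := by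
  rw [← unip_zero]; exact unip_injective.eq_iff

theorem unip_zpow (u : ℝ) (m : ℤ) : unip u ^ m = unip (m * u) := by
  have hn : ∀ n : ℕ, unip u ^ n = unip (n * u) := by
    intro n
    induction n with
    | zero => simp [unip_zero]
    | succ n ih => rw [pow_succ, ih, unip_mul]; push_cast; ring_nf
  obtain ⟨n, rfl | rfl⟩ := m.eq_nat_or_neg
  · rw [zpow_natCast, hn]; simp
  · rw [zpow_neg, zpow_natCast, hn, unip_inv]; simp

/-- Upper triangular matrices rescale `u` by the square of their first entry. Conversely,
normalizing `unip 1` alone already forces the lower left entry to vanish. -/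
theorem mk_mem_B {M : SL(2, ℝ)} : (QuotientGroup.mk M : G) ∈ B ↔ M 1 0 = 0 := by
  have tri : ∀ N : SL(2, ℝ), N 1 0 = 0 → ∀ t ∈ T,
      (QuotientGroup.mk N : G) * t * (QuotientGroup.mk N)⁻¹ ∈ T := by
    rintro N hN _ ⟨u, rfl⟩
    refine ⟨N 0 0 ^ 2 * u, ?_⟩
    rw [eq_mul_inv_iff_mul_eq, unip, unip, ← coe_mk_mul, ← coe_mk_mul, mk_eq_mk_iff]
    have hd := det_entries N
    obtain ⟨a₁, a₂, a₃, a₄⟩ := unipMat_entries u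
    obtain ⟨b₁, b₂, b₃, b₄⟩ := unipMat_entries (N 0 0 ^ 2 * u)
    refine ⟨1, Or.inl rfl, ?_⟩
    simp only [mul_apply_fin_two, a₁, a₂, a₃, a₄, b₁, b₂, b₃, b₄, hN] at hd ⊢
    refine ⟨by ring, ?_, by ring, by ring⟩
    linear_combination -(N 0 0 * u) * hd
  constructor
  · intro h
    rw [B, Subgroup.mem_normalizer_iff] at h
    obtain ⟨u, hu⟩ := (h (unip 1)).mp (unip_mem_T 1)
    rw [eq_mul_inv_iff_mul_eq, unip, unip, ← coe_mk_mul, ← coe_mk_mul, mk_eq_mk_iff] at hu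
    obtain ⟨s, hs, -, -, h₁, h₂⟩ := hu
    obtain ⟨a₁, a₂, a₃, a₄⟩ := unipMat_entries 1
    obtain ⟨b₁, b₂, b₃, b₄⟩ := unipMat_entries u
    simp only [mul_apply_fin_two, a₁, a₂, a₃, a₄, b₃, b₄] at h₁ h₂
    rcases hs with rfl | rfl <;> linarith
  · intro h
    rw [B, Subgroup.mem_normalizer_iff]
    refine fun t => ⟨tri M h t, fun ht => ?_⟩
    have := tri M⁻¹ (by rw [(inv_entries M).2.2.1, h, neg_zero]) _ ht
    rw [coe_mk_inv] at this
    convert this using 1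
    group

/-- A nontrivial translation fixes only `∞`, so `c` must fix `∞`. In entries, the lower left entry
of the conjugate is `-u` times the square of that of `c`. -/
theorem mem_B_of_conj_unip_mem_B {c : G} {u : ℝ} (hu : u ≠ 0) (h : c⁻¹ * unip u * c ∈ B) :
    c ∈ B := by
  obtain ⟨M, rfl⟩ := QuotientGroup.mk_surjective c
  rw [unip, ← coe_mk_inv, ← coe_mk_mul, ← coe_mk_mul, mk_mem_B] at h
  rw [mk_mem_B]
  obtain ⟨a₁, a₂, a₃, a₄⟩ := unipMat_entries u
  obtain ⟨b₁, b₂, b₃, b₄⟩ := inv_entries M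
  simp only [mul_apply_fin_two, a₁, a₂, a₃, a₄, b₃, b₄] at h
  have : u * M 1 0 ^ 2 = 0 := by linear_combination -h
  simpa [hu] using this

theorem T_le_B : T ≤ B := Subgroup.le_normalizer

/-- An element with a nontrivial conjugate in `T` determines that conjugate up to `B`. -/
theorem inv_mul_mem_B {a b g : G} (hg : g ≠ 1) (ha : a⁻¹ * g * a ∈ T) (hb : b⁻¹ * g * b ∈ B) :
    a⁻¹ * b ∈ B := by
  obtain ⟨u, hu⟩ := ha
  have hu0 : u ≠ 0 := by
    rintro rfl
    rw [unip_zero, eq_comm, mul_assoc, inv_mul_eq_one, eq_comm] at hu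
    exact hg (mul_eq_right.mp hu)
  refine mem_B_of_conj_unip_mem_B hu0 ?_
  rw [hu]
  convert hb using 1
  group

theorem thetaDiag_mul_self (h : ℝ) (hh : 0 < h) : thetaDiag h hh * thetaDiag h hh = 1 := by
  have h1 : (1 : G) = QuotientGroup.mk 1 := rfl
  rw [thetaDiag_eq, ← coe_mk_mul, h1, mk_eq_mk_iff]
  obtain ⟨a₁, a₂, a₃, a₄⟩ := thetaMat_entries h hh
  refine ⟨-1, Or.inr rfl, ?_⟩
  have := hh.ne'
  simp only [mul_apply_fin_two, a₁, a₂, a₃, a₄]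
  simp [this]

theorem thetaDiag_notMem_B (h : ℝ) (hh : 0 < h) : thetaDiag h hh ∉ B := by
  rw [thetaDiag_eq, mk_mem_B, (thetaMat_entries h hh).2.2.1]
  exact hh.ne'

theorem thetaDiag_injective {h k : ℝ} {hh : 0 < h} {hk : 0 < k}
    (e : thetaDiag h hh = thetaDiag k hk) : h = k := by
  rw [thetaDiag_eq, thetaDiag_eq, mk_eq_mk_iff] at e
  obtain ⟨s, hs, -, -, e, -⟩ := e
  rw [(thetaMat_entries h hh).2.2.1, (thetaMat_entries k hk).2.2.1] at e
  rcases hs with rfl | rfl <;> linarith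

/-- The lower left entry of the product is `a * u * d`. Such a product is the transport between the
ends of a new diagonal, which is why nonvanishing of `u` decides its admissibility. -/
theorem thetaDiag_unip_thetaDiag_notMem_B {a d u : ℝ} (ha : 0 < a) (hd : 0 < d) (hu : u ≠ 0) :
    thetaDiag a ha * unip u * thetaDiag d hd ∉ B := by
  rw [thetaDiag_eq, thetaDiag_eq, unip, ← coe_mk_mul, ← coe_mk_mul, mk_mem_B]
  obtain ⟨a₁, a₂, a₃, a₄⟩ := thetaMat_entries a ha
  obtain ⟨d₁, d₂, d₃, d₄⟩ := thetaMat_entries d hd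
  obtain ⟨b₁, b₂, b₃, b₄⟩ := unipMat_entries u
  simp only [mul_apply_fin_two, a₃, a₄, b₁, b₂, b₃, b₄, d₁, d₃]
  have := ha.ne'
  have := hd.ne'
  simp [*]

/-- The upper left entry is `u * h` on one side and `0` on the other. This is the uniqueness in the
Bruhat cell that makes frames on arcs unique. -/
theorem eq_zero_of_unip_mul_thetaDiag {u v h k : ℝ} {hh : 0 < h} {hk : 0 < k}
    (e : unip u * thetaDiag h hh = thetaDiag k hk * unip v) : u = 0 := by
  rw [thetaDiag_eq, thetaDiag_eq, unip, unip, ← coe_mk_mul, ← coe_mk_mul, mk_eq_mk_iff] at e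
  obtain ⟨s, hs, e, -, -, -⟩ := e
  obtain ⟨a₁, a₂, a₃, a₄⟩ := thetaMat_entries h hh
  obtain ⟨d₁, d₂, d₃, d₄⟩ := thetaMat_entries k hk
  obtain ⟨b₁, b₂, b₃, b₄⟩ := unipMat_entries u
  obtain ⟨c₁, c₂, c₃, c₄⟩ := unipMat_entries v
  simp only [mul_apply_fin_two, a₁, a₃, b₁, b₂, c₁, c₃, d₁, d₂] at e
  have hs0 : s ≠ 0 := by rcases hs with rfl | rfl <;> norm_num
  have : s * (u * h) = 0 := by linarith
  simpa [hs0, hh.ne'] using this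

/-- The big cell of the Bruhat decomposition. -/
theorem exists_unip_thetaDiag_unip {g : G} (hg : g ∉ B) :
    ∃ (u h v : ℝ) (hh : 0 < h), g = unip u * thetaDiag h hh * unip v := by
  have main : ∀ M : SL(2, ℝ), 0 < M 1 0 → ∃ (u h v : ℝ) (hh : 0 < h),
      (QuotientGroup.mk M : G) = unip u * thetaDiag h hh * unip v := by
    intro M hM
    refine ⟨M 0 0 / M 1 0, M 1 0, M 1 1 / M 1 0, hM, ?_⟩
    rw [thetaDiag_eq, unip, unip, ← coe_mk_mul, ← coe_mk_mul, mk_eq_mk_iff]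
    obtain ⟨a₁, a₂, a₃, a₄⟩ := thetaMat_entries (M 1 0) hM
    obtain ⟨b₁, b₂, b₃, b₄⟩ := unipMat_entries (M 0 0 / M 1 0)
    obtain ⟨c₁, c₂, c₃, c₄⟩ := unipMat_entries (M 1 1 / M 1 0)
    have hd := det_entries M
    have := hM.ne'
    refine ⟨1, Or.inl rfl, ?_⟩
    simp only [mul_apply_fin_two, a₁, a₂, a₃, a₄, b₁, b₂, b₃, b₄, c₁, c₂, c₃, c₄]
    refine ⟨?_, ?_, ?_, ?_⟩
    · field_simp; ring
    · field_simp; linear_combination hd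
    · ring
    · field_simp; ring
  obtain ⟨M, rfl⟩ := QuotientGroup.mk_surjective g
  rw [mk_mem_B] at hg
  rcases lt_or_gt_of_ne hg with h | h
  · have : (QuotientGroup.mk M : G) = QuotientGroup.mk (-M) :=
      mk_eq_mk_iff.mpr ⟨-1, Or.inr rfl, by simp, by simp, by simp, by simp⟩
    rw [this]
    exact main (-M) (by simpa using h)
  · exact main M h

/-- The parameters of an ideal triangle. -/
theorem hexagon_iff {p q r u v w : ℝ} (hp : 0 < p) (hq : 0 < q) (hr : 0 < r) :
    thetaDiag p hp * unip (-v) * thetaDiag q hq = unip u * thetaDiag r hr * unip w ↔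
      ∃ s : ℤˣ, u = sgn s * (q / (p * r)) ∧ v = sgn s * (r / (q * p)) ∧
        w = sgn s * (p / (r * q)) := by
  have hp' := hp.ne'
  have hq' := hq.ne'
  have hr' := hr.ne'
  rw [thetaDiag_eq, thetaDiag_eq, thetaDiag_eq, unip, unip, unip, ← coe_mk_mul, ← coe_mk_mul,
    ← coe_mk_mul, ← coe_mk_mul, mk_eq_mk_iff]
  obtain ⟨a₁, a₂, a₃, a₄⟩ := thetaMat_entries p hp
  obtain ⟨b₁, b₂, b₃, b₄⟩ := thetaMat_entries q hq
  obtain ⟨c₁, c₂, c₃, c₄⟩ := thetaMat_entries r hr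
  obtain ⟨d₁, d₂, d₃, d₄⟩ := unipMat_entries u
  obtain ⟨e₁, e₂, e₃, e₄⟩ := unipMat_entries (-v)
  obtain ⟨f₁, f₂, f₃, f₄⟩ := unipMat_entries w
  simp only [mul_apply_fin_two, a₁, a₂, a₃, a₄, b₁, b₂, b₃, b₄, c₁, c₂, c₃, c₄,
    d₁, d₂, d₃, d₄, e₁, e₂, e₃, e₄, f₁, f₂, f₃, f₄, mul_zero, zero_mul, add_zero, zero_add, mul_one,
    one_mul]
  constructor
  · rintro ⟨s, hs, h₁, -, h₂, h₃⟩
    -- Comparing entries yields all three parameters with the common factor `-s`, where `s` is the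
    -- sign relating the two lifts to `SL`. So the sign of the triangle is `-s`.
    have hu : u = -s * (q / (p * r)) := by
      field_simp at h₁ ⊢; linarith
    have hw : w = -s * (p / (r * q)) := by
      field_simp at h₃ ⊢; linarith
    have hv : v = -s * (r / (q * p)) := by
      have hss : s * s = 1 := by rcases hs with rfl | rfl <;> norm_num
      field_simp at h₂ ⊢
      linear_combination s * h₂ - (q * p * v) * hss
    rcases hs with rfl | rfl
    · exact ⟨-1, by simpa [sgn] using hu, by simpa [sgn] using hv, by simpa [sgn] using hw⟩
    · exact ⟨1, by simpa [sgn] using hu, by simpa [sgn] using hv, by simpa [sgn] using hw⟩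
  · rintro ⟨s, rfl, rfl, rfl⟩
    have hss : sgn s * sgn s = 1 := by
      rcases Int.units_eq_one_or s with rfl | rfl <;> simp [sgn]
    refine ⟨-sgn s, ?_, ?_, ?_, ?_, ?_⟩
    · rcases Int.units_eq_one_or s with rfl | rfl <;> simp [sgn]
    · field_simp
    · field_simp; linear_combination hss
    · field_simp; linear_combination -hss
    · field_simp

/-! ### Development of a pair `(f, ε)` -/

/-- The transport along long edges given by `f`. -/
noncomputable def longElt (f : EdgeFun τ) (x y : Cusp Γ) : G :=
  thetaDiag (edgeLen f (arc x y)) (edgeLen_pos f _)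

/-- The transport along short edges given by `(f, ε)`. -/
noncomputable def shortElt (f : EdgeFun τ) (ε : FaceSign τ) (x y z : Cusp Γ) : G :=
  unip (cornerParam f ε x y z)

/-- `F` is a family of frames with the transports prescribed by `(f, ε)`. -/
abbrev IsPairDevelopment (f : EdgeFun τ) (ε : FaceSign τ) (F : Cusp Γ → Cusp Γ → G) : Prop :=
  IsDevelopment τ (longElt f) (shortElt f ε) F

theorem thetaDiag_congr {h k : ℝ} (e : h = k) (hh : 0 < h) :
    thetaDiag h hh = thetaDiag k (e ▸ hh) := by
  subst e; rfl

theorem longElt_mul_comm (f : EdgeFun τ) (x y : Cusp Γ) : longElt f x y * longElt f y x = 1 := by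
  rw [longElt, longElt, thetaDiag_congr (by rw [arc_comm] : edgeLen f (arc y x) =
    edgeLen f (arc x y)), thetaDiag_mul_self]

theorem hexagon (f : EdgeFun τ) (ε : FaceSign τ) (x y z : Cusp Γ) :
    longElt f x y * (shortElt f ε y z x)⁻¹ * (longElt f y z * (shortElt f ε z x y)⁻¹) *
      (longElt f z x * (shortElt f ε x y z)⁻¹) = 1 := by
  have h := (hexagon_iff (u := cornerParam f ε x y z) (v := cornerParam f ε y z x)
    (w := cornerParam f ε z x y) (edgeLen_pos f (arc x y)) (edgeLen_pos f (arc y z))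
    (edgeLen_pos f (arc z x))).mpr ⟨faceSgn ε (face x y z), rfl,
      by rw [cornerParam, face_rotate], by rw [cornerParam, face_rotate, face_rotate]⟩
  rw [← unip_inv] at h
  have h' : longElt f x y * (shortElt f ε y z x)⁻¹ * longElt f y z =
      shortElt f ε x y z * longElt f z x * shortElt f ε z x y := h
  simp only [← mul_assoc]
  rw [h', mul_inv_cancel_right, mul_assoc (shortElt f ε x y z), longElt, thetaDiag_mul_self,
    mul_one,
    mul_inv_cancel]

theorem IsDevelopment.mul_left {K : Type*} [Group K] {len : Cusp Γ → Cusp Γ → K}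
    {sh : Cusp Γ → Cusp Γ → Cusp Γ → K} {F : Cusp Γ → Cusp Γ → K} (hF : IsDevelopment τ len sh F)
    (g : K) : IsDevelopment τ len sh fun x y => g * F x y :=
  ⟨fun x y h => by rw [hF.long x y h, mul_assoc],
    fun x y z h => by rw [hF.short x y z h, mul_assoc]⟩

theorem exists_pairDevelopment (hτ : IsIdealTriangulation τ) (f : EdgeFun τ) (ε : FaceSign τ)
    (a b : Cusp Γ) : ∃ F, IsPairDevelopment f ε F ∧ F a b = 1 := by
  obtain ⟨F, hF⟩ := exists_isDevelopment hτ (len := longElt f) (sh := shortElt f ε)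
    (fun x y _ => longElt_mul_comm f x y) (fun x y z _ => hexagon f ε x y z)
  exact ⟨_, hF.mul_left (F a b)⁻¹, inv_mul_cancel _⟩

namespace IsDevelopment

variable {f : EdgeFun τ} {ε : FaceSign τ} {F : Cusp Γ → Cusp Γ → G}

theorem smul (hF : IsPairDevelopment f ε F) (γ : Γ) :
    IsPairDevelopment f ε fun x y => F (γ • x) (γ • y) := by
  refine ⟨fun x y h => ?_, fun x y z h => ?_⟩
  · rw [hF.long (γ • x) (γ • y) (by rwa [arc_smul]), longElt, longElt,
      thetaDiag_congr (by rw [arc_smul] : edgeLen f (arc (γ • x) (γ • y)) = edgeLen f (arc x y))]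
  · rw [hF.short _ _ _ (h.smul γ), shortElt, shortElt, cornerParam_smul]

/-- The holonomy of a development. -/
theorem exists_holonomy (hτ : IsIdealTriangulation τ) (hF : IsPairDevelopment f ε F)
    {a b : Cusp Γ} (hab : arc a b ∈ τ) :
    ∃ ρ : Γ →* G, ∀ (γ : Γ) x y, arc x y ∈ τ → F (γ • x) (γ • y) = ρ γ * F x y := by
  -- The translate of `F` by `γ` and a left multiple of `F` are developments of the same pair that
  -- agree on `(a, b)`, hence on all of `τ`.
  have key : ∀ (γ : Γ) x y, arc x y ∈ τ →
      F (γ • x) (γ • y) = F (γ • a) (γ • b) * (F a b)⁻¹ * F x y := by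
    intro γ x y hxy
    exact IsDevelopment.unique hτ (hF.smul γ) (hF.mul_left (F (γ • a) (γ • b) * (F a b)⁻¹)) hab hxy
      (inv_mul_cancel_right _ _).symm
  refine ⟨MonoidHom.mk' (fun γ => F (γ • a) (γ • b) * (F a b)⁻¹) fun γ δ => ?_, key⟩
  rw [mul_smul, mul_smul, key γ (δ • a) (δ • b) (by rwa [arc_smul])]
  simp only [mul_assoc]

theorem fanSucc_pow (hτ : IsIdealTriangulation τ) (hF : IsPairDevelopment f ε F) {x : Cusp Γ}
    (y : Nbr τ x) (n : ℕ) : F x ((hτ.fanSucc x ^ n) y).1 = F x y.1 *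
      unip (∑ i ∈ Finset.range n, cornerParam f ε x
        ((hτ.fanSucc x ^ i) y).1 ((hτ.fanSucc x ^ (i + 1)) y).1) := by
  induction n with
  | zero => simp [unip_zero]
  | succ n ih =>
    rw [Finset.sum_range_succ, ← unip_mul, ← mul_assoc, ← ih, pow_succ', Equiv.Perm.mul_apply,
      hF.short _ _ _ (hτ.isTri_fanSucc _)]
    rfl

theorem inv_mul_mem_T (hτ : IsIdealTriangulation τ) (hF : IsPairDevelopment f ε F) {x y z : Cusp Γ}
    (hy : arc x y ∈ τ) (hz : arc x z ∈ τ) : (F x y)⁻¹ * F x z ∈ T := by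
  have main : ∀ (v : Nbr τ x) (n : ℕ), (F x v.1)⁻¹ * F x ((hτ.fanSucc x ^ n) v).1 ∈ T := by
    intro v n
    rw [hF.fanSucc_pow hτ, inv_mul_cancel_left]
    exact unip_mem_T _
  let v : Nbr τ x := ⟨y, hy⟩
  let w : Nbr τ x := ⟨z, hz⟩
  obtain ⟨k, hk⟩ := hτ.sameCycle_fanSucc v w
  change (F x v.1)⁻¹ * F x w.1 ∈ T
  obtain ⟨n, rfl | rfl⟩ := k.eq_nat_or_neg
  · rw [← hk, zpow_natCast]
    exact main v n
  · rw [zpow_neg, zpow_natCast, Equiv.Perm.inv_eq_iff_eq] at hk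
    have := main w n
    rw [← hk] at this
    simpa using T.inv_mem this

/-- The holonomy around a puncture is a nonzero multiple of `φ_{τ,P}(f, ε)`. -/
theorem parabolic_holonomy (hτ : IsIdealTriangulation τ)
    (hΓ : ∀ γ ∈ Γ, γ ≠ 1 → ∀ z : ℍ, γ • z ≠ z) (hφ : phi τ f ε ≠ 0)
    (hF : IsPairDevelopment f ε F) {ρ : Γ →* G}
    (hρ : ∀ γ x y, arc x y ∈ τ → F (γ • x) (γ • y) = ρ γ * F x y) {x y : Cusp Γ}
    (hxy : arc x y ∈ τ) {γ : Γ} (hγ : γ • x = x) :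
    (F x y)⁻¹ * ρ γ * F x y ∈ T ∧ (γ ≠ 1 → ρ γ ≠ 1) := by
  let v : Nbr τ x := ⟨y, hxy⟩
  obtain ⟨d, δ, hd, hδ, hgen⟩ := hτ.exists_stabilizer_generator hΓ v
  obtain ⟨m, hm⟩ := hgen ⟨γ, hγ⟩
  have hγm : γ = δ.1 ^ m := congrArg Subtype.val hm
  -- The generator moves the frame through one period of the fan, whose corner parameters sum to
  -- `phiAt`. Any other stabilizer element is a power of it.
  have h₁ : (F x y)⁻¹ * ρ δ.1 * F x y = unip (phiAt τ f ε (puncture x)) := by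
    have e := hρ δ.1 x y hxy
    have e₂ : F (δ.1 • x) (δ.1 • y) = F x (δ • v).1 := by rw [δ.2]; rfl
    rw [mul_assoc, ← e, e₂, hδ, hF.fanSucc_pow hτ, inv_mul_cancel_left,
      phiAt_eq_sum hτ f ε v hd hδ hgen]
  have h₂ : (F x y)⁻¹ * ρ γ * F x y = unip (m * phiAt τ f ε (puncture x)) := by
    rw [← unip_zpow, ← h₁, hγm, map_zpow]
    have := conj_zpow (i := m) (a := (F x y)⁻¹) (b := ρ δ.1)
    rw [inv_inv] at this
    exact this.symm
  refine ⟨h₂ ▸ unip_mem_T _, fun hne h1 => ?_⟩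
  rw [h1, mul_one, inv_mul_cancel, eq_comm, unip_eq_one_iff, mul_eq_zero] at h₂
  rcases h₂ with h | h
  · rw [Int.cast_eq_zero] at h
    subst h
    exact hne (by simpa using hγm)
  · exact phiAt_ne_zero hτ hφ _ h

end IsDevelopment

/-! ### Admissibility -/

theorem Admissible.symm {ρ : FlatConn Γ} {x y : Cusp Γ} (h : Admissible ρ x y) :
    Admissible ρ y x := fun ⟨a, h₁, h₂⟩ => h ⟨a, h₂, h₁⟩

theorem Admissible.smul {ρ : FlatConn Γ} {x y : Cusp Γ} (h : Admissible ρ x y) (γ : Γ) :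
    Admissible ρ (γ • x) (γ • y) := by
  rintro ⟨a, h₁, h₂⟩
  have aux : ∀ z : Cusp Γ, (∀ δ : Γ, δ • γ • z = γ • z → a⁻¹ * ρ.hol δ * a ∈ T) →
      ∀ δ : Γ, δ • z = z → ((ρ.hol γ)⁻¹ * a)⁻¹ * ρ.hol δ * ((ρ.hol γ)⁻¹ * a) ∈ T := by
    intro z hz δ hδ
    have := hz (γ * δ * γ⁻¹) (by rw [mul_smul, mul_smul, inv_smul_smul, hδ])
    rw [map_mul, map_mul, map_inv] at this
    convert this using 1
    group
  exact h ⟨(ρ.hol γ)⁻¹ * a, aux x h₁, aux y h₂⟩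

theorem Admissible.congr {ρ σ : FlatConn Γ}
    (hρσ : (Quotient.mk _ ρ : Moduli Γ) = Quotient.mk _ σ) {x y : Cusp Γ} (h : Admissible ρ x y) :
    Admissible σ x y := by
  obtain ⟨b, hb⟩ := Quotient.exact hρσ
  rintro ⟨a, h₁, h₂⟩
  have aux : ∀ z : Cusp Γ, (∀ δ : Γ, δ • z = z → a⁻¹ * σ.hol δ * a ∈ T) →
      ∀ δ : Γ, δ • z = z → (b⁻¹ * a)⁻¹ * ρ.hol δ * (b⁻¹ * a) ∈ T := by
    intro z hz δ hδ
    have := hz δ hδ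
    rw [hb] at this
    convert this using 1
    group
  exact h ⟨b⁻¹ * a, aux x h₁, aux y h₂⟩

theorem exists_smul_eq_of_arc_eq {x y x' y' : Cusp Γ} (h : arc x y = arc x' y') :
    ∃ γ : Γ, (x = γ • x' ∧ y = γ • y') ∨ (x = γ • y' ∧ y = γ • x') := by
  obtain ⟨γ, hγ⟩ := Quotient.exact h
  have hγ' : γ • ({x', y'} : Set (Cusp Γ)) = {x, y} := hγ
  rw [← Set.image_smul, Set.image_pair, Set.pair_eq_pair_iff] at hγ'
  refine ⟨γ, ?_⟩
  rcases hγ' with ⟨h₁, h₂⟩ | ⟨h₁, h₂⟩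
  · exact Or.inl ⟨h₁.symm, h₂.symm⟩
  · exact Or.inr ⟨h₂.symm, h₁.symm⟩

theorem arc_mem_admissibleArcs {ρ : FlatConn Γ} {x y : Cusp Γ} :
    arc x y ∈ admissibleArcs (Quotient.mk _ ρ : Moduli Γ) ↔
      IsIdealArc (arc x y) ∧ Admissible ρ x y := by
  refine ⟨?_, fun h => ⟨h.1, ρ, x, y, rfl, rfl, h.2⟩⟩
  rintro ⟨hI, σ, x', y', hσ, he, hA⟩
  refine ⟨hI, ?_⟩
  have hA' := hA.congr hσ
  obtain ⟨γ, ⟨rfl, rfl⟩ | ⟨rfl, rfl⟩⟩ := exists_smul_eq_of_arc_eq he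
  · exact hA'.smul γ
  · exact (hA'.smul γ).symm

/-- The parabolic subgroups at the two ends are the conjugates of `T` by `A` and by `C`; they agree
exactly when `A⁻¹ * C` normalizes `T`. A nontrivial holonomy at each cusp determines its parabolic
subgroup. -/
theorem admissible_iff {ρ : FlatConn Γ} {x y : Cusp Γ} {A C : G}
    (hA : ∀ γ : Γ, γ • x = x → A⁻¹ * ρ.hol γ * A ∈ T)
    (hC : ∀ γ : Γ, γ • y = y → C⁻¹ * ρ.hol γ * C ∈ T) : Admissible ρ x y ↔ A⁻¹ * C ∉ B := by
  constructor
  · intro h hB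
    refine h ⟨A, hA, fun γ hγ => ?_⟩
    rw [B, Subgroup.mem_normalizer_iff] at hB
    have := (hB _).mp (hC γ hγ)
    convert this using 1
    group
  · rintro h ⟨a, h₁, h₂⟩
    obtain ⟨γ, hγ, hγ1⟩ := x.exists_stabilizer_ne_one
    obtain ⟨δ, hδ, hδ1⟩ := y.exists_stabilizer_ne_one
    have k₁ := inv_mul_mem_B (ρ.parabolic x γ hγ hγ1).1 (hA γ hγ) (T_le_B (h₁ γ hγ))
    have k₂ := inv_mul_mem_B (ρ.parabolic y δ hδ hδ1).1 (h₂ δ hδ) (T_le_B (hC δ hδ))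
    have := B.mul_mem k₁ k₂
    rw [mul_assoc, mul_inv_cancel_left] at this
    exact h this

/-! ### Frames on arcs -/

/-- `g` is the frame at the end `x` of an arc from `x` to `y`, where `A` and `C` are frames at `x`
and at `y`. -/
def IsFrame (A C g : G) : Prop :=
  A⁻¹ * g ∈ T ∧ ∃ (h : ℝ) (hh : 0 < h), C⁻¹ * (g * thetaDiag h hh) ∈ T

theorem exists_isFrame {A C : G} (h : A⁻¹ * C ∉ B) : ∃ g, IsFrame A C g := by
  obtain ⟨u, k, v, hk, e⟩ := exists_unip_thetaDiag_unip h
  refine ⟨A * unip u, by simpa using unip_mem_T u, k, hk, ?_⟩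
  have hC : C = A * (unip u * thetaDiag k hk * unip v) := by rw [← e, mul_inv_cancel_left]
  have : C⁻¹ * (A * unip u * thetaDiag k hk) = (unip v)⁻¹ := by rw [hC]; group
  rw [this]
  exact T.inv_mem (unip_mem_T v)

/-- Two frames differ by elements of `T` on the right at both ends of the arc, and no nontrivial
element of `T` can be moved past an element of `θH` and stay in `T`. -/
theorem IsFrame.unique {A C g g' : G} (h : IsFrame A C g) (h' : IsFrame A C g') : g = g' := by
  obtain ⟨h₁, k, hk, h₂⟩ := h
  obtain ⟨h₁', k', hk', h₂'⟩ := h'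
  obtain ⟨u, hu⟩ : g⁻¹ * g' ∈ T := by
    convert T.mul_mem (T.inv_mem h₁) h₁' using 1
    group
  obtain ⟨v, hv⟩ : (g * thetaDiag k hk)⁻¹ * (g' * thetaDiag k' hk') ∈ T := by
    convert T.mul_mem (T.inv_mem h₂) h₂' using 1
    group
  have : unip u * thetaDiag k' hk' = thetaDiag k hk * unip v := by
    rw [hu, hv]; group
  have hu0 := eq_zero_of_unip_mul_thetaDiag this
  rw [hu0, unip_zero, eq_comm, inv_mul_eq_one] at hu
  exact hu

theorem IsFrame.symm {A C g : G} (h : IsFrame A C g) :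
    ∃ (k : ℝ) (hk : 0 < k), IsFrame C A (g * thetaDiag k hk) := by
  obtain ⟨h₁, k, hk, h₂⟩ := h
  refine ⟨k, hk, h₂, k, hk, ?_⟩
  rwa [mul_assoc, thetaDiag_mul_self, mul_one]

theorem IsFrame.change {A C A' C' g : G} (h : IsFrame A C g) (hA : A'⁻¹ * A ∈ T)
    (hC : C'⁻¹ * C ∈ T) : IsFrame A' C' g := by
  obtain ⟨h₁, k, hk, h₂⟩ := h
  refine ⟨?_, k, hk, ?_⟩
  · convert T.mul_mem hA h₁ using 1
    group
  · convert T.mul_mem hC h₂ using 1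
    group

theorem IsFrame.mul_left {A C g : G} (h : IsFrame A C g) (a : G) :
    IsFrame (a * A) (a * C) (a * g) := by
  obtain ⟨h₁, k, hk, h₂⟩ := h
  refine ⟨?_, k, hk, ?_⟩
  · convert h₁ using 1
    group
  · convert h₂ using 1
    group

/-! ### Existence of the corresponding point -/

/-- The flat connection given by the holonomy of a development. -/
noncomputable def IsDevelopment.flatConn {f : EdgeFun τ} {ε : FaceSign τ} {F : Cusp Γ → Cusp Γ → G}
    (hτ : IsIdealTriangulation τ) (hΓ : ∀ γ ∈ Γ, γ ≠ 1 → ∀ z : ℍ, γ • z ≠ z) (hφ : phi τ f ε ≠ 0)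
    (hF : IsPairDevelopment f ε F) {ρ : Γ →* G}
    (hρ : ∀ γ x y, arc x y ∈ τ → F (γ • x) (γ • y) = ρ γ * F x y) {x y : Cusp Γ}
    (hxy : arc x y ∈ τ) : FlatConn Γ where
  hol := ρ
  parabolic z γ hγ hne := by
    obtain ⟨w, hw⟩ := hτ.exists_arc z
    obtain ⟨h₁, h₂⟩ := hF.parabolic_holonomy hτ hΓ hφ hρ hw hγ
    exact ⟨h₂ hne, _, h₁⟩
  irreducible a := by
    by_contra! h
    -- If `a` conjugated the holonomy into `B`, the nontrivial parabolic at each cusp would force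
    -- every frame into the coset `a B`. But frames at the two ends of an edge differ by an element
    -- of `θH`, which misses `B`.
    have aux : ∀ z w, arc z w ∈ τ → (F z w)⁻¹ * a ∈ B := by
      intro z w hzw
      obtain ⟨γ, hγ, hne⟩ := z.exists_stabilizer_ne_one
      obtain ⟨h₁, h₂⟩ := hF.parabolic_holonomy hτ hΓ hφ hρ hzw hγ
      exact inv_mul_mem_B (h₂ hne) h₁ (h γ)
    have h₁ := aux x y hxy
    have h₂ := aux y x (by rwa [arc_comm])
    have h₃ := B.mul_mem h₁ (B.inv_mem h₂)
    rw [hF.long x y hxy] at h₃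
    refine thetaDiag_notMem_B _ (edgeLen_pos f (arc x y)) ?_
    change longElt f x y ∈ B
    convert h₃ using 1
    group

/-- The development gives frames on `τ`. They determine, up to `T`, a frame at each cusp, and so by
the Bruhat decomposition a unique frame `E` on each admissible arc. Transports are quotients of
frames, and uniqueness of frames gives equivariance. -/
theorem exists_corresponds (hτ : IsIdealTriangulation τ)
    (hΓ : ∀ γ ∈ Γ, γ ≠ 1 → ∀ z : ℍ, γ • z ≠ z) {f : EdgeFun τ} {ε : FaceSign τ}
    (hφ : phi τ f ε ≠ 0) {a b : Cusp Γ} (hab : arc a b ∈ τ) :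
    ∃ p : Bundle Γ, Corresponds τ f ε p := by
  obtain ⟨F, hF, hF1⟩ := exists_pairDevelopment hτ f ε a b
  obtain ⟨ρ, hρ⟩ := hF.exists_holonomy hτ hab
  let σ : FlatConn Γ := hF.flatConn hτ hΓ hφ hρ hab
  -- The choice of neighbour is harmless: frames of `F` at the same cusp differ by `T`, and
  -- `IsFrame` depends on `A` and `C` only up to `T` on the right.
  choose N hN using hτ.exists_arc
  let A : Cusp Γ → G := fun x => F x (N x)
  have hA : ∀ (x : Cusp Γ) (γ : Γ), γ • x = x → (A x)⁻¹ * σ.hol γ * A x ∈ T := fun x γ hγ =>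
    (hF.parabolic_holonomy hτ hΓ hφ hρ (hN x) hγ).1
  have hAdm : ∀ x y, Admissible σ x y ↔ (A x)⁻¹ * A y ∉ B := fun x y =>
    admissible_iff (hA x) (hA y)
  have hFτ : ∀ x y, arc x y ∈ τ → IsFrame (A x) (A y) (F x y) := by
    intro x y hxy
    refine ⟨hF.inv_mul_mem_T hτ (hN x) hxy, _, edgeLen_pos f (arc x y), ?_⟩
    have := hF.long x y hxy
    rw [longElt] at this
    rw [← this]
    exact hF.inv_mul_mem_T hτ (hN y) (by rwa [arc_comm])
  have hmem : τ ⊆ admissibleArcs (Quotient.mk _ σ : Moduli Γ) := by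
    intro e he
    have hI := hτ.isIdealArc e he
    obtain ⟨x, y, -, rfl, -⟩ := hI
    rw [arc_mem_admissibleArcs]
    refine ⟨hτ.isIdealArc _ he, ?_⟩
    rw [admissible_iff (A := F x y) (C := F y x)
      (fun γ hγ => (hF.parabolic_holonomy hτ hΓ hφ hρ he hγ).1)
      (fun γ hγ => (hF.parabolic_holonomy hτ hΓ hφ hρ (by rwa [arc_comm]) hγ).1),
      hF.long x y he, inv_mul_cancel_left]
    exact thetaDiag_notMem_B _ _
  have hE : ∀ v : Vert (admissibleArcs (Quotient.mk _ σ : Moduli Γ)),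
      ∃ g, IsFrame (A v.1.1) (A v.1.2) g := fun v =>
    exists_isFrame ((hAdm _ _).mp (arc_mem_admissibleArcs.mp v.2).2)
  choose E hE using hE
  have hEτ : ∀ x y (h : arc x y ∈ τ), E ⟨(x, y), hmem h⟩ = F x y := fun x y h =>
    (hE _).unique (hFτ x y h)
  have hAsmul : ∀ (γ : Γ) (x : Cusp Γ), (A (γ • x))⁻¹ * (σ.hol γ * A x) ∈ T := by
    intro γ x
    have := hρ γ x (N x) (hN x)
    change (A (γ • x))⁻¹ * (ρ γ * F x (N x)) ∈ T
    rw [← this]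
    exact hF.inv_mul_mem_T hτ (hN _) (by rw [arc_smul]; exact hN x)
  have hEsmul : ∀ (γ : Γ) v, E (γ • v) = σ.hol γ * E v := fun γ v =>
    (hE _).unique (((hE v).mul_left (σ.hol γ)).change (hAsmul γ _) (hAsmul γ _))
  let v₀ : Vert (admissibleArcs (Quotient.mk _ σ : Moduli Γ)) := ⟨(a, b), hmem hab⟩
  have hE₀ : E v₀ = 1 := (hEτ a b hab).trans hF1
  let C : GraphConn (admissibleArcs (Quotient.mk _ σ : Moduli Γ)) :=
    { W := fun u v => (E u)⁻¹ * E v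
      comp := fun u v w => by group
      smul := fun γ u v => by rw [hEsmul, hEsmul]; group }
  let p : Bundle Γ :=
    { π := Quotient.mk _ σ
      conn := C
      represents := by
        refine ⟨v₀, σ, MonoidHom.ext fun γ => ?_, rfl⟩
        change σ.hol γ = (E v₀)⁻¹ * E (γ • v₀)
        rw [hEsmul, hE₀, inv_one, one_mul, mul_one]
      long := by
        intro x y hxy hyx
        obtain ⟨k, hk, h⟩ := (hE ⟨(x, y), hxy⟩).symm
        have e := (hE ⟨(y, x), hyx⟩).unique h
        refine ⟨k, hk, ?_⟩
        change (E _)⁻¹ * E _ = _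
        rw [e, inv_mul_cancel_left]
      short := by
        intro x y z hy hz
        have h := T.mul_mem (T.inv_mem (hE ⟨(x, y), hy⟩).1) (hE ⟨(x, z), hz⟩).1
        change (E _)⁻¹ * E _ ∈ T
        convert h using 1
        group }
  refine ⟨p, hmem, fun x y hxy hyx => ?_, fun x y z t => ?_⟩
  · change (E _)⁻¹ * E _ = _
    rw [hEτ x y hxy, hEτ y x hyx, hF.long x y hxy, inv_mul_cancel_left, longElt]
    exact thetaDiag_congr (edgeLen_of_mem f hxy) _
  · change (E _)⁻¹ * E _ = _
    rw [hEτ x y t.xy, hEτ x z t.xz, hF.short x y z t, inv_mul_cancel_left, shortElt, cornerParam,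
      faceSgn_of_mem ε t.face_mem, edgeLen_of_mem f t.xy, edgeLen_of_mem f t.yz,
      edgeLen_of_mem f t.zx]

/-! ### Transports of a point of the bundle -/

/-- The vertex at the end `x` of the lifted arc from `x` to `y`. -/
def vert {α : Set (Orb Γ)} {x y : Cusp Γ} (h : arc x y ∈ α) : Vert α := ⟨(x, y), h⟩

namespace GraphConn

variable {α : Set (Orb Γ)} (C : GraphConn α)

theorem W_self (v : Vert α) : C.W v v = 1 := mul_eq_left.mp (C.comp v v v)

theorem W_inv (u v : Vert α) : (C.W u v)⁻¹ = C.W v u := by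
  rw [inv_eq_iff_mul_eq_one, C.comp, C.W_self]

theorem W_smul_right (γ : Γ) (u v : Vert α) : C.W u (γ • v) = C.hol u γ * C.W u v := by
  change _ = C.W u (γ • u) * C.W u v
  rw [← C.smul γ u v, C.comp]

theorem hol_conj (u v : Vert α) (γ : Γ) :
    C.hol u γ = C.W u v * C.hol v γ * (C.W u v)⁻¹ := by
  have h := C.W_smul_right γ v u
  change C.W u (γ • u) = _
  rw [C.W_inv, mul_assoc, ← h, C.comp]

end GraphConn

namespace Bundle

variable (p : Bundle Γ)

theorem exists_long {x y : Cusp Γ} (hxy : arc x y ∈ admissibleArcs p.π)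
    (hyx : arc y x ∈ admissibleArcs p.π) :
    ∃ (h : ℝ) (hh : 0 < h), p.conn.W (vert hxy) (vert hyx) = thetaDiag h hh :=
  p.long x y hxy hyx

theorem short_mem {x y z : Cusp Γ} (hy : arc x y ∈ admissibleArcs p.π)
    (hz : arc x z ∈ admissibleArcs p.π) : p.conn.W (vert hy) (vert hz) ∈ T :=
  p.short x y z hy hz

end Bundle

namespace Corresponds

variable {f : EdgeFun τ} {ε : FaceSign τ} {p q : Bundle Γ}

theorem sub (hp : Corresponds τ f ε p) {e : Orb Γ} (he : e ∈ τ) : e ∈ admissibleArcs p.π :=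
  hp.mem he

theorem long_eq (hp : Corresponds τ f ε p) {x y : Cusp Γ} (hxy : arc x y ∈ τ) (hyx : arc y x ∈ τ) :
    p.conn.W (vert (hp.sub hxy)) (vert (hp.sub hyx)) = longElt f x y := by
  refine (hp.long x y hxy hyx).trans ?_
  rw [longElt]
  exact thetaDiag_congr (edgeLen_of_mem f hxy).symm _

theorem short_eq (hp : Corresponds τ f ε p) {x y z : Cusp Γ} (h : IsTri τ x y z) :
    p.conn.W (vert (hp.sub h.xy)) (vert (hp.sub h.xz)) = unip (cornerParam f ε x y z) := by
  refine (hp.short x y z h).trans ?_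
  rw [cornerParam, faceSgn_of_mem ε h.face_mem, edgeLen_of_mem f h.xy,
    edgeLen_of_mem f h.yz, edgeLen_of_mem f h.zx]

theorem of_eq (mem : p.π ∈ moduliOf τ)
    (long : ∀ x y (hxy : arc x y ∈ τ) (hyx : arc y x ∈ τ),
      p.conn.W (vert (mem hxy)) (vert (mem hyx)) = longElt f x y)
    (short : ∀ x y z (h : IsTri τ x y z),
      p.conn.W (vert (mem h.xy)) (vert (mem h.xz)) = unip (cornerParam f ε x y z)) :
    Corresponds τ f ε p := by
  refine ⟨mem, fun x y hxy hyx => ?_, fun x y z h => ?_⟩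
  · refine (long x y hxy hyx).trans ?_
    rw [longElt]
    exact thetaDiag_congr (edgeLen_of_mem f hxy) _
  · refine (short x y z h).trans ?_
    rw [cornerParam, faceSgn_of_mem ε h.face_mem, edgeLen_of_mem f h.xy,
      edgeLen_of_mem f h.yz, edgeLen_of_mem f h.zx]

-- Transports from a fixed vertex form a development, so that uniqueness of developments applies to
-- points of the bundle.
open Classical in
theorem isPairDevelopment (hp : Corresponds τ f ε p) (v : Vert (admissibleArcs p.π)) :
    IsPairDevelopment f ε fun x y =>
      if h : arc x y ∈ τ then p.conn.W v (vert (hp.sub h)) else 1 := by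
  refine ⟨fun x y h => ?_, fun x y z h => ?_⟩
  · have h' : arc y x ∈ τ := by rwa [arc_comm]
    rw [dif_pos h, dif_pos h', ← hp.long_eq h h', p.conn.comp]
  · rw [dif_pos h.xy, dif_pos h.xz, shortElt, ← hp.short_eq h, p.conn.comp]

theorem W_eq (hτ : IsIdealTriangulation τ) (hp : Corresponds τ f ε p) (hq : Corresponds τ f ε q)
    {a b x y : Cusp Γ} (hab : arc a b ∈ τ) (hxy : arc x y ∈ τ) :
    p.conn.W (vert (hp.sub hab)) (vert (hp.sub hxy)) =
      q.conn.W (vert (hq.sub hab)) (vert (hq.sub hxy)) := by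
  classical
  have := IsDevelopment.unique hτ (hp.isPairDevelopment (vert (hp.sub hab)))
    (hq.isPairDevelopment (vert (hq.sub hab))) hab hxy
    (by rw [dif_pos hab, dif_pos hab, GraphConn.W_self, GraphConn.W_self])
  rwa [dif_pos hxy, dif_pos hxy] at this

theorem π_eq (hτ : IsIdealTriangulation τ) (hp : Corresponds τ f ε p) (hq : Corresponds τ f ε q)
    {a b : Cusp Γ} (hab : arc a b ∈ τ) : p.π = q.π := by
  obtain ⟨v, ρ, hρ, hρπ⟩ := p.represents
  obtain ⟨w, σ, hσ, hσπ⟩ := q.represents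
  let u : Vert (admissibleArcs p.π) := vert (hp.sub hab)
  let u' : Vert (admissibleArcs q.π) := vert (hq.sub hab)
  have hol : ∀ γ : Γ, p.conn.hol u γ = q.conn.hol u' γ := fun γ =>
    hp.W_eq hτ hq hab (by rw [arc_smul]; exact hab)
  rw [← hρπ, ← hσπ]
  -- The holonomies agree at the vertex of `ab`, while the representing flat connections may be
  -- based elsewhere. The conjugating element moves both base points there.
  refine Quotient.sound ⟨q.conn.W w u' * (p.conn.W v u)⁻¹, fun γ => ?_⟩
  rw [hρ, hσ, q.conn.hol_conj w u', p.conn.hol_conj v u, hol]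
  group

end Corresponds

/-- The transport to any admissible arc is pinned down by transports to arbitrary arcs at its two
cusps, so the whole connection is determined by its transports on `τ`. -/
theorem Bundle.isFrame (p : Bundle Γ) (v : Vert (admissibleArcs p.π)) {x y x' y' : Cusp Γ}
    (hxy : arc x y ∈ admissibleArcs p.π) (hx : arc x x' ∈ admissibleArcs p.π)
    (hy : arc y y' ∈ admissibleArcs p.π) :
    IsFrame (p.conn.W v (vert hx)) (p.conn.W v (vert hy)) (p.conn.W v (vert hxy)) := by
  have hyx : arc y x ∈ admissibleArcs p.π := by rwa [arc_comm]
  obtain ⟨k, hk, e⟩ := p.exists_long hxy hyx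
  refine ⟨?_, k, hk, ?_⟩
  · rw [p.conn.W_inv, p.conn.comp]
    exact p.short_mem hx hxy
  · rw [← e, p.conn.comp, p.conn.W_inv, p.conn.comp]
    exact p.short_mem hy hyx

theorem Corresponds.unique (hτ : IsIdealTriangulation τ) {f : EdgeFun τ} {ε : FaceSign τ}
    {p q : Bundle Γ} (hp : Corresponds τ f ε p) (hq : Corresponds τ f ε q) {a b : Cusp Γ}
    (hab : arc a b ∈ τ) : p = q := by
  have hπ := hp.π_eq hτ hq hab
  have hW := fun x y (hxy : arc x y ∈ τ) => hp.W_eq hτ hq hab hxy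
  have hpF := @Bundle.isFrame _ p (vert (hp.sub hab))
  have hqF := @Bundle.isFrame _ q (vert (hq.sub hab))
  have hmem : τ ⊆ admissibleArcs p.π := hp.mem
  obtain ⟨m, C, r₁, r₂, r₃⟩ := p
  obtain ⟨m', C', s₁, s₂, s₃⟩ := q
  obtain rfl : m = m' := hπ
  have hWW : ∀ v, C.W (vert (hp.sub hab)) v = C'.W (vert (hp.sub hab)) v := by
    rintro ⟨⟨x, y⟩, hxy⟩
    obtain ⟨x', hx⟩ := hτ.exists_arc x
    obtain ⟨y', hy⟩ := hτ.exists_arc y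
    have e₁ := hpF hxy (hmem hx) (hmem hy)
    have e₂ := hqF hxy (hmem hx) (hmem hy)
    have k₁ := hW x x' hx
    have k₂ := hW y y' hy
    dsimp only at e₁ e₂ k₁ k₂
    rw [k₁, k₂] at e₁
    exact e₁.unique e₂
  have hC : C = C' := by
    ext u v
    rw [← C.comp u (vert (hp.sub hab)) v, ← C'.comp u (vert (hp.sub hab)) v, ← C.W_inv,
      ← C'.W_inv, hWW, hWW]
  subst hC
  rfl

/-- The parameters of a triangle of admissible arcs. -/
theorem Bundle.exists_sign (p : Bundle Γ) {x y z : Cusp Γ} (hxy : arc x y ∈ admissibleArcs p.π)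
    (hyx : arc y x ∈ admissibleArcs p.π) (hyz : arc y z ∈ admissibleArcs p.π)
    (hzy : arc z y ∈ admissibleArcs p.π) (hxz : arc x z ∈ admissibleArcs p.π)
    (hzx : arc z x ∈ admissibleArcs p.π) {k l m : ℝ} {hk : 0 < k} {hl : 0 < l} {hm : 0 < m}
    (e₁ : p.conn.W (vert hxy) (vert hyx) = thetaDiag k hk)
    (e₂ : p.conn.W (vert hyz) (vert hzy) = thetaDiag l hl)
    (e₃ : p.conn.W (vert hxz) (vert hzx) = thetaDiag m hm) :
    ∃ s : ℤˣ, p.conn.W (vert hxy) (vert hxz) = unip (sgn s * (l / (k * m))) ∧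
      p.conn.W (vert hyz) (vert hyx) = unip (sgn s * (m / (l * k))) ∧
      p.conn.W (vert hzx) (vert hzy) = unip (sgn s * (k / (m * l))) := by
  obtain ⟨u, hu⟩ := p.short_mem hxy hxz
  obtain ⟨v, hv⟩ := p.short_mem hyz hyx
  obtain ⟨w, hw⟩ := p.short_mem hzx hzy
  have h : thetaDiag k hk * unip (-v) * thetaDiag l hl = unip u * thetaDiag m hm * unip w := by
    rw [← unip_inv, hu, hv, hw, ← e₁, ← e₂, ← e₃, p.conn.W_inv]
    simp only [p.conn.comp]
  obtain ⟨s, rfl, rfl, rfl⟩ := (hexagon_iff hk hl hm).mp h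
  exact ⟨s, hu.symm, hv.symm, hw.symm⟩

/-! ### Signs -/

theorem sgn_eq_one_or (s : ℤˣ) : (s = 1 ∧ sgn s = 1) ∨ (s = -1 ∧ sgn s = -1) := by
  rcases Int.units_eq_one_or s with rfl | rfl <;> simp [sgn]

theorem sgn_mul_pos_inj {s t : ℤˣ} {x y : ℝ} (hx : 0 < x) (hy : 0 < y)
    (h : sgn s * x = sgn t * y) : s = t ∧ x = y := by
  rcases sgn_eq_one_or s with ⟨rfl, e⟩ | ⟨rfl, e⟩ <;>
    rcases sgn_eq_one_or t with ⟨rfl, e'⟩ | ⟨rfl, e'⟩ <;> simp only [e, e'] at h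
  · exact ⟨rfl, by linarith⟩
  · exfalso; linarith
  · exfalso; linarith
  · exact ⟨rfl, by linarith⟩

/-- The conditions that the corners at the two ends of the old diagonal add up, in terms of the
flip relations. -/
theorem flip_relations_iff {a b c d e k : ℝ} (ha : 0 < a) (hb : 0 < b) (hc : 0 < c) (hd : 0 < d)
    (he : 0 < e) (hk : 0 < k) {s₁ s₂ t₁ t₂ : ℤˣ} :
    (sgn t₁ * (k / (a * d)) = sgn s₁ * (b / (a * e)) + sgn s₂ * (c / (e * d)) ∧
      sgn t₂ * (k / (c * b)) = sgn s₂ * (d / (c * e)) + sgn s₁ * (a / (e * b))) ↔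
    (t₁ * t₂ = s₁ * s₂ ∧ sgn t₁ * e * k = sgn s₂ * a * c + sgn s₁ * b * d) := by
  have h₁ : sgn t₁ * (k / (a * d)) = sgn s₁ * (b / (a * e)) + sgn s₂ * (c / (e * d)) ↔
      sgn t₁ * (e * k) = sgn s₂ * (a * c) + sgn s₁ * (b * d) := by
    field_simp
    constructor <;> intro h <;> linarith
  have h₂ : sgn t₂ * (k / (c * b)) = sgn s₂ * (d / (c * e)) + sgn s₁ * (a / (e * b)) ↔
      sgn t₂ * (e * k) = sgn s₁ * (a * c) + sgn s₂ * (b * d) := by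
    field_simp
    constructor <;> intro h <;> linarith
  rw [h₁, h₂]
  simp only [mul_assoc]
  have p₁ := mul_pos he hk
  have p₂ := mul_pos ha hc
  have p₃ := mul_pos hb hd
  generalize e * k = x at *
  generalize a * c = y at *
  generalize b * d = z at *
  clear h₁ h₂
  -- After clearing denominators, the two right sides differ by the factor `s₁ s₂`, and the left
  -- sides by `t₁ t₂`. As `x` is positive, the second equation given the first amounts to equality
  -- of these signs.
  rcases sgn_eq_one_or s₁ with ⟨rfl, e₁⟩ | ⟨rfl, e₁⟩ <;>
    rcases sgn_eq_one_or s₂ with ⟨rfl, e₂⟩ | ⟨rfl, e₂⟩ <;>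
    rcases sgn_eq_one_or t₁ with ⟨rfl, e₃⟩ | ⟨rfl, e₃⟩ <;>
    rcases sgn_eq_one_or t₂ with ⟨rfl, e₄⟩ | ⟨rfl, e₄⟩ <;>
    simp only [e₁, e₂, e₃, e₄] <;> constructor <;> rintro ⟨h, h'⟩ <;>
    first
      | exact ⟨by decide, by linarith⟩
      | exact ⟨by linarith, by linarith⟩
      | exact absurd h (by decide)

/-! ### Flips -/

namespace IsFlip

variable {x₀ x₁ x₂ x₃ : Cusp Γ}

theorem mem_of_mem (h : IsFlip τ τ' x₀ x₁ x₂ x₃) {t : Orb Γ} (ht : t ∈ τ')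
    (hne : t ≠ arc x₁ x₃) : t ∈ τ := by
  rw [h.eq] at ht
  exact (ht.resolve_left hne).1

theorem isTri_of_isTri (h : IsFlip τ τ' x₀ x₁ x₂ x₃) {x y z : Cusp Γ} (t : IsTri τ' x y z)
    (h₁ : arc x y ≠ arc x₁ x₃) (h₂ : arc y z ≠ arc x₁ x₃) (h₃ : arc z x ≠ arc x₁ x₃) :
    IsTri τ x y z :=
  ⟨t.pos, h.mem_of_mem t.xy h₁, h.mem_of_mem t.yz h₂, h.mem_of_mem t.zx h₃⟩

end IsFlip

/-- A common face of two ideal triangulations is a triangle of both. -/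
theorem exists_isTri_of_mem_faces {t : Orb Γ} (ht : t ∈ faces τ) (ht' : t ∈ faces τ') :
    ∃ x y z : Cusp Γ, IsTri τ x y z ∧ IsTri τ' x y z ∧ t = face x y z := by
  obtain ⟨x, y, z, h, rfl⟩ := ht
  obtain ⟨x', y', z', h', e⟩ := ht'
  obtain ⟨γ, hγ⟩ := Quotient.exact e
  have hγ' : ({γ • x', γ • y', γ • z'} : Set (Cusp Γ)) = {x, y, z} := by
    rw [← hγ]
    change _ = γ • ({x', y', z'} : Set (Cusp Γ))
    rw [← Set.image_smul, Set.image_insert_eq, Set.image_pair]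
  have h'' := h'.smul γ
  refine ⟨x, y, z, h, ?_, rfl⟩
  rcases eq_rotate_of_triple_eq h''.pos h.pos hγ' with
    ⟨e₁, e₂, e₃⟩ | ⟨e₁, e₂, e₃⟩ | ⟨e₁, e₂, e₃⟩ <;>
    rw [e₁, e₂, e₃]
  · exact h''
  · exact h''.rotate
  · exact h''.rotate.rotate

/-! ### Comparison of the coordinates of one point in two triangulations related by a flip. -/

section Flip

variable {x₀ x₁ x₂ x₃ : Cusp Γ} {f : EdgeFun τ} {ε : FaceSign τ} {f' : EdgeFun τ'}
  {ε' : FaceSign τ'} {p : Bundle Γ}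

/-- The parameters at the corners of the quadrilateral of a flip add up. -/
theorem Corresponds.corner_add (hp : Corresponds τ f ε p) {x y z w : Cusp Γ} (h₁ : IsTri τ x y z)
    (h₂ : IsTri τ x z w) : p.conn.W (vert (hp.sub h₁.xy)) (vert (hp.sub h₂.xz)) =
      unip (cornerParam f ε x y z + cornerParam f ε x z w) := by
  rw [← unip_mul, ← hp.short_eq h₁, ← hp.short_eq h₂, p.conn.comp]

theorem edgeLen_comm (f : EdgeFun τ) (x y : Cusp Γ) :
    edgeLen f (arc x y) = edgeLen f (arc y x) := by
  rw [arc_comm]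

/-- The flip relations between `(f, ε)` and `(f', ε')`. -/
structure FlipRelations (x₀ x₁ x₂ x₃ : Cusp Γ) (f : EdgeFun τ) (ε : FaceSign τ) (f' : EdgeFun τ')
    (ε' : FaceSign τ') : Prop where
  edge : ∀ e, e ∈ τ → e ∈ τ' → edgeLen f' e = edgeLen f e
  face : ∀ t, t ∈ faces τ → t ∈ faces τ' → faceSgn ε' t = faceSgn ε t
  corner₀ : cornerParam f' ε' x₀ x₁ x₃ = cornerParam f ε x₀ x₁ x₂ + cornerParam f ε x₀ x₂ x₃
  corner₂ : cornerParam f' ε' x₂ x₃ x₁ = cornerParam f ε x₂ x₃ x₀ + cornerParam f ε x₂ x₀ x₁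

theorem cornerParam_ne_zero (f : EdgeFun τ) (ε : FaceSign τ) (x y z : Cusp Γ) :
    cornerParam f ε x y z ≠ 0 := by
  have h₁ := edgeLen_pos f (arc x y)
  have h₂ := edgeLen_pos f (arc y z)
  have h₃ := edgeLen_pos f (arc z x)
  have hs : sgn (faceSgn ε (face x y z)) ≠ 0 := by
    rcases sgn_eq_one_or (faceSgn ε (PuncturedSurface.face x y z)) with ⟨-, e⟩ | ⟨-, e⟩ <;>
      rw [e] <;> norm_num
  exact mul_ne_zero hs (by positivity)

/-- Both pairs describe transports of the same connection, and the parametrizations of `θH` and `T`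
are injective. At an end of the old diagonal, the new short edge is the composite of two old ones.
-/
theorem Corresponds.flipRelations (h : IsFlip τ τ' x₀ x₁ x₂ x₃) (hτ : IsIdealTriangulation τ)
    (hp : Corresponds τ f ε p) (hp' : Corresponds τ' f' ε' p) :
    FlipRelations x₀ x₁ x₂ x₃ f ε f' ε' := by
  have edge : ∀ e, e ∈ τ → e ∈ τ' → edgeLen f' e = edgeLen f e := by
    intro e he he'
    obtain ⟨x, y, -, rfl, -⟩ := hτ.isIdealArc e he
    have h₁ := hp.long_eq he (by rwa [arc_comm])
    have h₂ := hp'.long_eq he' (by rwa [arc_comm])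
    exact thetaDiag_injective (h₂.symm.trans h₁)
  refine ⟨edge, ?_, ?_, ?_⟩
  · intro t ht ht'
    obtain ⟨x, y, z, k, k', rfl⟩ := exists_isTri_of_mem_faces ht ht'
    have e := unip_injective ((hp'.short_eq k').symm.trans (hp.short_eq k))
    have h₁ := edgeLen_pos f (arc x y)
    have h₂ := edgeLen_pos f (arc y z)
    have h₃ := edgeLen_pos f (arc z x)
    rw [cornerParam, cornerParam, edge _ k.xy k'.xy, edge _ k.yz k'.yz, edge _ k.zx k'.zx] at e
    exact (sgn_mul_pos_inj (by positivity) (by positivity) e).1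
  · exact unip_injective ((hp'.short_eq h.t₁'.rotate.rotate).symm.trans (hp.corner_add h.t₁ h.t₂))
  · exact unip_injective ((hp'.short_eq h.t₂'.rotate).symm.trans
      (hp.corner_add h.t₂.rotate h.t₁.rotate.rotate))

/-- The new diagonal is admissible if the corners at `x₀` do not cancel. -/
theorem Corresponds.arc_mem (h : IsFlip τ τ' x₀ x₁ x₂ x₃) (hτ' : IsIdealTriangulation τ')
    (hp : Corresponds τ f ε p)
    (hu : cornerParam f ε x₀ x₁ x₂ + cornerParam f ε x₀ x₂ x₃ ≠ 0) :
    arc x₁ x₃ ∈ admissibleArcs p.π := by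
  obtain ⟨v, ρ, hρ, hρπ⟩ := p.represents
  have aux : ∀ {x y : Cusp Γ} (hxy : arc x y ∈ admissibleArcs p.π) (γ : Γ), γ • x = x →
      (p.conn.W v (vert hxy))⁻¹ * ρ.hol γ * p.conn.W v (vert hxy) ∈ T := by
    intro x y hxy γ hγ
    have hxy' : arc x (γ • y) ∈ admissibleArcs p.π := by
      have := arc_smul γ x y
      rw [hγ] at this
      rwa [this]
    have e : γ • vert hxy = vert hxy' :=
      Subtype.ext (Prod.ext hγ rfl)
    rw [hρ, mul_assoc, ← p.conn.W_smul_right, p.conn.W_inv, p.conn.comp, e]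
    exact p.short_mem _ _
  have h₁₀ : arc x₁ x₀ ∈ τ := by rw [arc_comm]; exact h.t₁.xy
  -- The ends `x₁` and `x₃` are joined by travelling along `x₁x₀`, around `x₀`, and along `x₀x₃`.
  have key := thetaDiag_unip_thetaDiag_notMem_B (edgeLen_pos f (arc x₁ x₀))
    (edgeLen_pos f (arc x₀ x₃)) hu
  have e₁ := hp.long_eq h₁₀ h.t₁.xy
  have e₂ := hp.corner_add h.t₁ h.t₂
  have e₃ := hp.long_eq h.t₂.xz h.t₂.zx
  rw [longElt] at e₁ e₃
  rw [← e₁, ← e₂, ← e₃] at key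
  erw [p.conn.comp, p.conn.comp] at key
  have goal : Admissible ρ x₁ x₃ := by
    rw [admissible_iff (aux (hp.sub h₁₀)) (aux (hp.sub h.t₂.zx)), p.conn.W_inv, p.conn.comp]
    exact key
  have hI := hτ'.isIdealArc _ h.t₁'.xy
  have := arc_mem_admissibleArcs.mpr ⟨hI, goal⟩
  rwa [hρπ] at this

/-- Away from the diagonal nothing changes. The two corner equations identify the unknown length of
the diagonal and the signs of its two triangles; the remaining four corners then follow from
`Bundle.exists_sign`, and all lifts are covered by invariance under `Γ`. -/
theorem FlipRelations.corresponds (h : IsFlip τ τ' x₀ x₁ x₂ x₃) (hτ' : IsIdealTriangulation τ')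
    (r : FlipRelations x₀ x₁ x₂ x₃ f ε f' ε') (hp : Corresponds τ f ε p) :
    Corresponds τ' f' ε' p := by
  have mem₁₃ := hp.arc_mem h hτ' (r.corner₀ ▸ cornerParam_ne_zero f' ε' _ _ _)
  have mem₃₁ : arc x₃ x₁ ∈ admissibleArcs p.π := by rwa [arc_comm]
  have mem : p.π ∈ moduliOf τ' := by
    intro e he
    by_cases hne : e = arc x₁ x₃
    · exact hne ▸ mem₁₃
    · exact hp.sub (h.mem_of_mem he hne)
  have sub : ∀ {e}, e ∈ τ' → e ∈ admissibleArcs p.π := fun he => mem he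
  have long : ∀ {x y} (hxy : arc x y ∈ τ') (hyx : arc y x ∈ τ'), arc x y ∈ τ →
      p.conn.W (vert (sub hxy)) (vert (sub hyx)) = longElt f' x y := by
    intro x y hxy hyx hτxy
    refine (hp.long_eq hτxy (by rwa [arc_comm])).trans ?_
    rw [longElt, longElt]
    exact thetaDiag_congr (r.edge _ hτxy hxy).symm _
  have d₀ := hp.corner_add h.t₁ h.t₂
  have d₂ := hp.corner_add h.t₂.rotate h.t₁.rotate.rotate
  rw [← r.corner₀] at d₀
  rw [← r.corner₂] at d₂
  obtain ⟨k, hk, e₁₃⟩ := p.exists_long mem₁₃ mem₃₁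
  have e₃₁ : p.conn.W (vert mem₃₁) (vert mem₁₃) = thetaDiag k hk := by
    rw [← p.conn.W_inv, e₁₃, inv_eq_iff_mul_eq_one, thetaDiag_mul_self]
  have h₁₀ : arc x₁ x₀ ∈ τ' := by rw [arc_comm]; exact h.t₁'.zx
  have h₀₃ : arc x₀ x₃ ∈ τ' := by rw [arc_comm]; exact h.t₁'.yz
  obtain ⟨s, s₀, s₁, s₃⟩ := p.exists_sign (sub h.t₁'.zx) (sub h₁₀) mem₁₃ mem₃₁ (sub h₀₃)
    (sub h.t₁'.yz) (long h.t₁'.zx h₁₀ h.t₁.xy) e₁₃ (long h₀₃ h.t₁'.yz h.t₂.xz)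
  have p₀₁ := edgeLen_pos f' (arc x₀ x₁)
  have p₁₃ := edgeLen_pos f' (arc x₁ x₃)
  have p₃₀ := edgeLen_pos f' (arc x₃ x₀)
  have p₁₂ := edgeLen_pos f' (arc x₁ x₂)
  have p₂₃ := edgeLen_pos f' (arc x₂ x₃)
  have E₀ := unip_injective (s₀.symm.trans d₀)
  rw [cornerParam, edgeLen_comm f' x₀ x₃] at E₀
  -- The equation at `x₀` fixes both the sign of the first new triangle and the length `k`. The
  -- equation at `x₂` below is then needed only for the sign of the second.
  obtain ⟨rfl, hkk⟩ := sgn_mul_pos_inj (by positivity) (by positivity) E₀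
  have hk' : k = edgeLen f' (arc x₁ x₃) := by
    rwa [div_left_inj' (by positivity)] at hkk
  subst hk'
  have h₃₂ : arc x₃ x₂ ∈ τ' := by rw [arc_comm]; exact h.t₂'.yz
  have h₂₁ : arc x₂ x₁ ∈ τ' := by rw [arc_comm]; exact h.t₂'.xy
  have g₂₁ : arc x₂ x₁ ∈ τ := by rw [arc_comm]; exact h.t₁.yz
  obtain ⟨s', s₂', s₃', s₁'⟩ := p.exists_sign (sub h.t₂'.yz) (sub h₃₂) mem₃₁ mem₁₃ (sub h₂₁)
    (sub h.t₂'.xy) (long h.t₂'.yz h₃₂ h.t₂.yz) e₃₁ (long h₂₁ h.t₂'.xy g₂₁)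
  have E₂ := unip_injective (s₂'.symm.trans d₂)
  rw [cornerParam, edgeLen_comm f' x₂ x₁, edgeLen_comm f' x₃ x₁] at E₂
  obtain ⟨rfl, -⟩ := sgn_mul_pos_inj (by positivity) (by positivity) E₂
  let Good : Cusp Γ → Cusp Γ → Cusp Γ → Prop := fun x y z =>
    ∀ (hy : arc x y ∈ admissibleArcs p.π) (hz : arc x z ∈ admissibleArcs p.π),
      p.conn.W (vert hy) (vert hz) = unip (cornerParam f' ε' x y z)
  have good_smul : ∀ (γ : Γ) {x y z}, Good x y z → Good (γ • x) (γ • y) (γ • z) := by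
    intro γ x y z hg hy hz
    have hy' : arc x y ∈ admissibleArcs p.π := by rwa [arc_smul] at hy
    have hz' : arc x z ∈ admissibleArcs p.π := by rwa [arc_smul] at hz
    rw [cornerParam_smul, ← hg hy' hz', ← p.conn.smul γ (vert hy') (vert hz')]
    rfl
  have g₀₁₃ : Good x₀ x₁ x₃ := fun _ _ => d₀
  have g₁₃₀ : Good x₁ x₃ x₀ := fun _ _ => s₁.trans (by
    rw [cornerParam, face_rotate x₀ x₁ x₃, edgeLen_comm f' x₀ x₃])
  have g₃₀₁ : Good x₃ x₀ x₁ := fun _ _ => s₃.trans (by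
    rw [cornerParam, face_rotate, face_rotate, edgeLen_comm f' x₀ x₃])
  have g₂₃₁ : Good x₂ x₃ x₁ := fun _ _ => d₂
  have g₃₁₂ : Good x₃ x₁ x₂ := fun _ _ => s₃'.trans (by
    rw [cornerParam, face_rotate x₂ x₃ x₁, edgeLen_comm f' x₂ x₁, edgeLen_comm f' x₃ x₁])
  have g₁₂₃ : Good x₁ x₂ x₃ := fun _ _ => s₁'.trans (by
    rw [cornerParam, face_rotate x₃ x₁ x₂, face_rotate x₂ x₃ x₁, edgeLen_comm f' x₂ x₁,
      edgeLen_comm f' x₃ x₁])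
  have good_diag : ∀ {x y z}, IsTri τ' x y z → arc x y = arc x₁ x₃ →
      Good x y z ∧ Good y z x ∧ Good z x y := by
    intro x y z t e
    -- A triangle on a lift of the diagonal is a translate of one of the two new triangles; the
    -- direction of the lift tells which.
    obtain ⟨γ, ⟨rfl, rfl⟩ | ⟨rfl, rfl⟩⟩ := exists_smul_eq_of_arc_eq e
    · obtain rfl := hτ'.third_unique (h.t₁'.smul γ) t
      exact ⟨good_smul γ g₁₃₀, good_smul γ g₃₀₁, good_smul γ g₀₁₃⟩
    · obtain rfl := hτ'.third_unique (h.t₂'.rotate.rotate.smul γ) t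
      exact ⟨good_smul γ g₃₁₂, good_smul γ g₁₂₃, good_smul γ g₂₃₁⟩
  refine Corresponds.of_eq mem ?_ ?_
  · intro x y hxy hyx
    change p.conn.W (vert (sub hxy)) (vert (sub hyx)) = _
    by_cases hne : arc x y = arc x₁ x₃
    · have hlen : longElt f' x y = thetaDiag (edgeLen f' (arc x₁ x₃)) hk := by
        rw [longElt]; exact thetaDiag_congr (by rw [hne]) _
      rw [hlen]
      obtain ⟨γ, ⟨rfl, rfl⟩ | ⟨rfl, rfl⟩⟩ := exists_smul_eq_of_arc_eq hne
      · rw [← e₁₃, ← p.conn.smul γ (vert mem₁₃) (vert mem₃₁)]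
        rfl
      · rw [← e₃₁, ← p.conn.smul γ (vert mem₃₁) (vert mem₁₃)]
        rfl
    · exact long hxy hyx (h.mem_of_mem hxy hne)
  · intro x y z t
    by_cases n₁ : arc x y = arc x₁ x₃
    · exact (good_diag t n₁).1 _ _
    by_cases n₂ : arc y z = arc x₁ x₃
    · exact (good_diag t.rotate n₂).2.2 _ _
    by_cases n₃ : arc z x = arc x₁ x₃
    · exact (good_diag t.rotate.rotate n₃).2.1 _ _
    have t' := h.isTri_of_isTri t n₁ n₂ n₃
    refine (hp.short_eq t').trans ?_
    rw [cornerParam, cornerParam, r.edge _ t'.xy t.xy, r.edge _ t'.yz t.yz, r.edge _ t'.zx t.zx,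
      r.face _ t'.face_mem t.face_mem]

/-- The four sides of the quadrilateral belong to both triangulations, so the edge condition
replaces their `f'`-lengths by `f`-lengths and reduces the corner equations to `flip_relations_iff`.
-/
theorem flipRelations_iff (h : IsFlip τ τ' x₀ x₁ x₂ x₃) :
    FlipRelations x₀ x₁ x₂ x₃ f ε f' ε' ↔
      ((∀ e, e ∈ τ → e ∈ τ' → edgeLen f' e = edgeLen f e) ∧
        (∀ t, t ∈ faces τ → t ∈ faces τ' → faceSgn ε' t = faceSgn ε t) ∧
        faceSgn ε' (face x₁ x₃ x₀) * faceSgn ε' (face x₁ x₂ x₃) =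
          faceSgn ε (face x₀ x₁ x₂) * faceSgn ε (face x₀ x₂ x₃) ∧
        sgn (faceSgn ε' (face x₁ x₃ x₀)) * edgeLen f (arc x₀ x₂) * edgeLen f' (arc x₁ x₃) =
          sgn (faceSgn ε (face x₀ x₂ x₃)) * edgeLen f (arc x₀ x₁) * edgeLen f (arc x₂ x₃) +
          sgn (faceSgn ε (face x₀ x₁ x₂)) * edgeLen f (arc x₁ x₂) * edgeLen f (arc x₃ x₀)) := by
  have key : ∀ edge : (∀ e, e ∈ τ → e ∈ τ' → edgeLen f' e = edgeLen f e), _ := fun edge => by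
    have := flip_relations_iff (edgeLen_pos f (arc x₀ x₁)) (edgeLen_pos f (arc x₁ x₂))
      (edgeLen_pos f (arc x₂ x₃)) (edgeLen_pos f (arc x₃ x₀)) (edgeLen_pos f (arc x₀ x₂))
      (edgeLen_pos f' (arc x₁ x₃)) (s₁ := faceSgn ε (face x₀ x₁ x₂))
      (s₂ := faceSgn ε (face x₀ x₂ x₃)) (t₁ := faceSgn ε' (face x₁ x₃ x₀))
      (t₂ := faceSgn ε' (face x₁ x₂ x₃))
    have c₀ : cornerParam f' ε' x₀ x₁ x₃ = sgn (faceSgn ε' (face x₁ x₃ x₀)) *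
        (edgeLen f' (arc x₁ x₃) / (edgeLen f (arc x₀ x₁) * edgeLen f (arc x₃ x₀))) := by
      rw [cornerParam, face_rotate x₀ x₁ x₃, edge _ h.t₁.xy h.t₁'.zx, edge _ h.t₂.zx h.t₁'.yz]
    have c₁ : cornerParam f ε x₀ x₁ x₂ = sgn (faceSgn ε (face x₀ x₁ x₂)) *
        (edgeLen f (arc x₁ x₂) / (edgeLen f (arc x₀ x₁) * edgeLen f (arc x₀ x₂))) := by
      rw [cornerParam, edgeLen_comm f x₂ x₀]
    have c₂ : cornerParam f ε x₀ x₂ x₃ = sgn (faceSgn ε (face x₀ x₂ x₃)) *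
        (edgeLen f (arc x₂ x₃) / (edgeLen f (arc x₀ x₂) * edgeLen f (arc x₃ x₀))) := rfl
    have c₃ : cornerParam f' ε' x₂ x₃ x₁ = sgn (faceSgn ε' (face x₁ x₂ x₃)) *
        (edgeLen f' (arc x₁ x₃) / (edgeLen f (arc x₂ x₃) * edgeLen f (arc x₁ x₂))) := by
      rw [cornerParam, face_rotate x₁ x₂ x₃, edge _ h.t₂.yz h.t₂'.yz, edge _ h.t₁.yz h.t₂'.xy,
        edgeLen_comm f' x₃ x₁]
    have c₄ : cornerParam f ε x₂ x₃ x₀ = sgn (faceSgn ε (face x₀ x₂ x₃)) *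
        (edgeLen f (arc x₃ x₀) / (edgeLen f (arc x₂ x₃) * edgeLen f (arc x₀ x₂))) := by
      rw [cornerParam, face_rotate x₀ x₂ x₃]
    have c₅ : cornerParam f ε x₂ x₀ x₁ = sgn (faceSgn ε (face x₀ x₁ x₂)) *
        (edgeLen f (arc x₀ x₁) / (edgeLen f (arc x₀ x₂) * edgeLen f (arc x₁ x₂))) := by
      rw [cornerParam, ← face_rotate x₂ x₀ x₁, edgeLen_comm f x₂ x₀]
    rw [← c₀, ← c₁, ← c₂, ← c₃, ← c₄, ← c₅] at this
    exact this
  constructor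
  · rintro ⟨edge, face, h₀, h₂⟩
    exact ⟨edge, face, (key edge).mp ⟨h₀, h₂⟩⟩
  · rintro ⟨edge, face, hh⟩
    obtain ⟨h₀, h₂⟩ := (key edge).mpr hh
    exact ⟨edge, face, h₀, h₂⟩

/-- If the new diagonal were admissible, the short transport at `x₀` from `x₁` to `x₃` would have a
nonzero entry by `Bundle.exists_sign`. The degeneracy condition says that the two old parameters
with this sum cancel. -/
theorem Corresponds.notMem_of_degenerate (h : IsFlip τ τ' x₀ x₁ x₂ x₃)
    (hp : Corresponds τ f ε p)
    (hdeg : edgeLen f (arc x₀ x₁) * edgeLen f (arc x₂ x₃) /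
      (edgeLen f (arc x₁ x₂) * edgeLen f (arc x₃ x₀)) +
        sgn (faceSgn ε (face x₀ x₁ x₂)) * sgn (faceSgn ε (face x₀ x₂ x₃)) = 0) :
    p.π ∉ moduliOf τ' := by
  intro mem
  have mem₁₃ : arc x₁ x₃ ∈ admissibleArcs p.π := mem h.t₁'.xy
  have mem₃₁ : arc x₃ x₁ ∈ admissibleArcs p.π := by rwa [arc_comm]
  have h₁₀ : arc x₁ x₀ ∈ τ := by rw [arc_comm]; exact h.t₁.xy
  obtain ⟨k, hk, e₁₃⟩ := p.exists_long mem₁₃ mem₃₁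
  obtain ⟨s, s₀, -, -⟩ := p.exists_sign (hp.sub h.t₁.xy) (hp.sub h₁₀) mem₁₃ mem₃₁ (hp.sub h.t₂.xz)
    (hp.sub h.t₂.zx) (hp.long_eq h.t₁.xy h₁₀) e₁₃ (hp.long_eq h.t₂.xz h.t₂.zx)
  have e := unip_injective (s₀.symm.trans (hp.corner_add h.t₁ h.t₂))
  have p₀₁ := edgeLen_pos f (arc x₀ x₁)
  have p₁₂ := edgeLen_pos f (arc x₁ x₂)
  have p₂₃ := edgeLen_pos f (arc x₂ x₃)
  have p₃₀ := edgeLen_pos f (arc x₃ x₀)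
  have p₀₂ := edgeLen_pos f (arc x₀ x₂)
  rw [cornerParam, cornerParam, edgeLen_comm f x₂ x₀, edgeLen_comm f x₀ x₃] at e
  generalize edgeLen f (arc x₀ x₁) = a at *
  generalize edgeLen f (arc x₁ x₂) = b at *
  generalize edgeLen f (arc x₂ x₃) = c at *
  generalize edgeLen f (arc x₃ x₀) = d at *
  generalize edgeLen f (arc x₀ x₂) = g at *
  have hs : sgn s * k ≠ 0 := by
    rcases sgn_eq_one_or s with ⟨-, e⟩ | ⟨-, e⟩ <;> rw [e] <;> simp [hk.ne']
  have hss : sgn (faceSgn ε (face x₀ x₂ x₃)) * sgn (faceSgn ε (face x₀ x₂ x₃)) = 1 := by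
    rcases sgn_eq_one_or (faceSgn ε (face x₀ x₂ x₃)) with ⟨-, e⟩ | ⟨-, e⟩ <;> rw [e] <;> norm_num
  generalize sgn (faceSgn ε (face x₀ x₁ x₂)) = u at *
  generalize sgn (faceSgn ε (face x₀ x₂ x₃)) = v at *
  field_simp at hdeg e
  have : sgn s * k * g = 0 := by
    linear_combination e + v * hdeg - (u * b * d) * hss
  rcases mul_eq_zero.mp this with h0 | h0
  · exact hs h0
  · exact p₀₂.ne' h0

end Flip

end PuncturedSurface

/-! ### The flip transformation. -/

theorem propositionp (Γ : Subgroup SL(2, ℝ)) (hΓ : IsPuncturedSurfaceGroup Γ)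
    (τ τ' : Set (Orb Γ)) (hτ : IsIdealTriangulation τ) (hτ' : IsIdealTriangulation τ')
    (x₀ x₁ x₂ x₃ : Cusp Γ) (h : IsFlip τ τ' x₀ x₁ x₂ x₃)
    (f : EdgeFun τ) (ε : FaceSign τ) (hf : phi τ f ε ≠ 0) :
    -- the pair `(f, ε)` corresponds to exactly one point of the bundle
    (∃! p : Bundle Γ, Corresponds τ f ε p) ∧
    (∀ (f' : EdgeFun τ') (ε' : FaceSign τ'), phi τ' f' ε' ≠ 0 →
      -- so does the pair `(f', ε')`
      (∃! p : Bundle Γ, Corresponds τ' f' ε' p) ∧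
      -- the two pairs correspond to the same point if and only if the four relations hold
      ((∃ p : Bundle Γ, p.π ∈ moduliOf τ ∩ moduliOf τ' ∧
          Corresponds τ f ε p ∧ Corresponds τ' f' ε' p) ↔
        ((∀ (x : Orb Γ) (hx : x ∈ τ) (hx' : x ∈ τ'), f' ⟨x, hx'⟩ = f ⟨x, hx⟩) ∧
          (∀ (t : Orb Γ) (ht : t ∈ faces τ) (ht' : t ∈ faces τ'), ε' ⟨t, ht'⟩ = ε ⟨t, ht⟩) ∧
          ε' ⟨face x₁ x₃ x₀, h.t₁'.face_mem⟩ * ε' ⟨face x₁ x₂ x₃, h.t₂'.face_mem⟩ =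
            ε ⟨face x₀ x₁ x₂, h.t₁.face_mem⟩ * ε ⟨face x₀ x₂ x₃, h.t₂.face_mem⟩ ∧
          sgn (ε' ⟨face x₁ x₃ x₀, h.t₁'.face_mem⟩) *
              (f ⟨arc x₀ x₂, h.t₂.xy⟩ : ℝ) * (f' ⟨arc x₁ x₃, h.t₁'.xy⟩ : ℝ) =
            sgn (ε ⟨face x₀ x₂ x₃, h.t₂.face_mem⟩) *
                (f ⟨arc x₀ x₁, h.t₁.xy⟩ : ℝ) * (f ⟨arc x₂ x₃, h.t₂.yz⟩ : ℝ) +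
              sgn (ε ⟨face x₀ x₁ x₂, h.t₁.face_mem⟩) *
                (f ⟨arc x₁ x₂, h.t₁.yz⟩ : ℝ) * (f ⟨arc x₃ x₀, h.t₂.zx⟩ : ℝ)))) ∧
    -- in the degenerate case, the point is not over the other chart domain
    (((f ⟨arc x₀ x₁, h.t₁.xy⟩ : ℝ) * (f ⟨arc x₂ x₃, h.t₂.yz⟩ : ℝ)) /
          ((f ⟨arc x₁ x₂, h.t₁.yz⟩ : ℝ) * (f ⟨arc x₃ x₀, h.t₂.zx⟩ : ℝ)) +
        sgn (ε ⟨face x₀ x₁ x₂, h.t₁.face_mem⟩) * sgn (ε ⟨face x₀ x₂ x₃, h.t₂.face_mem⟩) = 0 →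
      ∀ p : Bundle Γ, Corresponds τ f ε p → p.π ∉ moduliOf τ') := by
  have exu : ∀ {σ : Set (Orb Γ)} (_ : IsIdealTriangulation σ) (g : EdgeFun σ) (η : FaceSign σ),
      phi σ g η ≠ 0 → ∃! p : Bundle Γ, Corresponds σ g η p := by
    intro σ hσ g η hg
    obtain ⟨y, hy⟩ := hσ.exists_arc x₀
    obtain ⟨p, hp⟩ := exists_corresponds hσ hΓ.free hg hy
    exact ⟨p, hp, fun q hq => hq.unique hσ hp hy⟩
  refine ⟨exu hτ f ε hf, fun f' ε' hf' => ⟨exu hτ' f' ε' hf', ?_⟩, fun hdeg p hp => ?_⟩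
  · have key : (∃ p : Bundle Γ, p.π ∈ moduliOf τ ∩ moduliOf τ' ∧
        Corresponds τ f ε p ∧ Corresponds τ' f' ε' p) ↔ FlipRelations x₀ x₁ x₂ x₃ f ε f' ε' := by
      constructor
      · rintro ⟨p, -, hp, hp'⟩
        exact hp.flipRelations h hτ hp'
      · intro r
        obtain ⟨p, hp, -⟩ := exu hτ f ε hf
        have hp' := r.corresponds h hτ' hp
        exact ⟨p, ⟨hp.mem, hp'.mem⟩, hp, hp'⟩
    -- What remains is to pass from the extensions by `1` back to functions on edges and faces.
    rw [key, flipRelations_iff h, edgeLen_of_mem f h.t₁.xy, edgeLen_of_mem f h.t₁.yz,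
      edgeLen_of_mem f h.t₂.yz, edgeLen_of_mem f h.t₂.zx, edgeLen_of_mem f h.t₂.xy,
      edgeLen_of_mem f' h.t₁'.xy, faceSgn_of_mem ε h.t₁.face_mem, faceSgn_of_mem ε h.t₂.face_mem,
      faceSgn_of_mem ε' h.t₁'.face_mem, faceSgn_of_mem ε' h.t₂'.face_mem]
    refine and_congr (forall_congr' fun x => forall_congr' fun hx => forall_congr' fun hx' => ?_)
      (and_congr_left' (forall_congr' fun t => forall_congr' fun ht => forall_congr' fun ht' => ?_))
    · rw [edgeLen_of_mem f hx, edgeLen_of_mem f' hx']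
      exact Subtype.ext_iff.symm
    · rw [faceSgn_of_mem ε ht, faceSgn_of_mem ε' ht']
  · refine hp.notMem_of_degenerate h ?_
    rw [edgeLen_of_mem f h.t₁.xy, edgeLen_of_mem f h.t₁.yz, edgeLen_of_mem f h.t₂.yz,
      edgeLen_of_mem f h.t₂.zx, faceSgn_of_mem ε h.t₁.face_mem, faceSgn_of_mem ε h.t₂.face_mem]
    exact hdeg
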